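/- **Setting.** Let $N\ge 2$ be even and let $\phi$ be the (continuous) orthogonal Coiflet scaling function of order $N$ with real filter $p_0,\dots,p_{3N-1}$: $\phi(x)=\sum_k p_k\phi(2x-k)$, $\operatorname{supp}\phi\subset[0,3N-1]$, $\int\phi=1$, integer translates orthonormal, first moment $M_1=\int x\phi$ an integer with $1\le M_1\le 3N-2$, $\int (x-M_1)^k\phi(x)\,dx=0$ for $1\le k<N$, and $\int x^k\psi(x)\,dx=0$ for $0\le k<N$, where $\psi(x)=\sum_k(-1)^kp_{3N-1-k}\phi(2x-k)$. For $0\le i<N$ let $\phi^{(i)}(m)$, $m\in\mathbb Z$, be values of the derivatives at the integers in the usual sense: they vanish for $m\notin[1,3N-2]$, satisfy $\phi^{(i)}(m)=2^i\sum_kp_k\phi^{(i)}(2m-k)$ and $\sum_m(-m)^i\phi^{(i)}(m)=i!$, and are the classical values whenever $\phi\in C^i$. Put $\alpha_1'=M_1-1$, $\alpha_2'=3N-2-M_1$ and, for $0\le i,l<N$, $$S_0=\Big(\sum_{t=-\alpha_2'}^{-1}\tfrac{t^l}{l!}\phi^{(i)}(M_1-t)\Big)_{i,l},\quad S_1=\Big(\sum_{t=1}^{\alpha_1'}\tfrac{t^l}{l!}\phi^{(i)}(M_1-t)\Big)_{i,l},$$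 $$(\zeta_{0,i,k})=(I-S_0)^{-1}(\phi^{(i)}(M_1-k)),\qquad (\zeta_{1,i,k})=(I-S_1)^{-1}(\phi^{(i)}(M_1+k)),$$ where $I-S_0$ and $I-S_1$ are assumed invertible. For a function $h$ let $h^{\int_n}(x)=\int_0^x\int_0^{\xi_n}\cdots\int_0^{\xi_2}h(\xi_1)\,d\xi_1\cdots d\xi_n$, and let $\phi_{j,k}^{\int_n}$ be the $n$-tuple integral of $\xi\mapsto\phi(2^j\xi-k)$. For $0\le k\le 2^j$ put $$\Phi_{j,k}^{\int_n}=\phi_{j,k-M_1}^{\int_n}+\mathbf 1_{k\le\alpha_1'}\sum_{m=-\alpha_2'}^{-1}\Big(\sum_{i<N}\tfrac{\zeta_{0,i,k}}{i!}m^i\Big)\phi_{j,m-M_1}^{\int_n}+\mathbf 1_{k\ge 2^j-\alpha_2'}\sum_{m=1}^{\alpha_1'}\Big(\sum_{i<N}\tfrac{\zeta_{1,i,2^j-k}}{i!}m^i\Big)\phi_{j,2^j+m-M_1}^{\int_n}.$$ **Problem and scheme.** Let $\alpha_0,\dots,\alpha_4\in\mathbb R$, $\alpha_4\neq0$, and consider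 $$\sum_{i=0}^4\alpha_iu^{(i)}=f\ \text{ on }[0,1],\qquad u(0)=a_0,\ u(1)=a_1,\ u''(0)=b_0,\ u''(1)=b_1 .\tag{$*$}$$ The wavelet integral collocation method at level $j$ seeks $\bar U=(\bar U_k)_{0\le k\le 2^j}$ such that, with $J_n(x)=\sum_k\bar U_k\Phi_{j,k}^{\int_n}(x)$, $c_0=a_0$, $c_2=b_0$, $c_3=b_1-b_0-J_2(1)$, $c_1=a_1-a_0-\frac{b_0}2-\frac{c_3}6-J_4(1)$ and $u_i(x)=J_{4-i}(x)+\sum_{n=i}^3\frac{x^{n-i}}{(n-i)!}c_n$, one has $\sum_{i=0}^3\alpha_iu_i(x_l)+\alpha_4\bar U_l=f(x_l)$ for all $x_l=l/2^j$, $0\le l\le2^j$. This is a linear system $A\bar U=G$ with $A=A_j$ depending only on $j$, the Coiflet and its derivative values at the integers, and the $\alpha_i$: $$A_{l,k}=\alpha_4\delta_{l,k}+\sum_{i=0}^3\alpha_i\Phi_{j,k}^{\int_{4-i}}(x_l)-(\alpha_0x_l+\alpha_1)\Phi_{j,k}^{\int_4}(1)-\beta(x_l)\Phi_{j,k}^{\int_2}(1),$$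 $\beta(x)=\frac{\alpha_0x^3}6+\frac{\alpha_1x^2}2+\alpha_2x+\alpha_3-\frac{\alpha_0x+\alpha_1}6$. For a classical solution $u$ of $(*)$ let $U=(u^{(4)}(x_l))_l$. Let $\|\cdot\|_2$ be the Euclidean vector norm and the induced matrix norm. **Theorem.** 1. There is a constant $K$ such that, whenever $2^j\ge3N-2$, $A=\alpha_4I+2^{-j}M$ with all $|M_{l,k}|\le K$. 2. Let $u$ be a solution of $(*)$ with $u\in C^{N+4}[0,1]$ (that is, $u^{(4)}\in C^N[0,1]$). There is $C$ independent of $j$ such that, whenever $2^j\ge 3N-2$, $AU=G+\Delta$ with $|\Delta_l|\le C2^{-jN}$ for all $l$, and, if $A$ is invertible, $$(2^j+1)^{-1/2}\|U-\bar U\|_2\le C\,2^{-jN}\|A^{-1}\|_2 .$$ If moreover $u^{(N+4)}$ is Hölder continuous with exponent $1/2$ on $[0,1]$ (e.g. $u\in C^{N+5}[0,1]$), then, with another $C$ and for the same $j$, also without the mesh weight $$\|U-\bar U\|_2\le C\,2^{-jN}\|A^{-1}\|_2 .$$ 3. Suppose that the homogeneous problem ($f=0$, $a_0=a_1=b_0=b_1=0$)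 has only the zero solution. Then there are $B,j_0$ such that for all $j\ge j_0$ the matrix $A$ is invertible and $\|A^{-1}\|_2\le B$. Consequently, for every solution $u\in C^{N+4}[0,1]$ of $(*)$ and all large $j$, the scheme has exactly one solution $\bar U$ and $(2^j+1)^{-1/2}\|U-\bar U\|_2=O(2^{-jN})$; if moreover $u^{(N+4)}$ is Hölder continuous with exponent $1/2$, then $\|U-\bar U\|_2=O(2^{-jN})$. So the method has order $N$. -/

import Mathlib

open MeasureTheory Set Matrix

noncomputable section

namespace WICM

/-! ### Multiple integrals and Coiflets -/

/-- The `n`-tuple integral `∫₀ˣ ∫₀^{ξₙ} ⋯ ∫₀^{ξ₂} f(ξ₁) dξ₁ ⋯ dξₙ`. -/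
def multInt : ℕ → (ℝ → ℝ) → ℝ → ℝ
  | 0, f => f
  | n + 1, f => fun x => ∫ t in (0 : ℝ)..x, multInt n f t

/-- The wavelet function `ψ(x) = ∑ₖ (-1)ᵏ p_{3N-1-k} φ(2x - k)` of a scaling function with filter
`p₀, …, p_{3N-1}`. -/
def wavelet (N : ℕ) (p : ℕ → ℝ) (φ : ℝ → ℝ) (x : ℝ) : ℝ :=
  ∑ k ∈ Finset.range (3 * N), (-1 : ℝ) ^ k * p (3 * N - 1 - k) * φ (2 * x - k)

/-- `φ` is the orthogonal scaling function of a Coiflet of order `N` with filter coefficients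
`p₀, …, p_{3N-1}`, support `[0, 3N-1]` and integer first moment `M₁` lying inside the support. -/
structure IsCoiflet (N M₁ : ℕ) (p : ℕ → ℝ) (φ : ℝ → ℝ) : Prop where
  continuous : Continuous φ
  support : ∀ x, φ x ≠ 0 → x ∈ Icc (0 : ℝ) (3 * N - 1)
  refinement : ∀ x, φ x = ∑ k ∈ Finset.range (3 * N), p k * φ (2 * x - k)
  integral_eq_one : ∫ x, φ x = 1
  orthonormal : ∀ n : ℤ, ∫ x, φ x * φ (x - n) = if n = 0 then 1 else 0
  first_moment : ∫ x, x * φ x = M₁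
  shifted_moments : ∀ k, 1 ≤ k → k < N → ∫ x, (x - M₁) ^ k * φ x = 0
  wavelet_moments : ∀ k, k < N → ∫ x, x ^ k * wavelet N p φ x = 0
  moment_pos : 1 ≤ M₁
  moment_le : M₁ ≤ 3 * N - 2

/-- `d i m` are the values `φ^{(i)}(m)`, `i < N`, of the derivatives of the scaling function at the
integers.  As usual for compactly supported scaling functions they are the solution of the
differentiated two-scale relation `φ^{(i)}(m) = 2ⁱ ∑ₖ pₖ φ^{(i)}(2m - k)` that vanishes outside
the open support and is normalized by the `i`-th derivative of the expansion of the monomial `xⁱ`;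
they are the classical derivatives whenever `φ` is of class `Cⁱ`. -/
structure IsIntegerDerivs (N : ℕ) (p : ℕ → ℝ) (φ : ℝ → ℝ) (d : ℕ → ℤ → ℝ) : Prop where
  support : ∀ i < N, ∀ m : ℤ, d i m ≠ 0 → 1 ≤ m ∧ m ≤ 3 * N - 2
  refinement : ∀ i < N, ∀ m : ℤ,
    d i m = 2 ^ i * ∑ k ∈ Finset.range (3 * N), p k * d i (2 * m - k)
  normalized : ∀ i < N, ∑ m ∈ Finset.Icc (1 : ℤ) (3 * N - 2), (-(m : ℝ)) ^ i * d i m = i.factorial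
  classical : ∀ i < N, ContDiff ℝ i φ → ∀ m : ℤ, d i m = iteratedDeriv i φ m

/-! ### Boundary extension

`α₁ = M₁ - 1` and `α₂ = 3N - 2 - M₁` are the numbers of exterior nodes that interact with `[0, 1]`
at the right and at the left end. -/

/-- `S₀ = (∑_{t=-α₂}^{-1} tˡ/l! φ^{(i)}(M₁ - t))_{i,l}`, written with `-t` in place of `t`. -/
def S₀ (N M₁ : ℕ) (d : ℕ → ℤ → ℝ) : Matrix (Fin N) (Fin N) ℝ :=
  Matrix.of fun i l => ∑ t ∈ Finset.Icc 1 (3 * N - 2 - M₁),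
    (-(t : ℝ)) ^ (l : ℕ) / (l : ℕ).factorial * d i ((M₁ : ℤ) + t)

/-- `S₁ = (∑_{t=1}^{α₁} tˡ/l! φ^{(i)}(M₁ - t))_{i,l}`. -/
def S₁ (N M₁ : ℕ) (d : ℕ → ℤ → ℝ) : Matrix (Fin N) (Fin N) ℝ :=
  Matrix.of fun i l => ∑ t ∈ Finset.Icc 1 (M₁ - 1),
    (t : ℝ) ^ (l : ℕ) / (l : ℕ).factorial * d i ((M₁ : ℤ) - t)

/-- `ζ_{0,i,k}`: the entries of `P₀ = (I - S₀)⁻¹ R₀`, `R₀ = (φ^{(i)}(M₁ - k))_{i,k}`. -/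
def ζ₀ (N M₁ : ℕ) (d : ℕ → ℤ → ℝ) (i : Fin N) (k : ℕ) : ℝ :=
  ((1 - S₀ N M₁ d)⁻¹ *ᵥ fun l : Fin N => d l ((M₁ : ℤ) - k)) i

/-- `ζ_{1,i,k}`: the entries of `P₁ = (I - S₁)⁻¹ R₁`, `R₁ = (φ^{(i)}(k + M₁))_{i,k}`. -/
def ζ₁ (N M₁ : ℕ) (d : ℕ → ℤ → ℝ) (i : Fin N) (k : ℕ) : ℝ :=
  ((1 - S₁ N M₁ d)⁻¹ *ᵥ fun l : Fin N => d l ((M₁ : ℤ) + k)) i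

/-- `T_{L,k}(x)`: the weight of the nodal value `f(k/2ʲ)` in the extension of `f` to `x < 0`. -/
def TL (N M₁ : ℕ) (d : ℕ → ℤ → ℝ) (j k : ℕ) (x : ℝ) : ℝ :=
  ∑ i : Fin N, (2 : ℝ) ^ ((i : ℕ) * j) * ζ₀ N M₁ d i k / (i : ℕ).factorial * x ^ (i : ℕ)

/-- `T_{R,k}(x)`: the weight of the nodal value `f(1 - k/2ʲ)` in the extension of `f` to `x > 1`. -/
def TR (N M₁ : ℕ) (d : ℕ → ℤ → ℝ) (j k : ℕ) (x : ℝ) : ℝ :=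
  ∑ i : Fin N, (2 : ℝ) ^ ((i : ℕ) * j) * ζ₁ N M₁ d i k / (i : ℕ).factorial * (x - 1) ^ (i : ℕ)

/-- The `n`-tuple integral of `ξ ↦ φ(2ʲ ξ - k)`. -/
def φInt (φ : ℝ → ℝ) (n j : ℕ) (k : ℤ) : ℝ → ℝ :=
  multInt n fun ξ => φ (2 ^ j * ξ - k)

/-- The `n`-tuple integral `Φ_{j,k}^{∫n}` of the boundary-modified basis function that belongs to
the node `k / 2ʲ`, `0 ≤ k ≤ 2ʲ`. -/
def ΦInt (N M₁ : ℕ) (φ : ℝ → ℝ) (d : ℕ → ℤ → ℝ) (n j k : ℕ) (x : ℝ) : ℝ :=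
  φInt φ n j ((k : ℤ) - M₁) x
    + (if k ≤ M₁ - 1 then
        ∑ m ∈ Finset.Icc 1 (3 * N - 2 - M₁),
          TL N M₁ d j k (-(m : ℝ) / 2 ^ j) * φInt φ n j (-(m : ℤ) - M₁) x
      else 0)
    + (if 2 ^ j ≤ k + (3 * N - 2 - M₁) then
        ∑ m ∈ Finset.Icc 1 (M₁ - 1),
          TR N M₁ d j (2 ^ j - k) (1 + (m : ℝ) / 2 ^ j) * φInt φ n j ((2 : ℤ) ^ j + m - M₁) x
      else 0)

/-! ### The boundary value problem and the collocation scheme -/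

/-- `u` is a classical solution on `[0, 1]` of `∑_{i ≤ 4} αᵢ u⁽ⁱ⁾ = f`, `u(0) = a₀`, `u(1) = a₁`,
`u''(0) = b₀`, `u''(1) = b₁`. -/
structure IsSolution (α : Fin 5 → ℝ) (f : ℝ → ℝ) (a₀ a₁ b₀ b₁ : ℝ) (u : ℝ → ℝ) : Prop where
  contDiffOn : ContDiffOn ℝ 4 u (Icc 0 1)
  equation : ∀ x ∈ Icc (0 : ℝ) 1,
    ∑ i : Fin 5, α i * iteratedDerivWithin (i : ℕ) u (Icc 0 1) x = f x
  left : u 0 = a₀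
  right : u 1 = a₁
  left₂ : iteratedDerivWithin 2 u (Icc 0 1) 0 = b₀
  right₂ : iteratedDerivWithin 2 u (Icc 0 1) 1 = b₁

/-- The collocation point `l / 2ʲ`. -/
def node (j : ℕ) (l : Fin (2 ^ j + 1)) : ℝ := (l : ℝ) / 2 ^ j

/-- The vector `U` of the exact values of `u₄ = u''''` at the collocation points. -/
def exactNodal (u : ℝ → ℝ) (j : ℕ) (l : Fin (2 ^ j + 1)) : ℝ :=
  iteratedDerivWithin 4 u (Icc 0 1) (node j l)

/-- The approximation `∑ₖ vₖ Φ_{j,k}^{∫n}(x)` of the `n`-tuple integral of the function with nodal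
values `v`. -/
def approxInt (N M₁ : ℕ) (φ : ℝ → ℝ) (d : ℕ → ℤ → ℝ) (n j : ℕ) (v : Fin (2 ^ j + 1) → ℝ)
    (x : ℝ) : ℝ :=
  ∑ k, v k * ΦInt N M₁ φ d n j k x

/-- The approximate value of `u'''(0)` determined by
`u''(1) = u₄^{∫2}(1) + u''(0) + u'''(0)`. -/
def initU₃ (N M₁ : ℕ) (φ : ℝ → ℝ) (d : ℕ → ℤ → ℝ) (b₀ b₁ : ℝ) (j : ℕ)
    (v : Fin (2 ^ j + 1) → ℝ) : ℝ :=
  b₁ - b₀ - approxInt N M₁ φ d 2 j v 1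

/-- The approximate value of `u'(0)` determined by
`u(1) = u₄^{∫4}(1) + u(0) + u'(0) + u''(0)/2 + u'''(0)/6`. -/
def initU₁ (N M₁ : ℕ) (φ : ℝ → ℝ) (d : ℕ → ℤ → ℝ) (a₀ a₁ b₀ b₁ : ℝ) (j : ℕ)
    (v : Fin (2 ^ j + 1) → ℝ) : ℝ :=
  a₁ - a₀ - b₀ / 2 - initU₃ N M₁ φ d b₀ b₁ j v / 6 - approxInt N M₁ φ d 4 j v 1

/-- The (approximate) initial values `uₙ(0)`, `n = 0, 1, 2, 3`. -/
def initVals (N M₁ : ℕ) (φ : ℝ → ℝ) (d : ℕ → ℤ → ℝ) (a₀ a₁ b₀ b₁ : ℝ) (j : ℕ)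
    (v : Fin (2 ^ j + 1) → ℝ) : ℕ → ℝ
  | 0 => a₀
  | 1 => initU₁ N M₁ φ d a₀ a₁ b₀ b₁ j v
  | 2 => b₀
  | _ => initU₃ N M₁ φ d b₀ b₁ j v

/-- The approximations `u₀, u₁, u₂, u₃` of `u, u', u'', u'''` obtained from nodal values `v` of
`u''''`: `uᵢ(x) = ∑ₖ vₖ Φ_{j,k}^{∫(4-i)}(x) + ∑_{n=i}^{3} x^{n-i}/(n-i)! uₙ(0)`. -/
def approxDeriv (N M₁ : ℕ) (φ : ℝ → ℝ) (d : ℕ → ℤ → ℝ) (a₀ a₁ b₀ b₁ : ℝ) (j : ℕ)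
    (v : Fin (2 ^ j + 1) → ℝ) (i : ℕ) (x : ℝ) : ℝ :=
  approxInt N M₁ φ d (4 - i) j v x
    + ∑ n ∈ Finset.Icc i 3, x ^ (n - i) / (n - i).factorial *
        initVals N M₁ φ d a₀ a₁ b₀ b₁ j v n

/-- `v` solves the wavelet integral collocation scheme at resolution level `j`: the equation
`∑_{i ≤ 3} αᵢ uᵢ + α₄ u₄ = f` holds at all collocation points. -/
def IsWICMSolution (N M₁ : ℕ) (φ : ℝ → ℝ) (d : ℕ → ℤ → ℝ) (α : Fin 5 → ℝ) (f : ℝ → ℝ)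
    (a₀ a₁ b₀ b₁ : ℝ) (j : ℕ) (v : Fin (2 ^ j + 1) → ℝ) : Prop :=
  ∀ l, α 0 * approxDeriv N M₁ φ d a₀ a₁ b₀ b₁ j v 0 (node j l)
      + α 1 * approxDeriv N M₁ φ d a₀ a₁ b₀ b₁ j v 1 (node j l)
      + α 2 * approxDeriv N M₁ φ d a₀ a₁ b₀ b₁ j v 2 (node j l)
      + α 3 * approxDeriv N M₁ φ d a₀ a₁ b₀ b₁ j v 3 (node j l)
      + α 4 * v l = f (node j l)

/-- The coefficient of `u'(0)` after expressing `u, …, u'''` through `u''''`. -/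
def coeff₁ (α : Fin 5 → ℝ) (x : ℝ) : ℝ := α 0 * x + α 1

/-- The coefficient of `u'''(0)` after expressing `u, …, u'''` through `u''''`. -/
def coeff₃ (α : Fin 5 → ℝ) (x : ℝ) : ℝ := α 0 * x ^ 3 / 6 + α 1 * x ^ 2 / 2 + α 2 * x + α 3

/-- The collocation matrix `A`. -/
def colMatrix (N M₁ : ℕ) (φ : ℝ → ℝ) (d : ℕ → ℤ → ℝ) (α : Fin 5 → ℝ) (j : ℕ) :
    Matrix (Fin (2 ^ j + 1)) (Fin (2 ^ j + 1)) ℝ :=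
  Matrix.of fun l k =>
    (if l = k then α 4 else 0)
      + (α 0 * ΦInt N M₁ φ d 4 j k (node j l) + α 1 * ΦInt N M₁ φ d 3 j k (node j l)
        + α 2 * ΦInt N M₁ φ d 2 j k (node j l) + α 3 * ΦInt N M₁ φ d 1 j k (node j l))
      - coeff₁ α (node j l) * ΦInt N M₁ φ d 4 j k 1
      - (coeff₃ α (node j l) - coeff₁ α (node j l) / 6) * ΦInt N M₁ φ d 2 j k 1

/-- The right-hand side `G` of the collocation system `A Ū = G`. -/
def colRhs (α : Fin 5 → ℝ) (f : ℝ → ℝ) (a₀ a₁ b₀ b₁ : ℝ) (j : ℕ) (l : Fin (2 ^ j + 1)) : ℝ :=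
  f (node j l) - α 0 * a₀
    - b₀ * (α 0 * node j l ^ 2 / 2 + α 1 * node j l + α 2)
    - coeff₁ α (node j l) * (a₁ - a₀ - b₀ / 2 - (b₁ - b₀) / 6)
    - coeff₃ α (node j l) * (b₁ - b₀)

/-- Consistency of the definitions: the scheme is the linear system `A v = G`. -/
theorem isWICMSolution_iff (N M₁ : ℕ) (φ : ℝ → ℝ) (d : ℕ → ℤ → ℝ) (α : Fin 5 → ℝ) (f : ℝ → ℝ)
    (a₀ a₁ b₀ b₁ : ℝ) (j : ℕ) (v : Fin (2 ^ j + 1) → ℝ) :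
    IsWICMSolution N M₁ φ d α f a₀ a₁ b₀ b₁ j v ↔
      colMatrix N M₁ φ d α j *ᵥ v = colRhs α f a₀ a₁ b₀ b₁ j := by
  have key : ∀ l, (colMatrix N M₁ φ d α j *ᵥ v) l =
      α 4 * v l + (α 0 * approxInt N M₁ φ d 4 j v (node j l)
        + α 1 * approxInt N M₁ φ d 3 j v (node j l) + α 2 * approxInt N M₁ φ d 2 j v (node j l)
        + α 3 * approxInt N M₁ φ d 1 j v (node j l))
      - coeff₁ α (node j l) * approxInt N M₁ φ d 4 j v 1
      - (coeff₃ α (node j l) - coeff₁ α (node j l) / 6) * approxInt N M₁ φ d 2 j v 1 := by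
    intro l
    have h4 : α 4 * v l = ∑ k, (if l = k then α 4 else 0) * v k := by simp
    rw [h4]
    simp only [Matrix.mulVec, dotProduct, colMatrix, Matrix.of_apply, approxInt, Finset.mul_sum]
    simp only [← Finset.sum_add_distrib, ← Finset.sum_sub_distrib]
    exact Finset.sum_congr rfl fun k _ => by ring
  rw [funext_iff]
  refine forall_congr' fun l => ?_
  rw [key]
  have e0 : Finset.Icc 0 3 = {0, 1, 2, 3} := by decide
  have e1 : Finset.Icc 1 3 = {1, 2, 3} := by decide
  have e2 : Finset.Icc 2 3 = {2, 3} := by decide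
  have e3 : Finset.Icc 3 3 = {3} := by decide
  simp only [approxDeriv, e0, e1, e2, e3, colRhs, coeff₁, coeff₃]
  norm_num [Nat.factorial, initVals, initU₁, initU₃]
  constructor <;> intro h <;> linear_combination h

/-- The Euclidean norm of a vector. -/
def vecNorm {ι : Type*} [Fintype ι] (v : ι → ℝ) : ℝ := ‖WithLp.toLp 2 v‖

/-- The matrix norm induced by the Euclidean vector norm. -/
def matNorm {ι : Type*} [Fintype ι] [DecidableEq ι] (A : Matrix ι ι ℝ) : ℝ :=
  ‖Matrix.toEuclideanCLM (n := ι) (𝕜 := ℝ) A‖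

end WICM

end

noncomputable section

namespace WICM

/-! ### Moments of the scaling function and sum rules of the filter -/

section Moments

variable {N M₁ : ℕ} {p : ℕ → ℝ} {φ : ℝ → ℝ}

/-! Two features of the Coiflet drive the proof. The first is that the nodal values of a polynomial
of degree below `N` already are its expansion coefficients. The vanishing moments of φ and of the
wavelet yield sum rules for the filter on each residue class modulo two. These rules give the
periodized moments P_i(y) = ∑ (y-k)^i φ(y-k+M₁) the self-similarity P_i(y) = 2^{-i} P_i(2y). Since
P_i is bounded, it vanishes for 0 < i < N, while P_0 = 1. The same two-scale identity
(`IsCoiflet.tsum_two_scale`), applied to the derivative values at the integers, determines their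
discrete moments. Hence the weights ζ differentiate polynomials exactly at the end points, and the
boundary-modified basis reproduces degree below `N` on all of [0,1] (`IsCoiflet.sum_pow_mul_ΦInt`).
A Lebesgue function bounded uniformly in j turns this into a pointwise error O(2^{-jN}).

The second feature is that the N-th power is reproduced, away from the boundary, up to the periodic
function P_N, and P_N has mean zero when `N` is even (`IsCoiflet.integral_periodicMoment_order`, a
consequence of orthonormality). The leading error thus cancels over each interior cell.

Integrating the boundary value problem gives α₄ g + T(∫g) = data with g = u'''' and T = `lowerOp`,
an operator bounded in the sup norm. The matrix has the same form, with g replaced inside the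
integral by its wavelet approximation, so the residual is T applied to the primitive of the
approximation error (`IsCoiflet.residual_eq`). It is O(2^{-jN}) in general. If the top derivative is
Hölder 1/2, cancellation over cells gains a factor 2^{-j/2}, which pays for the factor √(2^j+1)
between the maximum and the Euclidean norm.

Stability (`IsCoiflet.stability`) is a compactness argument. If it failed, there would be vectors of
mesh-weighted norm one with A v → 0. Their primitives are uniformly Hölder 1/2, so a subsequence
converges uniformly to some G. The equation then forces v to be close to the samples of g =
-T(G)/α₄, whence G = ∫g and α₄ g + T(∫g) = 0. Unique solvability gives g = 0, contradicting the
normalization. -/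

lemma IsCoiflet.eq_zero (hφ : IsCoiflet N M₁ p φ) {x : ℝ} (hx : x ∉ Icc (0 : ℝ) (3 * N - 1)) :
    φ x = 0 := by
  by_contra h
  exact hx (hφ.support x h)

lemma IsCoiflet.hasCompactSupport (hφ : IsCoiflet N M₁ p φ) : HasCompactSupport φ :=
  HasCompactSupport.intro isCompact_Icc fun _ hx => hφ.eq_zero hx

lemma IsCoiflet.integrable_mul (hφ : IsCoiflet N M₁ p φ) {G : ℝ → ℝ} (hG : Continuous G) :
    Integrable fun x => G x * φ x :=
  (hG.mul hφ.continuous).integrable_of_hasCompactSupport hφ.hasCompactSupport.mul_left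

lemma IsCoiflet.moment_eq (hφ : IsCoiflet N M₁ p φ) {k : ℕ} (hk : k < N) :
    ∫ x, (x - M₁) ^ k * φ x = if k = 0 then 1 else 0 := by
  split_ifs with h
  · subst h
    simpa using hφ.integral_eq_one
  · exact hφ.shifted_moments k (by omega) hk

/-- In the binomial expansion only the moment of order zero survives: integrating a polynomial of
degree below `N` against φ evaluates it at M₁. -/
lemma IsCoiflet.moment_translate (hφ : IsCoiflet N M₁ p φ) {m : ℕ} (hm : m < N) (c : ℝ) :
    ∫ y, ((y - M₁) + c) ^ m * φ y = c ^ m := by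
  have h1 : ∀ y : ℝ, ((y - M₁) + c) ^ m * φ y =
      ∑ s ∈ Finset.range (m + 1), c ^ (m - s) * (m.choose s) * ((y - M₁) ^ s * φ y) := by
    intro y
    rw [add_pow, Finset.sum_mul]
    exact Finset.sum_congr rfl fun s _ => by ring
  simp_rw [h1]
  rw [integral_finsetSum]
  · rw [Finset.sum_eq_single 0]
    · rw [integral_const_mul, hφ.moment_eq (by omega)]
      simp
    · intro s hs h0
      rw [Finset.mem_range] at hs
      rw [integral_const_mul, hφ.moment_eq (by omega), if_neg h0, mul_zero]
    · simp
  · intro s _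
    exact (hφ.integrable_mul (by fun_prop)).const_mul _

lemma integral_mul_comp_two_mul_sub (φ G : ℝ → ℝ) (c : ℝ) :
    ∫ x, G x * φ (2 * x - c) = 1 / 2 * ∫ y, G ((y + c) / 2) * φ y := by
  have h1 := Measure.integral_comp_mul_left (fun y => G ((y - c + c) / 2) * φ (y - c)) 2
  have h2 := integral_sub_right_eq_self (μ := volume) (fun y => G ((y + c) / 2) * φ y) c
  rw [← h2]
  norm_num at h1 ⊢
  rw [← h1]

lemma IsCoiflet.integrable_mul_comp (hφ : IsCoiflet N M₁ p φ) {G : ℝ → ℝ} (hG : Continuous G)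
    (c : ℝ) : Integrable fun x => G x * φ (2 * x - c) := by
  have h : HasCompactSupport fun x : ℝ => φ (2 * x - c) := by
    refine HasCompactSupport.intro (isCompact_Icc (a := c / 2) (b := (3 * N - 1 + c) / 2)) ?_
    intro x hx
    refine hφ.eq_zero fun h => hx ⟨?_, ?_⟩
    · linarith [h.1]
    · linarith [h.2]
  exact (hG.mul (hφ.continuous.comp (by fun_prop))).integrable_of_hasCompactSupport h.mul_left

lemma IsCoiflet.integral_pow_comp (hφ : IsCoiflet N M₁ p φ) {m : ℕ} (hm : m < N) (a c : ℝ) :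
    ∫ x, (x - a) ^ m * φ (2 * x - c) = (1 / 2) ^ (m + 1) * (M₁ + c - 2 * a) ^ m := by
  rw [integral_mul_comp_two_mul_sub φ (fun x => (x - a) ^ m) c]
  have h1 : ∀ y : ℝ, ((y + c) / 2 - a) ^ m * φ y =
      (1 / 2) ^ m * (((y - M₁) + (M₁ + c - 2 * a)) ^ m * φ y) := by
    intro y
    rw [← mul_assoc, ← mul_pow]
    ring_nf
  simp_rw [h1]
  rw [integral_const_mul, hφ.moment_translate hm]
  ring

/-- Inserting the refinement equation into the m-th shifted moment turns each φ(2x-k) into a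
multiple of (k-M₁)^m, so the filter inherits the vanishing moments of φ. -/
lemma IsCoiflet.sum_filter (hφ : IsCoiflet N M₁ p φ) {m : ℕ} (hm : m < N) :
    ∑ k ∈ Finset.range (3 * N), p k * ((k : ℝ) - M₁) ^ m = if m = 0 then 2 else 0 := by
  have h := hφ.moment_eq hm
  have h1 : ∀ x : ℝ, (x - M₁) ^ m * φ x =
      ∑ k ∈ Finset.range (3 * N), p k * ((x - M₁) ^ m * φ (2 * x - k)) := by
    intro x
    conv_lhs => rw [hφ.refinement x]
    rw [Finset.mul_sum]
    exact Finset.sum_congr rfl fun s _ => by ring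
  simp_rw [h1] at h
  rw [integral_finsetSum _ fun (k : ℕ) _ =>
    (hφ.integrable_mul_comp (G := fun x => (x - M₁) ^ m) (by fun_prop) k).const_mul _] at h
  simp_rw [integral_const_mul, hφ.integral_pow_comp hm] at h
  have h2 : ∀ k : ℕ, p k * ((1 / 2) ^ (m + 1) * ((M₁ : ℝ) + k - 2 * M₁) ^ m) =
      (1 / 2) ^ (m + 1) * (p k * ((k : ℝ) - M₁) ^ m) := by
    intro k
    rw [show (M₁ : ℝ) + k - 2 * M₁ = k - M₁ by ring]
    ring
  simp_rw [h2, ← Finset.mul_sum] at h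
  split_ifs at h ⊢ with h0
  · subst h0
    norm_num at h ⊢
    linarith
  · simpa using h

/-- These are the wavelet moments after the reflection k ↦ 3N-1-k, which undoes the reversal of the
filter and produces the centre M₁+3N-1. -/
lemma IsCoiflet.alternating_sum_reflected (hφ : IsCoiflet N M₁ p φ) {m : ℕ} (hm : m < N) :
    ∑ k ∈ Finset.range (3 * N), (-1 : ℝ) ^ k * p k * (M₁ + (3 * N - 1) - k) ^ m = 0 := by
  have h := hφ.wavelet_moments m hm
  have h1 : ∀ x : ℝ, x ^ m * wavelet N p φ x = ∑ k ∈ Finset.range (3 * N),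
      ((-1 : ℝ) ^ k * p (3 * N - 1 - k)) * ((x - 0) ^ m * φ (2 * x - k)) := by
    intro x
    rw [wavelet, Finset.mul_sum]
    exact Finset.sum_congr rfl fun s _ => by ring
  simp_rw [h1] at h
  rw [integral_finsetSum _ fun (k : ℕ) _ =>
    (hφ.integrable_mul_comp (G := fun x => (x - 0) ^ m) (by fun_prop) k).const_mul _] at h
  simp_rw [integral_const_mul, hφ.integral_pow_comp hm] at h
  rw [← Finset.sum_range_reflect] at h
  have h2 : ∀ k ∈ Finset.range (3 * N),
      (-1 : ℝ) ^ (3 * N - 1 - k) * p (3 * N - 1 - (3 * N - 1 - k)) *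
        ((1 / 2) ^ (m + 1) * ((M₁ : ℝ) + ((3 * N - 1 - k : ℕ) : ℝ) - 2 * 0) ^ m) =
      ((-1) ^ (3 * N - 1) * (1 / 2) ^ (m + 1)) *
        ((-1 : ℝ) ^ k * p k * (M₁ + (3 * N - 1) - k) ^ m) := by
    intro k hk
    rw [Finset.mem_range] at hk
    have e1 : (-1 : ℝ) ^ (3 * N - 1 - k) = (-1) ^ (3 * N - 1) * (-1) ^ k := by
      rw [← pow_add, show 3 * N - 1 + k = (3 * N - 1 - k) + 2 * k by omega, pow_add _ _ (2 * k),
        pow_mul]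
      simp
    have e2 : ((3 * N - 1 - k : ℕ) : ℝ) = 3 * N - 1 - k := by
      rw [Nat.cast_sub (by omega), Nat.cast_sub (by omega)]
      push_cast
      ring
    rw [e1, e2, show 3 * N - 1 - (3 * N - 1 - k) = k by omega]
    ring
  rw [Finset.sum_congr rfl h2, ← Finset.mul_sum] at h
  rcases mul_eq_zero.1 h with h | h
  · exact absurd h (by positivity)
  · exact h

/-- Vanishing of all powers below `N` survives an affine change of variable, here from M₁+3N-1-k to
k-M₁. -/
lemma IsCoiflet.alternating_sum (hφ : IsCoiflet N M₁ p φ) {m : ℕ} (hm : m < N) :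
    ∑ k ∈ Finset.range (3 * N), (-1 : ℝ) ^ k * p k * ((k : ℝ) - M₁) ^ m = 0 := by
  have h1 : ∀ k : ℕ, (-1 : ℝ) ^ k * p k * ((k : ℝ) - M₁) ^ m =
      ∑ s ∈ Finset.range (m + 1), ((-1) ^ s * (3 * N - 1) ^ (m - s) * m.choose s) *
        ((-1 : ℝ) ^ k * p k * (M₁ + (3 * N - 1) - k) ^ s) := by
    intro k
    rw [show (k : ℝ) - M₁ = (-1) * (M₁ + (3 * N - 1) - k) + (3 * N - 1) by ring, add_pow,
      Finset.mul_sum]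
    refine Finset.sum_congr rfl fun s _ => ?_
    rw [mul_pow]
    ring
  simp_rw [h1]
  rw [Finset.sum_comm]
  refine Finset.sum_eq_zero fun s hs => ?_
  rw [Finset.mem_range] at hs
  rw [← Finset.mul_sum, hφ.alternating_sum_reflected (by omega), mul_zero]

/-- The sum rules of the filter restricted to one residue class modulo two. -/
lemma IsCoiflet.sum_filter_parity (hφ : IsCoiflet N M₁ p φ) {m : ℕ} (hm : m < N) (r : ℤ) :
    ∑ k ∈ Finset.range (3 * N), (if Even (r - k) then p k * ((k : ℝ) - M₁) ^ m else 0)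
      = if m = 0 then 1 else 0 := by
  -- The indicator of a parity class is the mean of 1 and ±(-1)^k, with sign given by the parity of
  -- r.
  have h1 : ∀ k : ℕ, (if Even (r - k) then p k * ((k : ℝ) - M₁) ^ m else 0) =
      (1 / 2) * (p k * ((k : ℝ) - M₁) ^ m)
        + (1 / 2 * if Even r then 1 else -1) * ((-1 : ℝ) ^ k * p k * ((k : ℝ) - M₁) ^ m) := by
    intro k
    have hpar : Even (r - k) ↔ (Even r ↔ Even k) := by rw [Int.even_sub, Int.even_coe_nat]
    simp only [hpar]
    rcases Nat.even_or_odd k with hk | hk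
    · by_cases hr : Even r <;> simp [hk, hr, hk.neg_one_pow]
      ring
    · have hk' := Nat.not_even_iff_odd.2 hk
      by_cases hr : Even r <;> simp [hk', hr, hk.neg_one_pow]
      ring
  simp_rw [h1]
  rw [Finset.sum_add_distrib, ← Finset.mul_sum, ← Finset.mul_sum, hφ.sum_filter hm,
    hφ.alternating_sum hm]
  split_ifs <;> norm_num

end Moments

/-! ### Periodized moments and the two-scale relation -/

section TwoScale

variable {N M₁ : ℕ} {p : ℕ → ℝ} {φ : ℝ → ℝ}

lemma tsum_comp_two_mul_add (h : ℤ → ℝ) (c : ℤ) :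
    ∑' n : ℤ, h (2 * n + c) = ∑' r : ℤ, if Even (r - c) then h r else 0 := by
  have hinj : Function.Injective fun n : ℤ => 2 * n + c := fun a b hab => by
    simp only at hab
    omega
  rw [← hinj.tsum_eq (f := fun r : ℤ => if Even (r - c) then h r else 0)]
  · refine tsum_congr fun n => ?_
    rw [if_pos]
    exact ⟨n, by ring⟩
  · intro r hr
    have h1 : Even (r - c) := by
      by_contra h1
      simp [h1] at hr
    obtain ⟨n, hn⟩ := h1
    exact ⟨n, by simp only; omega⟩

lemma summable_mul_of_finite_support {F : ℤ → ℝ} (hF : F.support.Finite) (G : ℤ → ℝ) :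
    Summable fun r => G r * F r := by
  refine summable_of_hasFiniteSupport (hF.subset fun r hr => ?_)
  exact right_ne_zero_of_mul hr

/-- Averaging the sum rules: the local form of the reproduction of polynomials. -/
lemma IsCoiflet.sum_filter_parity_add (hφ : IsCoiflet N M₁ p φ) {i : ℕ} (hi : i < N) (r : ℤ)
    (b : ℝ) :
    ∑ k ∈ Finset.range (3 * N), (if Even (r - k) then p k * (b + ((k : ℝ) - M₁)) ^ i else 0)
      = b ^ i := by
  have h1 : ∀ k : ℕ, (if Even (r - k) then p k * (b + ((k : ℝ) - M₁)) ^ i else 0) =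
      ∑ s ∈ Finset.range (i + 1), (b ^ (i - s) * i.choose s) *
        (if Even (r - k) then p k * ((k : ℝ) - M₁) ^ s else 0) := by
    intro k
    split_ifs
    · rw [add_comm b, add_pow, Finset.mul_sum]
      exact Finset.sum_congr rfl fun s _ => by ring
    · simp
  simp_rw [h1]
  rw [Finset.sum_comm]
  simp_rw [← Finset.mul_sum]
  rw [Finset.sum_eq_single 0]
  · rw [hφ.sum_filter_parity (by omega)]
    simp
  · intro s hs h0
    rw [Finset.mem_range] at hs
    rw [hφ.sum_filter_parity (by omega), if_neg h0, mul_zero]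
  · simp

/-- With r = 2n-M₁+k held fixed, k runs through one parity class, and the sum rule collapses its
contribution to (a-r)^i. The function `F` is left arbitrary because the identity is needed both for
translates of φ at a real point and for derivative values at the integers. -/
lemma IsCoiflet.tsum_two_scale (hφ : IsCoiflet N M₁ p φ) {i : ℕ} (hi : i < N) (a : ℝ)
    {F : ℤ → ℝ} (hF : F.support.Finite) :
    ∑' n : ℤ, ((a - 2 * n) / 2) ^ i * ∑ k ∈ Finset.range (3 * N), p k * F (2 * n - M₁ + k)
      = (1 / 2) ^ i * ∑' r : ℤ, (a - r) ^ i * F r := by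
  set f : ℕ → ℤ → ℝ := fun k r => p k * ((a - r + (k - M₁)) / 2) ^ i * F r with hf
  have h1 : ∀ n : ℤ, ((a - 2 * n) / 2) ^ i * ∑ k ∈ Finset.range (3 * N), p k * F (2 * n - M₁ + k)
      = ∑ k ∈ Finset.range (3 * N), f k (2 * n + ((k : ℤ) - M₁)) := by
    intro n
    rw [Finset.mul_sum]
    refine Finset.sum_congr rfl fun k _ => ?_
    simp only [hf]
    rw [show 2 * n - (M₁ : ℤ) + k = 2 * n + ((k : ℤ) - M₁) by ring]
    push_cast
    rw [show a - (2 * (n : ℝ) + (k - M₁)) + (k - M₁) = a - 2 * n by ring]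
    ring
  have hs : ∀ k : ℕ, Summable fun n : ℤ => f k (2 * n + ((k : ℤ) - M₁)) := by
    intro k
    have h0 : Summable (f k) :=
      summable_mul_of_finite_support hF fun r => p k * ((a - r + (k - M₁)) / 2) ^ i
    have hinj : Function.Injective fun n : ℤ => 2 * n + ((k : ℤ) - M₁) := fun x y hxy => by
      simp only at hxy
      omega
    exact h0.comp_injective hinj
  have hs' : ∀ k : ℕ, Summable fun r : ℤ => if Even (r - ((k : ℤ) - M₁)) then f k r else 0 := by
    intro k
    refine summable_of_hasFiniteSupport (hF.subset fun r hr h0 => ?_)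
    apply hr
    simp [hf, h0]
  simp_rw [h1]
  rw [Summable.tsum_finsetSum fun k _ => hs k]
  simp_rw [tsum_comp_two_mul_add]
  rw [← Summable.tsum_finsetSum fun k _ => hs' k, ← tsum_mul_left]
  refine tsum_congr fun r => ?_
  -- The factor (a-r)^i is expanded back by the sum rule so that both sides become sums over the
  -- same k.
  rw [← hφ.sum_filter_parity_add hi (r + M₁) (a - r), Finset.sum_mul, Finset.mul_sum]
  refine Finset.sum_congr rfl fun k _ => ?_
  rw [show r - ((k : ℤ) - M₁) = r + M₁ - k by ring]
  split_ifs
  · simp only [hf, div_pow]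
    ring
  · simp

end TwoScale

/-- The periodization `∑ₖ (y - k)ⁱ φ(y - k + M₁)` of the `i`-th shifted moment. -/
def periodicMoment (M₁ : ℕ) (φ : ℝ → ℝ) (i : ℕ) (y : ℝ) : ℝ :=
  ∑' k : ℤ, (y - k) ^ i * φ (y - k + M₁)

section PeriodicMoment

variable {N M₁ : ℕ} {p : ℕ → ℝ} {φ : ℝ → ℝ}

lemma IsCoiflet.mem_of_ne_zero (hφ : IsCoiflet N M₁ p φ) {y : ℝ} {k : ℤ}
    (h : φ (y - k + M₁) ≠ 0) :
    k ∈ Finset.Icc ⌈y + M₁ - (3 * N - 1)⌉ ⌊y + M₁⌋ := by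
  have := hφ.support _ h
  rw [Finset.mem_Icc, Int.ceil_le, Int.le_floor]
  constructor <;> linarith [this.1, this.2]

lemma IsCoiflet.finite_support (hφ : IsCoiflet N M₁ p φ) (y : ℝ) :
    (fun k : ℤ => φ (y - k + M₁)).support.Finite :=
  (Finset.finite_toSet _).subset fun _ hk => Finset.mem_coe.2 (hφ.mem_of_ne_zero hk)

lemma periodicMoment_eq_sum {y : ℝ} (i : ℕ) {s : Finset ℤ}
    (hs : ∀ k : ℤ, φ (y - k + M₁) ≠ 0 → k ∈ s) :
    periodicMoment M₁ φ i y = ∑ k ∈ s, (y - k) ^ i * φ (y - k + M₁) := by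
  refine tsum_eq_sum fun k hk => ?_
  rw [not_imp_comm.1 (hs k) hk, mul_zero]

lemma IsCoiflet.periodicMoment_two_mul (hφ : IsCoiflet N M₁ p φ) {i : ℕ} (hi : i < N) (y : ℝ) :
    periodicMoment M₁ φ i y = (1 / 2) ^ i * periodicMoment M₁ φ i (2 * y) := by
  rw [periodicMoment, periodicMoment, ← hφ.tsum_two_scale hi (2 * y) (hφ.finite_support (2 * y))]
  refine tsum_congr fun n => ?_
  rw [hφ.refinement (y - n + M₁)]
  congr 1
  · congr 1
    ring
  · refine Finset.sum_congr rfl fun k _ => ?_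
    congr 2
    push_cast
    ring

lemma periodicMoment_add_int (i : ℕ) (y : ℝ) (m : ℤ) :
    periodicMoment M₁ φ i (y + m) = periodicMoment M₁ φ i y := by
  rw [periodicMoment, periodicMoment, ← (Equiv.addRight m).tsum_eq]
  refine tsum_congr fun k => ?_
  simp only [Equiv.coe_addRight]
  push_cast
  rw [show y + m - (k + m) = y - (k : ℝ) by ring]

/-- On the unit interval the periodized moments are given by a fixed finite sum. -/
lemma IsCoiflet.periodicMoment_eq_unit (hφ : IsCoiflet N M₁ p φ) (i : ℕ) {y : ℝ}
    (hy : y ∈ Icc (0 : ℝ) 1) :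
    periodicMoment M₁ φ i y =
      ∑ k ∈ Finset.Icc ((M₁ : ℤ) - 3 * N + 1) (M₁ + 1), (y - k) ^ i * φ (y - k + M₁) := by
  refine periodicMoment_eq_sum i fun k hk => ?_
  have := hφ.support _ hk
  rw [Finset.mem_Icc]
  constructor
  · have h : ((M₁ : ℝ) - 3 * N + 1) ≤ k := by linarith [this.2, hy.1]
    exact_mod_cast h
  · have h : (k : ℝ) ≤ M₁ + 1 := by linarith [this.1, hy.2]
    exact_mod_cast h

lemma IsCoiflet.continuousOn_periodicMoment (hφ : IsCoiflet N M₁ p φ) (i : ℕ) :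
    ContinuousOn (periodicMoment M₁ φ i) (Icc 0 1) := by
  refine ContinuousOn.congr (Continuous.continuousOn ?_) fun y hy => hφ.periodicMoment_eq_unit i hy
  have := hφ.continuous
  fun_prop

/-- Periodicity reduces the bound to the compact interval [0,1]. -/
lemma IsCoiflet.exists_periodicMoment_le (hφ : IsCoiflet N M₁ p φ) (i : ℕ) :
    ∃ C, ∀ y, |periodicMoment M₁ φ i y| ≤ C := by
  obtain ⟨C, hC⟩ := isCompact_Icc.exists_bound_of_continuousOn (hφ.continuousOn_periodicMoment i)
  refine ⟨C, fun y => ?_⟩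
  have h := periodicMoment_add_int (M₁ := M₁) (φ := φ) i (Int.fract y) ⌊y⌋
  rw [Int.fract_add_floor] at h
  rw [h]
  exact hC _ ⟨Int.fract_nonneg y, (Int.fract_lt_one y).le⟩

/-- Iterating the self-similarity n times bounds the function by 2^{-n} times its supremum. -/
lemma IsCoiflet.periodicMoment_eq_zero (hφ : IsCoiflet N M₁ p φ) {i : ℕ} (hi : i < N)
    (h0 : i ≠ 0) (y : ℝ) : periodicMoment M₁ φ i y = 0 := by
  obtain ⟨C, hC⟩ := hφ.exists_periodicMoment_le i
  have h1 : ∀ n : ℕ, ∀ y, |periodicMoment M₁ φ i y| ≤ (1 / 2) ^ n * C := by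
    intro n
    induction n with
    | zero => simpa using hC
    | succ n ih =>
      intro y
      rw [hφ.periodicMoment_two_mul hi, abs_mul, abs_of_nonneg (by positivity), pow_succ',
        mul_assoc]
      refine mul_le_mul ?_ (ih _) (abs_nonneg _) (by positivity)
      exact pow_le_of_le_one (by norm_num) (by norm_num) h0
  have h2 : Filter.Tendsto (fun n : ℕ => (1 / 2 : ℝ) ^ n * C) Filter.atTop (nhds (0 * C)) :=
    (tendsto_pow_atTop_nhds_zero_of_lt_one (by norm_num) (by norm_num)).mul_const C
  rw [zero_mul] at h2
  exact abs_nonpos_iff.1 (ge_of_tendsto' h2 fun n => h1 n y)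

/-- Splitting an integral over the line into integrals over unit intervals. -/
lemma IsCoiflet.integral_eq_unit (hφ : IsCoiflet N M₁ p φ) {G : ℝ → ℝ} (hG : Continuous G) :
    ∫ x, G x * φ x = ∫ y in (0 : ℝ)..1,
      ∑ k ∈ Finset.Icc ((M₁ : ℤ) - 3 * N + 1) (M₁ + 1), G (y - k + M₁) * φ (y - k + M₁) := by
  have hc : Continuous fun x => G x * φ x := hG.mul hφ.continuous
  have hi : ∀ k : ℤ, IntervalIntegrable (fun y => G (y - k + M₁) * φ (y - k + M₁)) volume 0 1 :=
    fun k => (hc.comp (by fun_prop : Continuous fun y : ℝ => y - k + M₁)).intervalIntegrable _ _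
  rw [intervalIntegral.integral_finsetSum fun k _ => hi k]
  have h1 : ∀ k : ℤ, ∫ y in (0 : ℝ)..1, G (y - k + M₁) * φ (y - k + M₁)
      = ∫ x in (((M₁ : ℤ) - k : ℤ) : ℝ)..(((M₁ : ℤ) - k : ℤ) : ℝ) + 1, G x * φ x := by
    intro k
    have := intervalIntegral.integral_comp_add_right (a := 0) (b := 1)
      (fun x => G x * φ x) (((M₁ : ℤ) - k : ℤ) : ℝ)
    rw [zero_add, add_comm (1 : ℝ)] at this
    rw [← this]
    push_cast
    simp only [show ∀ y : ℝ, y + (M₁ - k) = y - k + M₁ from fun y => by ring]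
  simp_rw [h1]
  have h2 : ∑ k ∈ Finset.Icc ((M₁ : ℤ) - 3 * N + 1) (M₁ + 1),
      (∫ x in (((M₁ : ℤ) - k : ℤ) : ℝ)..(((M₁ : ℤ) - k : ℤ) : ℝ) + 1, G x * φ x) =
      ∑ n ∈ Finset.range (3 * N + 1),
        ∫ x in ((n : ℝ) - 1)..(((n + 1 : ℕ) : ℝ) - 1), G x * φ x := by
    refine Finset.sum_bij' (fun k _ => ((M₁ : ℤ) + 1 - k).toNat) (fun n _ => (M₁ : ℤ) + 1 - n)
      ?_ ?_ ?_ ?_ ?_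
    · intro k hk
      rw [Finset.mem_Icc] at hk
      rw [Finset.mem_range]
      omega
    · intro n hn
      rw [Finset.mem_range] at hn
      rw [Finset.mem_Icc]
      omega
    · intro k hk
      rw [Finset.mem_Icc] at hk
      omega
    · intro n hn
      omega
    · intro k hk
      rw [Finset.mem_Icc] at hk
      have : ((((M₁ : ℤ) + 1 - k).toNat : ℕ) : ℝ) = M₁ + 1 - k := by
        have h : ((((M₁ : ℤ) + 1 - k).toNat : ℕ) : ℤ) = M₁ + 1 - k := Int.toNat_of_nonneg (by omega)
        exact_mod_cast h
      push_cast
      rw [this]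
      congr 1 <;> ring
  rw [h2, intervalIntegral.sum_integral_adjacent_intervals (a := fun n : ℕ => (n : ℝ) - 1)
    fun k _ => hc.intervalIntegrable _ _, intervalIntegral.integral_of_le (by
      have := Nat.cast_nonneg (α := ℝ) N
      push_cast
      linarith)]
  rw [setIntegral_eq_integral_of_forall_compl_eq_zero]
  intro x hx
  by_cases hx0 : φ x = 0
  · rw [hx0, mul_zero]
  · exfalso
    apply hx
    have := hφ.support x hx0
    constructor
    · push_cast
      linarith [this.1]
    · push_cast
      linarith [this.2]

lemma IsCoiflet.integral_periodicMoment (hφ : IsCoiflet N M₁ p φ) (i : ℕ) :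
    ∫ y in (0 : ℝ)..1, periodicMoment M₁ φ i y = ∫ x, (x - M₁) ^ i * φ x := by
  rw [hφ.integral_eq_unit (G := fun x => (x - M₁) ^ i) (by fun_prop)]
  refine intervalIntegral.integral_congr fun y hy => ?_
  rw [uIcc_of_le zero_le_one] at hy
  simp only [hφ.periodicMoment_eq_unit i hy, add_sub_cancel_right]

/-- For order zero the function is invariant under halving the argument, so continuity at 0 makes it
constant on [0,1]. The constant is its mean, which is ∫φ = 1. -/
lemma IsCoiflet.periodicMoment_zero (hφ : IsCoiflet N M₁ p φ) (hN : 0 < N) (y : ℝ) :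
    periodicMoment M₁ φ 0 y = 1 := by
  have h1 : ∀ y ∈ Icc (0 : ℝ) 1, periodicMoment M₁ φ 0 y = periodicMoment M₁ φ 0 0 := by
    intro y hy
    have h2 : ∀ n : ℕ, periodicMoment M₁ φ 0 (y * (1 / 2) ^ n) = periodicMoment M₁ φ 0 y := by
      intro n
      induction n with
      | zero => simp
      | succ n ih =>
        rw [hφ.periodicMoment_two_mul hN, ← ih, pow_succ]
        ring_nf
    have h3 : Filter.Tendsto (fun n : ℕ => y * (1 / 2 : ℝ) ^ n) Filter.atTop
        (nhdsWithin 0 (Icc 0 1)) := by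
      refine tendsto_nhdsWithin_iff.2 ⟨?_, Filter.Eventually.of_forall fun n => ⟨?_, ?_⟩⟩
      · simpa using (tendsto_pow_atTop_nhds_zero_of_lt_one (r := (1 / 2 : ℝ))
          (by norm_num) (by norm_num)).const_mul y
      · exact mul_nonneg hy.1 (by positivity)
      · exact mul_le_one₀ hy.2 (by positivity) (pow_le_one₀ (by norm_num) (by norm_num))
    have h4 := (hφ.continuousOn_periodicMoment 0 0 (by simp)).tendsto.comp h3
    refine tendsto_nhds_unique ?_ h4
    simp only [Function.comp_def, h2]
    exact tendsto_const_nhds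
  have h5 : periodicMoment M₁ φ 0 0 = 1 := by
    have h := hφ.integral_periodicMoment 0
    rw [intervalIntegral.integral_congr (g := fun _ => periodicMoment M₁ φ 0 0) fun y hy => h1 y
      (by rwa [uIcc_of_le zero_le_one] at hy)] at h
    simpa [hφ.integral_eq_one] using h
  have h := periodicMoment_add_int (M₁ := M₁) (φ := φ) 0 (Int.fract y) ⌊y⌋
  rw [Int.fract_add_floor] at h
  rw [h, h1 _ ⟨Int.fract_nonneg y, (Int.fract_lt_one y).le⟩, h5]

end PeriodicMoment

/-! ### Reproduction of polynomials and the additional vanishing moment -/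

section Reproduction

variable {N M₁ : ℕ} {p : ℕ → ℝ} {φ : ℝ → ℝ}

lemma sum_pow_eq_sum_periodicMoment {y : ℝ} {s : Finset ℤ}
    (hs : ∀ k : ℤ, φ (y - k + M₁) ≠ 0 → k ∈ s) (c : ℝ) (i : ℕ) :
    ∑ k ∈ s, ((k : ℝ) - c) ^ i * φ (y - k + M₁) = ∑ m ∈ Finset.range (i + 1),
      (-1) ^ m * (y - c) ^ (i - m) * i.choose m * periodicMoment M₁ φ m y := by
  simp_rw [periodicMoment_eq_sum _ hs, Finset.mul_sum]
  rw [Finset.sum_comm]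
  refine Finset.sum_congr rfl fun k _ => ?_
  rw [show (k : ℝ) - c = (-1) * (y - k) + (y - c) by ring, add_pow, Finset.sum_mul]
  refine Finset.sum_congr rfl fun m _ => ?_
  rw [mul_pow]
  ring

lemma IsCoiflet.sum_pow (hφ : IsCoiflet N M₁ p φ) {y : ℝ} {s : Finset ℤ}
    (hs : ∀ k : ℤ, φ (y - k + M₁) ≠ 0 → k ∈ s) (c : ℝ) {i : ℕ} (hi : i < N) :
    ∑ k ∈ s, ((k : ℝ) - c) ^ i * φ (y - k + M₁) = (y - c) ^ i := by
  rw [sum_pow_eq_sum_periodicMoment hs, Finset.sum_eq_single 0]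
  · simp [hφ.periodicMoment_zero (by omega)]
  · intro m hm h0
    rw [Finset.mem_range] at hm
    rw [hφ.periodicMoment_eq_zero (by omega) h0, mul_zero]
  · simp

lemma IsCoiflet.sum_pow_order (hφ : IsCoiflet N M₁ p φ) (hN : Even N) (hN0 : 0 < N) {y : ℝ}
    {s : Finset ℤ} (hs : ∀ k : ℤ, φ (y - k + M₁) ≠ 0 → k ∈ s) (c : ℝ) :
    ∑ k ∈ s, ((k : ℝ) - c) ^ N * φ (y - k + M₁) = (y - c) ^ N + periodicMoment M₁ φ N y := by
  rw [sum_pow_eq_sum_periodicMoment hs, Finset.sum_range_succ, Finset.sum_eq_single 0]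
  · simp [hφ.periodicMoment_zero hN0, hN.neg_one_pow]
  · intro m hm h0
    rw [Finset.mem_range] at hm
    rw [hφ.periodicMoment_eq_zero hm h0, mul_zero]
  · simp [hN0.ne']

/-- A Coiflet of even order `N` has a vanishing shifted moment of order `N`. -/
lemma IsCoiflet.integral_periodicMoment_order (hφ : IsCoiflet N M₁ p φ) (hN : Even N)
    (hN0 : 0 < N) : ∫ y in (0 : ℝ)..1, periodicMoment M₁ φ N y = 0 := by
  set s : Finset ℤ := Finset.Icc (-(3 * N)) (3 * N) with hs
  set G : ℝ → ℝ := fun x => ∑ n ∈ s, (n : ℝ) ^ N * φ (x - n) with hG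
  have hcφ := hφ.continuous
  -- By orthonormality only n = 0 could contribute, and there n^N = 0.
  have h1 : ∫ x, G x * φ x = 0 := by
    have h2 : ∀ x, G x * φ x = ∑ n ∈ s, (n : ℝ) ^ N * (φ (x - n) * φ x) := by
      intro x
      rw [hG, Finset.sum_mul]
      exact Finset.sum_congr rfl fun n _ => by ring
    simp_rw [h2]
    rw [integral_finsetSum _ fun (n : ℤ) _ =>
      (hφ.integrable_mul (G := fun x => φ (x - n)) (by fun_prop)).const_mul _]
    refine Finset.sum_eq_zero fun n _ => ?_
    rw [integral_const_mul]
    simp_rw [mul_comm (φ (_ - (n : ℝ)))]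
    rw [hφ.orthonormal n]
    split_ifs with h
    · simp [h, hN0.ne']
    · simp
  rw [hφ.integral_eq_unit (by fun_prop)] at h1
  -- On the support of φ the truncation to |n| ≤ 3N loses nothing, so G(y-k+M₁) = (y-k)^N + P_N(y).
  -- Multiplying by φ(y-k+M₁) and summing over k gives P_N + P_N·P_0 = 2 P_N. For odd N the two
  -- terms would cancel instead.
  have h3 : ∀ y ∈ uIcc (0 : ℝ) 1, ∑ k ∈ Finset.Icc ((M₁ : ℤ) - 3 * N + 1) (M₁ + 1),
      G (y - k + M₁) * φ (y - k + M₁) = 2 * periodicMoment M₁ φ N y := by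
    intro y hy
    rw [uIcc_of_le zero_le_one] at hy
    have h4 : ∀ k : ℤ, G (y - k + M₁) * φ (y - k + M₁) =
        (y - k) ^ N * φ (y - k + M₁)
          + periodicMoment M₁ φ N y * ((y - k) ^ 0 * φ (y - k + M₁)) := by
      intro k
      by_cases h0 : φ (y - k + M₁) = 0
      · simp [h0]
      have h5 : G (y - k + M₁) = (y - k) ^ N + periodicMoment M₁ φ N y := by
        have hsup := hφ.support _ h0
        have h6 := hφ.sum_pow_order hN hN0 (y := y - k) (s := s) ?_ 0
        · rw [sub_zero, sub_eq_add_neg, ← Int.cast_neg, periodicMoment_add_int, Int.cast_neg,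
            ← sub_eq_add_neg] at h6
          rw [← h6, hG]
          refine Finset.sum_congr rfl fun n _ => ?_
          rw [sub_zero]
          ring_nf
        · intro n hn
          have hsup' := hφ.support _ hn
          rw [hs, Finset.mem_Icc]
          constructor
          · have : -(3 * (N : ℝ)) ≤ n := by linarith [hsup.1, hsup'.2]
            exact_mod_cast this
          · have : (n : ℝ) ≤ 3 * (N : ℝ) := by linarith [hsup.2, hsup'.1]
            exact_mod_cast this
      rw [h5]
      ring
    simp_rw [h4]
    rw [Finset.sum_add_distrib, ← Finset.mul_sum, ← hφ.periodicMoment_eq_unit _ hy,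
      ← hφ.periodicMoment_eq_unit _ hy, hφ.periodicMoment_zero hN0]
    ring
  rw [intervalIntegral.integral_congr h3, intervalIntegral.integral_const_mul] at h1
  simpa using h1

end Reproduction

/-! ### Values of the derivatives at the integers -/

section IntegerDerivs

variable {N M₁ : ℕ} {p : ℕ → ℝ} {φ : ℝ → ℝ} {d : ℕ → ℤ → ℝ}

lemma IsIntegerDerivs.mem_of_ne_zero (hd : IsIntegerDerivs N p φ d) {i : ℕ} (hi : i < N) {m : ℤ}
    (h : d i m ≠ 0) : m ∈ Finset.Icc (1 : ℤ) (3 * N - 2) :=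
  Finset.mem_Icc.2 (hd.support i hi m h)

lemma IsIntegerDerivs.tsum_eq_sum (hd : IsIntegerDerivs N p φ d) {i : ℕ} (hi : i < N) (l : ℕ) :
    ∑' n : ℤ, (0 - (n : ℝ)) ^ l * d i (M₁ - n) =
      ∑ m ∈ Finset.Icc (1 : ℤ) (3 * N - 2), ((m : ℝ) - M₁) ^ l * d i m := by
  rw [← (Equiv.subLeft (M₁ : ℤ)).tsum_eq, _root_.tsum_eq_sum (s := Finset.Icc (1 : ℤ) (3 * N - 2))]
  · refine Finset.sum_congr rfl fun m _ => ?_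
    simp
  · intro m hm
    simp [not_imp_comm.1 (hd.mem_of_ne_zero hi) hm]

/-- The refinement of `d i` scales the l-th discrete moment by 2^{-i}, the two-scale identity scales
it by 2^{-l}. Distinct factors force the moment to vanish. -/
lemma IsCoiflet.sum_shifted_pow_of_ne (hφ : IsCoiflet N M₁ p φ) (hd : IsIntegerDerivs N p φ d)
    {i l : ℕ} (hi : i < N) (hl : l < N) (hil : l ≠ i) :
    ∑ m ∈ Finset.Icc (1 : ℤ) (3 * N - 2), ((m : ℝ) - M₁) ^ l * d i m = 0 := by
  rw [← hd.tsum_eq_sum hi]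
  have hfin : (fun r : ℤ => d i (M₁ - r)).support.Finite := by
    refine (Finset.finite_toSet (Finset.Icc ((M₁ : ℤ) - (3 * N - 2)) (M₁ - 1))).subset ?_
    intro r hr
    have := hd.support i hi _ hr
    rw [Finset.mem_coe, Finset.mem_Icc]
    omega
  have h := hφ.tsum_two_scale hl 0 hfin
  have h1 : ∀ n : ℤ, (((0 : ℝ) - 2 * n) / 2) ^ l *
      ∑ k ∈ Finset.range (3 * N), p k * d i (M₁ - (2 * n - M₁ + k)) =
      (1 / 2) ^ i * ((0 - n) ^ l * d i (M₁ - n)) := by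
    intro n
    rw [hd.refinement i hi (M₁ - n)]
    have h2 : ∀ k : ℕ, (M₁ : ℤ) - (2 * n - M₁ + k) = 2 * (M₁ - n) - k := fun k => by ring
    simp_rw [h2]
    rw [show ((0 : ℝ) - 2 * n) / 2 = 0 - n by ring,
      show ∀ a b : ℝ, (1 / 2) ^ i * (a * (2 ^ i * b)) = ((1 / 2) ^ i * 2 ^ i) * (a * b) from
        fun a b => by ring, ← mul_pow]
    norm_num
  simp_rw [h1, tsum_mul_left] at h
  by_contra hne
  have h3 := mul_right_cancel₀ hne h
  rw [one_div, inv_pow, inv_pow, _root_.inv_inj] at h3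
  exact hil (Nat.pow_right_injective le_rfl (by exact_mod_cast h3.symm))

/-- The expansions of the monomials are reproduced by the values of the derivatives. -/
lemma IsCoiflet.sum_shifted_pow (hφ : IsCoiflet N M₁ p φ) (hd : IsIntegerDerivs N p φ d)
    {i l : ℕ} (hi : i < N) (hl : l < N) :
    ∑ m ∈ Finset.Icc (1 : ℤ) (3 * N - 2), ((M₁ : ℝ) - m) ^ l * d i m =
      if i = l then (l.factorial : ℝ) else 0 := by
  have h0 : ∀ m : ℤ, ((M₁ : ℝ) - m) ^ l * d i m = (-1) ^ l * (((m : ℝ) - M₁) ^ l * d i m) := by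
    intro m
    rw [← mul_assoc, ← mul_pow]
    ring
  simp_rw [h0]
  rw [← Finset.mul_sum]
  split_ifs with h
  · subst h
    have h1 := hd.normalized i hi
    have h2 : ∀ m : ℤ, (-(m : ℝ)) ^ i * d i m = ∑ s ∈ Finset.range (i + 1),
        ((-1) ^ i * (M₁ : ℝ) ^ (i - s) * i.choose s) * (((m : ℝ) - M₁) ^ s * d i m) := by
      intro m
      rw [show -(m : ℝ) = (-1) * (((m : ℝ) - M₁) + M₁) by ring, mul_pow, add_pow, Finset.mul_sum,
        Finset.sum_mul]
      exact Finset.sum_congr rfl fun s _ => by ring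
    simp_rw [h2] at h1
    rw [Finset.sum_comm] at h1
    simp_rw [← Finset.mul_sum] at h1
    rw [Finset.sum_range_succ, Finset.sum_eq_zero] at h1
    · simpa using h1
    · intro s hs
      rw [Finset.mem_range] at hs
      rw [hφ.sum_shifted_pow_of_ne hd hi (by omega) hs.ne, mul_zero]
  · rw [hφ.sum_shifted_pow_of_ne hd hi hl (Ne.symm h), mul_zero]

/-- The two outer sums are those in `S₁` and `S₀`; each is also part of the right-hand sides
defining the opposite ζ. -/
lemma IsCoiflet.sum_split (hφ : IsCoiflet N M₁ p φ) (f : ℤ → ℝ) :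
    ∑ m ∈ Finset.Icc (1 : ℤ) (3 * N - 2), f m =
      ∑ k ∈ Finset.Icc 1 (M₁ - 1), f ((M₁ : ℤ) - k) + f M₁
        + ∑ t ∈ Finset.Icc 1 (3 * N - 2 - M₁), f ((M₁ : ℤ) + t) := by
  have h1 := hφ.moment_pos
  have h2 := hφ.moment_le
  have e : Finset.Icc (1 : ℤ) (3 * N - 2) =
      (Finset.Icc (1 : ℤ) (M₁ - 1) ∪ {(M₁ : ℤ)}) ∪ Finset.Icc ((M₁ : ℤ) + 1) (3 * N - 2) := by
    ext m
    simp only [Finset.mem_union, Finset.mem_Icc, Finset.mem_singleton]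
    omega
  rw [e, Finset.sum_union, Finset.sum_union, Finset.sum_singleton]
  · congr 1
    · congr 1
      refine Finset.sum_bij' (fun m _ => ((M₁ : ℤ) - m).toNat) (fun k _ => (M₁ : ℤ) - k)
        ?_ ?_ ?_ ?_ ?_ <;> intro m hm <;> rw [Finset.mem_Icc] at hm <;>
        (try simp only [Finset.mem_Icc]) <;> first | omega | (congr 1; omega)
    · refine Finset.sum_bij' (fun m _ => (m - (M₁ : ℤ)).toNat) (fun k _ => (M₁ : ℤ) + k)
        ?_ ?_ ?_ ?_ ?_ <;> intro m hm <;> rw [Finset.mem_Icc] at hm <;>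
        (try simp only [Finset.mem_Icc]) <;> first | omega | (congr 1; omega)
  · rw [Finset.disjoint_left]
    intro m
    simp only [Finset.mem_Icc, Finset.mem_singleton]
    omega
  · rw [Finset.disjoint_left]
    intro m
    simp only [Finset.mem_union, Finset.mem_Icc, Finset.mem_singleton]
    omega

lemma sum_Icc_one_add_zero (f : ℕ → ℝ) (n : ℕ) :
    ∑ k ∈ Finset.Icc 1 n, f k + f 0 = ∑ k ∈ Finset.range (n + 1), f k := by
  rw [Finset.sum_range_succ', Finset.range_eq_Ico, Finset.sum_Ico_add' f 0 n 1]
  rfl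

lemma sum_inv_mulVec {n : ℕ} {A : Matrix (Fin n) (Fin n) ℝ} (hA : IsUnit A) {s : Finset ℕ}
    (c : ℕ → ℝ) (v : ℕ → Fin n → ℝ) (w : Fin n → ℝ)
    (h : ∀ i, ∑ k ∈ s, c k * v k i = (A *ᵥ w) i) (i : Fin n) :
    ∑ k ∈ s, c k * (A⁻¹ *ᵥ v k) i = w i := by
  have hA' : IsUnit A.det := (Matrix.isUnit_iff_isUnit_det A).1 hA
  have h1 : ∑ k ∈ s, c k • v k = A *ᵥ w := by
    ext i
    simpa using h i
  have h2 : A⁻¹ *ᵥ (∑ k ∈ s, c k • v k) = w := by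
    rw [h1, Matrix.mulVec_mulVec, Matrix.nonsing_inv_mul _ hA', Matrix.one_mulVec]
  rw [← h2, Matrix.mulVec_sum, Finset.sum_apply]
  simp [Matrix.mulVec_smul]

/-- The derivatives of x^l at 0 form the vector w = l! e_l. Splitting the discrete moment identity
into nodes k ≥ 0 and exterior nodes says that the nonnegative part equals (I - S₀)w, and inverting
shows that ζ₀ differentiates monomials exactly. -/
lemma IsCoiflet.sum_pow_mul_ζ₀ (hφ : IsCoiflet N M₁ p φ) (hd : IsIntegerDerivs N p φ d)
    (hS : IsUnit (1 - S₀ N M₁ d)) {l : ℕ} (hl : l < N) (i : Fin N) :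
    ∑ k ∈ Finset.range M₁, (k : ℝ) ^ l * ζ₀ N M₁ d i k =
      if (i : ℕ) = l then (l.factorial : ℝ) else 0 := by
  have h1 := hφ.moment_pos
  refine sum_inv_mulVec hS (fun k => (k : ℝ) ^ l) (fun k i => d i ((M₁ : ℤ) - k))
    (fun i => if (i : ℕ) = l then (l.factorial : ℝ) else 0) ?_ i
  intro i
  have h2 := hφ.sum_shifted_pow hd i.2 hl
  rw [hφ.sum_split fun m => ((M₁ : ℝ) - m) ^ l * d i m] at h2
  have h3 := sum_Icc_one_add_zero (fun k : ℕ => (k : ℝ) ^ l * d i ((M₁ : ℤ) - k)) (M₁ - 1)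
  rw [show M₁ - 1 + 1 = M₁ by omega] at h3
  rw [← h3]
  have h4 : ((1 - S₀ N M₁ d) *ᵥ fun i : Fin N => if (i : ℕ) = l then (l.factorial : ℝ) else 0) i =
      (if (i : ℕ) = l then (l.factorial : ℝ) else 0) -
        ∑ t ∈ Finset.Icc 1 (3 * N - 2 - M₁), (-(t : ℝ)) ^ l * d i ((M₁ : ℤ) + t) := by
    rw [Matrix.sub_mulVec, Matrix.one_mulVec, Pi.sub_apply, Matrix.mulVec, dotProduct,
      Finset.sum_eq_single (⟨l, hl⟩ : Fin N)]
    · congr 1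
      simp only [S₀, Matrix.of_apply, if_true, Finset.sum_mul]
      refine Finset.sum_congr rfl fun t _ => ?_
      have : (l.factorial : ℝ) ≠ 0 := by positivity
      field_simp
    · intro b _ hb
      rw [if_neg fun h => hb (Fin.ext h), mul_zero]
    · simp
  rw [h4, ← h2]
  push_cast
  simp only [sub_sub_cancel, sub_self, sub_add_cancel_left, sub_zero]
  ring

/-- Mirror image at the right end; k counts nodes inwards from 1, hence the sign of the node
coordinate. -/
lemma IsCoiflet.sum_pow_mul_ζ₁ (hφ : IsCoiflet N M₁ p φ) (hd : IsIntegerDerivs N p φ d)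
    (hS : IsUnit (1 - S₁ N M₁ d)) {l : ℕ} (hl : l < N) (i : Fin N) :
    ∑ k ∈ Finset.range (3 * N - 2 - M₁ + 1), (-(k : ℝ)) ^ l * ζ₁ N M₁ d i k =
      if (i : ℕ) = l then (l.factorial : ℝ) else 0 := by
  refine sum_inv_mulVec hS (fun k => (-(k : ℝ)) ^ l) (fun k i => d i ((M₁ : ℤ) + k))
    (fun i => if (i : ℕ) = l then (l.factorial : ℝ) else 0) ?_ i
  intro i
  have h2 := hφ.sum_shifted_pow hd i.2 hl
  rw [hφ.sum_split fun m => ((M₁ : ℝ) - m) ^ l * d i m] at h2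
  rw [← sum_Icc_one_add_zero (fun k : ℕ => (-(k : ℝ)) ^ l * d i ((M₁ : ℤ) + k))]
  have h4 : ((1 - S₁ N M₁ d) *ᵥ fun i : Fin N => if (i : ℕ) = l then (l.factorial : ℝ) else 0) i =
      (if (i : ℕ) = l then (l.factorial : ℝ) else 0) -
        ∑ t ∈ Finset.Icc 1 (M₁ - 1), (t : ℝ) ^ l * d i ((M₁ : ℤ) - t) := by
    rw [Matrix.sub_mulVec, Matrix.one_mulVec, Pi.sub_apply, Matrix.mulVec, dotProduct,
      Finset.sum_eq_single (⟨l, hl⟩ : Fin N)]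
    · congr 1
      simp only [S₁, Matrix.of_apply, if_true, Finset.sum_mul]
      refine Finset.sum_congr rfl fun t _ => ?_
      have : (l.factorial : ℝ) ≠ 0 := by positivity
      field_simp
    · intro b _ hb
      rw [if_neg fun h => hb (Fin.ext h), mul_zero]
    · simp
  rw [h4, ← h2]
  push_cast
  simp only [sub_sub_cancel, sub_self, sub_add_cancel_left, neg_zero, add_zero]
  ring

/-- The powers of 2^j cancel at the exterior nodes, so the extension weights there do not depend on
the level. The uniform Lebesgue bound rests on this. -/
lemma TL_node (j k m : ℕ) :
    TL N M₁ d j k (-(m : ℝ) / 2 ^ j) =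
      ∑ i : Fin N, ζ₀ N M₁ d i k / (i : ℕ).factorial * (-(m : ℝ)) ^ (i : ℕ) := by
  refine Finset.sum_congr rfl fun i _ => ?_
  rw [div_pow, ← pow_mul, mul_comm (i : ℕ) j]
  field_simp

lemma TR_node (j k m : ℕ) :
    TR N M₁ d j k (1 + (m : ℝ) / 2 ^ j) =
      ∑ i : Fin N, ζ₁ N M₁ d i k / (i : ℕ).factorial * (m : ℝ) ^ (i : ℕ) := by
  refine Finset.sum_congr rfl fun i _ => ?_
  rw [add_sub_cancel_left, div_pow, ← pow_mul, mul_comm (i : ℕ) j]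
  field_simp

/-- A monomial equals its Taylor polynomial, and its derivatives at 0 are computed exactly by ζ₀. -/
lemma IsCoiflet.sum_pow_mul_TL (hφ : IsCoiflet N M₁ p φ) (hd : IsIntegerDerivs N p φ d)
    (hS : IsUnit (1 - S₀ N M₁ d)) {l : ℕ} (hl : l < N) (j m : ℕ) :
    ∑ k ∈ Finset.range M₁, (k : ℝ) ^ l * TL N M₁ d j k (-(m : ℝ) / 2 ^ j) = (-(m : ℝ)) ^ l := by
  simp_rw [TL_node, Finset.mul_sum]
  rw [Finset.sum_comm]
  have h : ∀ i : Fin N, ∑ k ∈ Finset.range M₁,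
      (k : ℝ) ^ l * (ζ₀ N M₁ d i k / (i : ℕ).factorial * (-(m : ℝ)) ^ (i : ℕ)) =
      (if (i : ℕ) = l then (l.factorial : ℝ) else 0) *
        ((-(m : ℝ)) ^ (i : ℕ) / (i : ℕ).factorial) := by
    intro i
    rw [← hφ.sum_pow_mul_ζ₀ hd hS hl i, Finset.sum_mul]
    exact Finset.sum_congr rfl fun k _ => by ring
  simp_rw [h]
  rw [Finset.sum_eq_single (⟨l, hl⟩ : Fin N)]
  · have : (l.factorial : ℝ) ≠ 0 := by positivity
    simp only [if_true]
    field_simp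
  · intro b _ hb
    rw [if_neg fun h => hb (Fin.ext h), zero_mul]
  · simp

lemma IsCoiflet.sum_pow_mul_TR (hφ : IsCoiflet N M₁ p φ) (hd : IsIntegerDerivs N p φ d)
    (hS : IsUnit (1 - S₁ N M₁ d)) {l : ℕ} (hl : l < N) (j m : ℕ) :
    ∑ k ∈ Finset.range (3 * N - 2 - M₁ + 1), (-(k : ℝ)) ^ l *
      TR N M₁ d j k (1 + (m : ℝ) / 2 ^ j) = (m : ℝ) ^ l := by
  simp_rw [TR_node, Finset.mul_sum]
  rw [Finset.sum_comm]
  have h : ∀ i : Fin N, ∑ k ∈ Finset.range (3 * N - 2 - M₁ + 1),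
      (-(k : ℝ)) ^ l * (ζ₁ N M₁ d i k / (i : ℕ).factorial * (m : ℝ) ^ (i : ℕ)) =
      (if (i : ℕ) = l then (l.factorial : ℝ) else 0) *
        ((m : ℝ) ^ (i : ℕ) / (i : ℕ).factorial) := by
    intro i
    rw [← hφ.sum_pow_mul_ζ₁ hd hS hl i, Finset.sum_mul]
    exact Finset.sum_congr rfl fun k _ => by ring
  simp_rw [h]
  rw [Finset.sum_eq_single (⟨l, hl⟩ : Fin N)]
  · have : (l.factorial : ℝ) ≠ 0 := by positivity
    simp only [if_true]
    field_simp
  · intro b _ hb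
    rw [if_neg fun h => hb (Fin.ext h), zero_mul]
  · simp

end IntegerDerivs

/-! ### The boundary-modified basis -/

section Basis

variable {N M₁ : ℕ} {p : ℕ → ℝ} {φ : ℝ → ℝ} {d : ℕ → ℤ → ℝ}

/-- Continuity makes φ vanish at the ends of its support. The strict inequalities are what limits
the exterior nodes to exactly 3N-2-M₁ on the left and M₁-1 on the right. -/
lemma IsCoiflet.support_Ioo (hφ : IsCoiflet N M₁ p φ) {x : ℝ} (hx : φ x ≠ 0) :
    x ∈ Ioo (0 : ℝ) (3 * N - 1) := by
  rw [← interior_Icc]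
  have hopen : IsOpen {x | φ x ≠ 0} := isOpen_ne_fun hφ.continuous continuous_const
  exact interior_maximal (fun x hx => hφ.support x hx) hopen hx

lemma IsCoiflet.exists_bound (hφ : IsCoiflet N M₁ p φ) : ∃ B, 0 ≤ B ∧ ∀ x, |φ x| ≤ B := by
  obtain ⟨B, hB⟩ := hφ.continuous.bounded_above_of_compact_support hφ.hasCompactSupport
  exact ⟨B, (norm_nonneg _).trans (hB 0), hB⟩

lemma ΦInt_zero (j k : ℕ) (x : ℝ) : ΦInt N M₁ φ d 0 j k x = φ (2 ^ j * x - k + M₁)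
    + (if k ≤ M₁ - 1 then ∑ m ∈ Finset.Icc 1 (3 * N - 2 - M₁),
        TL N M₁ d j k (-(m : ℝ) / 2 ^ j) * φ (2 ^ j * x - (-(m : ℤ) : ℤ) + M₁) else 0)
    + (if 2 ^ j ≤ k + (3 * N - 2 - M₁) then ∑ m ∈ Finset.Icc 1 (M₁ - 1),
        TR N M₁ d j (2 ^ j - k) (1 + (m : ℝ) / 2 ^ j) * φ (2 ^ j * x - ((2 : ℤ) ^ j + m : ℤ) + M₁)
      else 0) := by
  have h : ∀ k : ℤ, φInt φ 0 j (k - M₁) x = φ (2 ^ j * x - k + M₁) := by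
    intro k
    rw [φInt, multInt]
    congr 1
    push_cast
    ring
  simp only [ΦInt, h, Int.cast_natCast]

lemma IsCoiflet.continuous_ΦInt_zero (hφ : IsCoiflet N M₁ p φ) (j k : ℕ) :
    Continuous (ΦInt N M₁ φ d 0 j k) := by
  have h := hφ.continuous
  have h1 : ΦInt N M₁ φ d 0 j k = _ := funext fun x => ΦInt_zero j k x
  rw [h1]
  refine (Continuous.add (by fun_prop) ?_).add ?_
  · split_ifs <;> fun_prop
  · split_ifs <;> fun_prop

lemma sum_ite_left {a n : ℕ} (ha : 1 ≤ a) (han : a ≤ n + 1) (f : ℕ → ℝ) :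
    ∑ k ∈ Finset.range (n + 1), (if k ≤ a - 1 then f k else 0) = ∑ k ∈ Finset.range a, f k := by
  rw [← Finset.sum_filter]
  refine Finset.sum_congr ?_ fun _ _ => rfl
  ext k
  simp only [Finset.mem_filter, Finset.mem_range]
  omega

lemma sum_ite_right {b n : ℕ} (hb : b ≤ n) (f : ℕ → ℝ) :
    ∑ k ∈ Finset.range (n + 1), (if n ≤ k + b then f (n - k) else 0) =
      ∑ k ∈ Finset.range (b + 1), f k := by
  rw [← Finset.sum_range_reflect]
  have h : ∀ k ∈ Finset.range (n + 1), (if n ≤ n + 1 - 1 - k + b then f (n - (n + 1 - 1 - k))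
      else 0) = if k ≤ b + 1 - 1 then f k else 0 := by
    intro k hk
    rw [Finset.mem_range] at hk
    have e : n - (n + 1 - 1 - k) = k := by omega
    rw [e]
    refine if_congr ?_ rfl rfl
    omega
  rw [Finset.sum_congr rfl h]
  exact sum_ite_left (by omega) (by omega) f

/-- Exactness on all monomials below degree n is invariant under translation of the origin. -/
lemma sum_add_pow_of_sum_pow {ι : Type*} {s : Finset ι} {x w : ι → ℝ} {y : ℝ} {n : ℕ}
    (h : ∀ l < n, ∑ k ∈ s, x k ^ l * w k = y ^ l) (c : ℝ) {l : ℕ} (hl : l < n) :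
    ∑ k ∈ s, (x k + c) ^ l * w k = (y + c) ^ l := by
  simp_rw [add_pow, Finset.sum_mul]
  rw [Finset.sum_comm]
  refine Finset.sum_congr rfl fun m hm => ?_
  rw [Finset.mem_range] at hm
  rw [← h m (by omega), Finset.sum_mul, Finset.sum_mul]
  exact Finset.sum_congr rfl fun k _ => by ring

lemma sum_range_eq_sum_Icc_int (n : ℕ) (f : ℤ → ℝ) :
    ∑ k ∈ Finset.range (n + 1), f k = ∑ k ∈ Finset.Icc (0 : ℤ) n, f k := by
  refine Finset.sum_bij' (fun k _ => (k : ℤ)) (fun k _ => k.toNat) ?_ ?_ ?_ ?_ ?_ <;>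
    intro k hk <;> simp only [Finset.mem_Icc, Finset.mem_range] at hk ⊢ <;> omega

lemma sum_int_split (a b n : ℕ) (f : ℤ → ℝ) :
    ∑ k ∈ Finset.range (n + 1), f k + ∑ m ∈ Finset.Icc 1 a, f (-(m : ℤ))
      + ∑ m ∈ Finset.Icc 1 b, f ((n : ℤ) + m) = ∑ k ∈ Finset.Icc (-(a : ℤ)) (n + b), f k := by
  have e : Finset.Icc (-(a : ℤ)) (n + b) =
      (Finset.Icc (0 : ℤ) n ∪ Finset.Icc (-(a : ℤ)) (-1)) ∪ Finset.Icc ((n : ℤ) + 1) (n + b) := by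
    ext m
    simp only [Finset.mem_union, Finset.mem_Icc]
    omega
  rw [e, Finset.sum_union, Finset.sum_union, sum_range_eq_sum_Icc_int]
  · congr 1
    · congr 1
      refine Finset.sum_bij' (fun m _ => -(m : ℤ)) (fun k _ => (-k).toNat)
        ?_ ?_ ?_ ?_ ?_ <;> intro m hm <;> rw [Finset.mem_Icc] at hm <;>
        (try simp only [Finset.mem_Icc]) <;> omega
    · refine Finset.sum_bij' (fun m _ => (n : ℤ) + m) (fun k _ => (k - n).toNat)
        ?_ ?_ ?_ ?_ ?_ <;> intro m hm <;> rw [Finset.mem_Icc] at hm <;>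
        (try simp only [Finset.mem_Icc]) <;> omega
  · rw [Finset.disjoint_left]
    intro m
    simp only [Finset.mem_Icc]
    omega
  · rw [Finset.disjoint_left]
    intro m
    simp only [Finset.mem_union, Finset.mem_Icc]
    omega

/-- The modified basis reproduces polynomials of degree less than `N` on `[0, 1]`. -/
lemma IsCoiflet.sum_pow_mul_ΦInt (hφ : IsCoiflet N M₁ p φ) (hd : IsIntegerDerivs N p φ d)
    (hS₀ : IsUnit (1 - S₀ N M₁ d)) (hS₁ : IsUnit (1 - S₁ N M₁ d)) {j : ℕ}
    (hj : 3 * N - 2 ≤ 2 ^ j) {i : ℕ} (hi : i < N) (c : ℝ) {x : ℝ} (hx : x ∈ Icc (0 : ℝ) 1) :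
    ∑ k ∈ Finset.range (2 ^ j + 1), ((k : ℝ) - c) ^ i * ΦInt N M₁ φ d 0 j k x =
      (2 ^ j * x - c) ^ i := by
  have hM1 := hφ.moment_pos
  have hM2 := hφ.moment_le
  set y : ℝ := 2 ^ j * x with hy
  have hy0 : 0 ≤ y := mul_nonneg (by positivity) hx.1
  have hy1 : y ≤ 2 ^ j := mul_le_of_le_one_right (by positivity) hx.2
  have hL : ∀ m : ℕ, ∑ k ∈ Finset.range M₁, ((k : ℝ) - c) ^ i * TL N M₁ d j k (-(m : ℝ) / 2 ^ j)
      = (-(m : ℝ) - c) ^ i := fun m =>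
    sum_add_pow_of_sum_pow (fun l hl => hφ.sum_pow_mul_TL hd hS₀ hl j m) (-c) hi
  have hR : ∀ m : ℕ, ∑ k ∈ Finset.range (3 * N - 2 - M₁ + 1),
      (-(k : ℝ) + (2 ^ j - c)) ^ i * TR N M₁ d j k (1 + (m : ℝ) / 2 ^ j)
      = ((m : ℝ) + (2 ^ j - c)) ^ i := fun m =>
    sum_add_pow_of_sum_pow (fun l hl => hφ.sum_pow_mul_TR hd hS₁ hl j m) (2 ^ j - c) hi
  -- On the whole line reproduction is known. By exactness of the extension, the boundary terms of
  -- the basis supply precisely the missing values at the exterior nodes.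
  have key := hφ.sum_pow (y := y)
    (s := Finset.Icc (-((3 * N - 2 - M₁ : ℕ) : ℤ)) ((2 ^ j : ℕ) + (M₁ - 1 : ℕ))) ?_ c hi
  · rw [← key, ← sum_int_split]
    simp only [ΦInt_zero, mul_add, Finset.sum_add_distrib, mul_ite, mul_zero]
    congr 1
    · congr 1
      rw [sum_ite_left hM1 (by omega)]
      simp_rw [Finset.mul_sum]
      rw [Finset.sum_comm]
      refine Finset.sum_congr rfl fun m _ => ?_
      push_cast
      rw [← hL m, Finset.sum_mul]
      exact Finset.sum_congr rfl fun k _ => by ring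
    · obtain ⟨g, hg⟩ : ∃ g : ℕ → ℝ, ∀ k, g k = (-(k : ℝ) + (2 ^ j - c)) ^ i *
          ∑ m ∈ Finset.Icc 1 (M₁ - 1),
            TR N M₁ d j k (1 + (m : ℝ) / 2 ^ j) * φ (y - ((2 : ℤ) ^ j + m : ℤ) + M₁) :=
        ⟨_, fun _ => rfl⟩
      have h1 : ∀ k ∈ Finset.range (2 ^ j + 1), (if 2 ^ j ≤ k + (3 * N - 2 - M₁) then
          ((k : ℝ) - c) ^ i * ∑ m ∈ Finset.Icc 1 (M₁ - 1),
            TR N M₁ d j (2 ^ j - k) (1 + (m : ℝ) / 2 ^ j) * φ (y - ((2 : ℤ) ^ j + m : ℤ) + M₁)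
          else 0) = if 2 ^ j ≤ k + (3 * N - 2 - M₁) then g (2 ^ j - k) else 0 := by
        intro k hk
        rw [Finset.mem_range] at hk
        refine if_congr Iff.rfl ?_ rfl
        have e : ((2 ^ j - k : ℕ) : ℝ) = 2 ^ j - k := by
          rw [Nat.cast_sub (by omega)]
          push_cast
          rfl
        rw [hg, e]
        congr 2
        ring
      rw [Finset.sum_congr rfl h1, sum_ite_right (by omega)]
      simp_rw [hg]
      simp_rw [Finset.mul_sum]
      rw [Finset.sum_comm]
      refine Finset.sum_congr rfl fun m _ => ?_
      push_cast
      rw [show (2 : ℝ) ^ j + m - c = m + (2 ^ j - c) by ring, ← hR m, Finset.sum_mul]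
      exact Finset.sum_congr rfl fun k _ => by ring
  · intro k hk
    have := hφ.support_Ioo hk
    rw [Finset.mem_Icc]
    constructor
    · have h : (M₁ : ℝ) - (3 * N - 1) < k := by linarith [this.2]
      have h' : (M₁ : ℤ) - (3 * N - 1) < k := by exact_mod_cast h
      omega
    · have h : (k : ℝ) < 2 ^ j + M₁ := by linarith [this.1]
      have h' : k < ((2 ^ j : ℕ) : ℤ) + M₁ := by
        push_cast
        exact_mod_cast h
      omega

/-- Away from the boundary the error of the monomial of degree `N` is a periodic function. -/
lemma IsCoiflet.sum_pow_order_mul_ΦInt (hφ : IsCoiflet N M₁ p φ) (hN : Even N) (hN0 : 0 < N)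
    {j : ℕ} (c : ℝ) {x : ℝ} (hx0 : 3 * N ≤ 2 ^ j * x) (hx1 : 2 ^ j * x ≤ 2 ^ j - 3 * N) :
    ∑ k ∈ Finset.range (2 ^ j + 1), ((k : ℝ) - c) ^ N * ΦInt N M₁ φ d 0 j k x =
      (2 ^ j * x - c) ^ N + periodicMoment M₁ φ N (2 ^ j * x) := by
  have hM1 := hφ.moment_pos
  have hM2 := hφ.moment_le
  have hM2' : (M₁ : ℝ) ≤ 3 * N - 2 := by
    have : M₁ + 2 ≤ 3 * N := by omega
    have : (M₁ : ℝ) + 2 ≤ 3 * N := by exact_mod_cast this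
    linarith
  have hM0 : (0 : ℝ) ≤ M₁ := by positivity
  have h1 : ∀ k : ℕ, ΦInt N M₁ φ d 0 j k x = φ (2 ^ j * x - (k : ℤ) + M₁) := by
    intro k
    have hL : ∀ m : ℕ, φ (2 ^ j * x - (-(m : ℤ) : ℤ) + M₁) = 0 := by
      intro m
      refine hφ.eq_zero fun h => ?_
      have := h.2
      push_cast at this
      linarith [Nat.cast_nonneg (α := ℝ) m]
    have hR : ∀ m : ℕ, φ (2 ^ j * x - ((2 : ℤ) ^ j + m : ℤ) + M₁) = 0 := by
      intro m
      refine hφ.eq_zero fun h => ?_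
      have := h.1
      push_cast at this
      linarith [Nat.cast_nonneg (α := ℝ) m]
    rw [ΦInt_zero]
    simp only [hL, hR, mul_zero, Finset.sum_const_zero, ite_self, add_zero, Int.cast_natCast]
  simp_rw [h1]
  have h2 := sum_range_eq_sum_Icc_int (2 ^ j)
    fun k : ℤ => ((k : ℝ) - c) ^ N * φ (2 ^ j * x - k + M₁)
  simp only [Int.cast_natCast] at h2 ⊢
  rw [h2]
  refine hφ.sum_pow_order hN hN0 (fun k hk => ?_) c
  have := hφ.support _ hk
  rw [Finset.mem_Icc]
  constructor
  · have h : (0 : ℝ) ≤ k := by linarith [this.2]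
    exact_mod_cast h
  · have h : (k : ℝ) ≤ 2 ^ j := by linarith [this.1]
    exact_mod_cast h

/-- The boundary corrections do not destroy locality: where one is active, both k and 2^j x lie
within 3N of the same end. -/
lemma IsCoiflet.abs_sub_le_of_ΦInt_ne_zero (hφ : IsCoiflet N M₁ p φ) {j k : ℕ}
    (hk : k ≤ 2 ^ j) {x : ℝ} (hx : x ∈ Icc (0 : ℝ) 1) (h : ΦInt N M₁ φ d 0 j k x ≠ 0) :
    |(k : ℝ) - 2 ^ j * x| ≤ 3 * N := by
  have hM1 := hφ.moment_pos
  have hM2 := hφ.moment_le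
  have hM2' : (M₁ : ℝ) + 2 ≤ 3 * N := by
    have : M₁ + 2 ≤ 3 * N := by omega
    exact_mod_cast this
  have hM0 : (0 : ℝ) ≤ M₁ := by positivity
  have hk0 : (0 : ℝ) ≤ k := by positivity
  have hk1 : (k : ℝ) ≤ 2 ^ j := by exact_mod_cast hk
  have hy0 : 0 ≤ 2 ^ j * x := mul_nonneg (by positivity) hx.1
  have hy1 : 2 ^ j * x ≤ 2 ^ j := mul_le_of_le_one_right (by positivity) hx.2
  rw [abs_le]
  by_contra hcon
  apply h
  rw [ΦInt_zero]
  have h1 : φ (2 ^ j * x - k + M₁) = 0 :=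
    hφ.eq_zero fun h => hcon ⟨by linarith [h.2], by linarith [h.1]⟩
  rw [h1, zero_add]
  have h2 : (if k ≤ M₁ - 1 then ∑ m ∈ Finset.Icc 1 (3 * N - 2 - M₁),
      TL N M₁ d j k (-(m : ℝ) / 2 ^ j) * φ (2 ^ j * x - (-(m : ℤ) : ℤ) + M₁) else 0) = 0 := by
    split_ifs with hk'
    · refine Finset.sum_eq_zero fun m _ => ?_
      rw [hφ.eq_zero, mul_zero]
      intro h
      have h2 := h.2
      push_cast at h2
      have hk'' : (k : ℝ) ≤ M₁ := by exact_mod_cast hk'.trans (Nat.sub_le _ _)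
      exact hcon ⟨by linarith [Nat.cast_nonneg (α := ℝ) m], by linarith⟩
    · rfl
  have h3 : (if 2 ^ j ≤ k + (3 * N - 2 - M₁) then ∑ m ∈ Finset.Icc 1 (M₁ - 1),
      TR N M₁ d j (2 ^ j - k) (1 + (m : ℝ) / 2 ^ j) * φ (2 ^ j * x - ((2 : ℤ) ^ j + m : ℤ) + M₁)
      else 0) = 0 := by
    split_ifs with hk'
    · refine Finset.sum_eq_zero fun m _ => ?_
      rw [hφ.eq_zero, mul_zero]
      intro h
      have h2 := h.1
      push_cast at h2
      have hk'' : 2 ^ j + M₁ ≤ k + 3 * N := by omega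
      have hk3 : (2 : ℝ) ^ j + M₁ ≤ k + 3 * N := by exact_mod_cast hk''
      exact hcon ⟨by linarith, by linarith [Nat.cast_nonneg (α := ℝ) m]⟩
    · rfl
  rw [h2, h3, zero_add]

lemma IsCoiflet.sum_abs_translates_le (hφ : IsCoiflet N M₁ p φ) (hN0 : 0 < N) {B : ℝ}
    (hB0 : 0 ≤ B) (hB : ∀ x, |φ x| ≤ B) (n : ℕ) (y : ℝ) :
    ∑ k ∈ Finset.range n, |φ (y - k + M₁)| ≤ 3 * N * B := by
  rw [← Finset.sum_filter_ne_zero]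
  refine (Finset.sum_le_card_nsmul _ _ B fun k _ => hB _).trans ?_
  rw [nsmul_eq_mul]
  refine mul_le_mul_of_nonneg_right ?_ hB0
  have h1 : ((Finset.range n).filter fun k : ℕ => |φ (y - k + M₁)| ≠ 0).card ≤
      (Finset.Icc ⌈y + M₁ - (3 * N - 1)⌉ ⌊y + M₁⌋).card := by
    refine Finset.card_le_card_of_injOn (fun k : ℕ => (k : ℤ)) ?_ fun a _ b _ h => by
      simpa using h
    intro k hk
    have h2 := (Finset.mem_filter.1 hk).2
    exact hφ.mem_of_ne_zero (k := (k : ℤ)) (by simpa using h2)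
  have h2 : (Finset.Icc ⌈y + M₁ - (3 * N - 1)⌉ ⌊y + M₁⌋).card ≤ 3 * N := by
    rw [Int.card_Icc]
    have h3 := Int.le_ceil (y + M₁ - (3 * N - 1))
    have h4 := Int.floor_le (y + M₁)
    have h5 : ((⌊y + M₁⌋ : ℤ) : ℝ) ≤ ⌈y + M₁ - (3 * N - 1)⌉ + (3 * N - 1) := by linarith
    have h6 : ⌊y + M₁⌋ ≤ ⌈y + M₁ - (3 * N - 1)⌉ + (3 * N - 1) := by exact_mod_cast h5
    omega
  exact_mod_cast h1.trans h2

/-- The Lebesgue function of the modified basis is bounded uniformly in the level. -/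
lemma IsCoiflet.exists_sum_abs_ΦInt_le (hφ : IsCoiflet N M₁ p φ) (hN0 : 0 < N)
    (d : ℕ → ℤ → ℝ) :
    ∃ C, 0 ≤ C ∧ ∀ j, 3 * N - 2 ≤ 2 ^ j → ∀ x,
      ∑ k ∈ Finset.range (2 ^ j + 1), |ΦInt N M₁ φ d 0 j k x| ≤ C := by
  obtain ⟨B, hB0, hB⟩ := hφ.exists_bound
  have hM1 := hφ.moment_pos
  have hM2 := hφ.moment_le
  set cL : ℕ → ℕ → ℝ := fun k m =>
    |∑ i : Fin N, ζ₀ N M₁ d i k / (i : ℕ).factorial * (-(m : ℝ)) ^ (i : ℕ)| with hcL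
  set cR : ℕ → ℕ → ℝ := fun k m =>
    |∑ i : Fin N, ζ₁ N M₁ d i k / (i : ℕ).factorial * (m : ℝ) ^ (i : ℕ)| with hcR
  refine ⟨3 * N * B + ∑ k ∈ Finset.range M₁, ∑ m ∈ Finset.Icc 1 (3 * N - 2 - M₁), cL k m * B
    + ∑ k ∈ Finset.range (3 * N - 2 - M₁ + 1), ∑ m ∈ Finset.Icc 1 (M₁ - 1), cR k m * B,
    by positivity, fun j hj x => ?_⟩
  obtain ⟨g, hg⟩ : ∃ g : ℕ → ℝ, ∀ k, g k = ∑ m ∈ Finset.Icc 1 (M₁ - 1), cR k m * B :=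
    ⟨_, fun _ => rfl⟩
  simp_rw [← hg]
  have h1 : ∀ k : ℕ, |ΦInt N M₁ φ d 0 j k x| ≤ |φ (2 ^ j * x - k + M₁)|
      + (if k ≤ M₁ - 1 then ∑ m ∈ Finset.Icc 1 (3 * N - 2 - M₁), cL k m * B else 0)
      + (if 2 ^ j ≤ k + (3 * N - 2 - M₁) then g (2 ^ j - k) else 0) := by
    intro k
    rw [ΦInt_zero]
    refine (abs_add_le _ _).trans (add_le_add ((abs_add_le _ _).trans (add_le_add le_rfl ?_)) ?_)
    · split_ifs
      · refine (Finset.abs_sum_le_sum_abs _ _).trans (Finset.sum_le_sum fun m _ => ?_)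
        rw [abs_mul, TL_node]
        exact mul_le_mul_of_nonneg_left (hB _) (abs_nonneg _)
      · simp
    · split_ifs
      · rw [hg]
        refine (Finset.abs_sum_le_sum_abs _ _).trans (Finset.sum_le_sum fun m _ => ?_)
        rw [abs_mul, TR_node]
        exact mul_le_mul_of_nonneg_left (hB _) (abs_nonneg _)
      · simp
  refine (Finset.sum_le_sum fun k _ => h1 k).trans ?_
  rw [Finset.sum_add_distrib, Finset.sum_add_distrib, sum_ite_left hM1 (by omega),
    sum_ite_right (by omega)]
  gcongr
  exact hφ.sum_abs_translates_le hN0 hB0 hB _ _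

lemma abs_le_of_sum_abs_le {n : ℕ} {f : ℕ → ℝ} {C : ℝ} (h : ∑ k ∈ Finset.range n, |f k| ≤ C)
    {k : ℕ} (hk : k < n) : |f k| ≤ C :=
  (Finset.single_le_sum (f := fun k => |f k|) (fun _ _ => abs_nonneg _)
    (Finset.mem_range.2 hk)).trans h

/-- The integrals of the basis functions over subintervals of `[0, 1]` are `O(2⁻ʲ)`. -/
lemma IsCoiflet.integral_abs_ΦInt_le (hφ : IsCoiflet N M₁ p φ) {C : ℝ} (hC0 : 0 ≤ C) {j : ℕ}
    (hC : ∀ x, ∑ k ∈ Finset.range (2 ^ j + 1), |ΦInt N M₁ φ d 0 j k x| ≤ C) {k : ℕ}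
    (hk : k ≤ 2 ^ j) {a b : ℝ} (ha : 0 ≤ a) (hab : a ≤ b) (hb : b ≤ 1) :
    ∫ x in a..b, |ΦInt N M₁ φ d 0 j k x| ≤ 6 * N * C * ((2 : ℝ) ^ j)⁻¹ := by
  have h2j : (0 : ℝ) < 2 ^ j := by positivity
  -- By locality the function lives on an interval of length 6N/2^j, and the Lebesgue bound `C` also
  -- bounds each single basis function.
  set I : Set ℝ := Icc (((k : ℝ) - 3 * N) / 2 ^ j) (((k : ℝ) + 3 * N) / 2 ^ j) with hI
  have hint : Integrable (I.indicator fun _ => C) :=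
    (integrable_indicator_iff measurableSet_Icc).2 (by simp)
  have h1 : ∀ x ∈ Ioc a b, |ΦInt N M₁ φ d 0 j k x| ≤ I.indicator (fun _ => C) x := by
    intro x hx
    by_cases h0 : ΦInt N M₁ φ d 0 j k x = 0
    · rw [h0, abs_zero]
      exact indicator_nonneg (fun _ _ => hC0) x
    · have := hφ.abs_sub_le_of_ΦInt_ne_zero hk ⟨by linarith [hx.1], by linarith [hx.2]⟩ h0
      rw [abs_le] at this
      rw [indicator_of_mem]
      · exact abs_le_of_sum_abs_le (hC x) (by omega)
      · rw [hI, mem_Icc, div_le_iff₀ h2j, le_div_iff₀ h2j]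
        constructor <;> linarith [this.1, this.2]
  rw [intervalIntegral.integral_of_le hab]
  have hc := (hφ.continuous_ΦInt_zero (d := d) j k).abs
  calc ∫ x in Ioc a b, |ΦInt N M₁ φ d 0 j k x|
      ≤ ∫ x in Ioc a b, I.indicator (fun _ => C) x :=
        setIntegral_mono_on (hc.integrableOn_Ioc) hint.integrableOn measurableSet_Ioc h1
    _ ≤ ∫ x, I.indicator (fun _ => C) x := setIntegral_le_integral hint
        (Filter.Eventually.of_forall fun x => indicator_nonneg (fun _ _ => hC0) x)
    _ = 6 * N * C * ((2 : ℝ) ^ j)⁻¹ := by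
        rw [integral_indicator measurableSet_Icc, setIntegral_const, Real.volume_real_Icc_of_le]
        · rw [smul_eq_mul]
          field_simp
          ring
        · gcongr
          have := Nat.cast_nonneg (α := ℝ) N
          linarith

end Basis

/-! ### Multiple integrals -/

section MultInt

lemma continuous_multInt {f : ℝ → ℝ} (hf : Continuous f) (n : ℕ) : Continuous (multInt n f) := by
  induction n with
  | zero => exact hf
  | succ n ih =>
    exact intervalIntegral.continuous_primitive (fun a b => ih.intervalIntegrable a b) 0

lemma hasDerivAt_multInt {f : ℝ → ℝ} (hf : Continuous f) (n : ℕ) (x : ℝ) :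
    HasDerivAt (multInt (n + 1) f) (multInt n f x) x := by
  have h := continuous_multInt hf n
  exact intervalIntegral.integral_hasDerivAt_right (h.intervalIntegrable _ _)
    (h.stronglyMeasurableAtFilter _ _) h.continuousAt

lemma multInt_comp (m n : ℕ) (f : ℝ → ℝ) : multInt m (multInt n f) = multInt (m + n) f := by
  induction m with
  | zero => rw [Nat.zero_add]; rfl
  | succ m ih => rw [Nat.succ_add, multInt, multInt, ih]

lemma multInt_add {f g : ℝ → ℝ} (hf : Continuous f) (hg : Continuous g) (n : ℕ) :
    multInt n (fun x => f x + g x) = fun x => multInt n f x + multInt n g x := by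
  induction n with
  | zero => rfl
  | succ n ih =>
    funext x
    simp only [multInt, ih]
    exact intervalIntegral.integral_add ((continuous_multInt hf n).intervalIntegrable _ _)
      ((continuous_multInt hg n).intervalIntegrable _ _)

lemma multInt_const_mul (c : ℝ) (f : ℝ → ℝ) (n : ℕ) :
    multInt n (fun x => c * f x) = fun x => c * multInt n f x := by
  induction n with
  | zero => rfl
  | succ n ih =>
    funext x
    simp only [multInt, ih]
    exact intervalIntegral.integral_const_mul _ _

lemma multInt_sub {f g : ℝ → ℝ} (hf : Continuous f) (hg : Continuous g) (n : ℕ) :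
    multInt n (fun x => f x - g x) = fun x => multInt n f x - multInt n g x := by
  have h := multInt_add hf (hg.const_mul (-1)) n
  rw [multInt_const_mul] at h
  simpa [sub_eq_add_neg] using h

lemma multInt_zero_fun (n : ℕ) : multInt n (fun _ => 0) = fun _ => 0 := by
  simpa using multInt_const_mul 0 (fun _ => (0 : ℝ)) n

lemma multInt_sum {ι : Type*} (s : Finset ι) (c : ι → ℝ) {f : ι → ℝ → ℝ}
    (hf : ∀ k, Continuous (f k)) (n : ℕ) :
    multInt n (fun x => ∑ k ∈ s, c k * f k x) = fun x => ∑ k ∈ s, c k * multInt n (f k) x := by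
  classical
  induction s using Finset.induction_on with
  | empty => simpa using multInt_zero_fun n
  | insert a s ha ih =>
    simp_rw [Finset.sum_insert ha]
    rw [multInt_add ((hf a).const_mul _) (by fun_prop), ih, multInt_const_mul]

lemma abs_multInt_le {f : ℝ → ℝ} {ε : ℝ} (hf : ∀ x ∈ Icc (0 : ℝ) 1, |f x| ≤ ε) (n : ℕ) :
    ∀ x ∈ Icc (0 : ℝ) 1, |multInt n f x| ≤ ε := by
  have hε : 0 ≤ ε := (abs_nonneg _).trans (hf 0 (by simp))
  induction n with
  | zero => exact hf
  | succ n ih =>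
    intro x hx
    have h := intervalIntegral.norm_integral_le_of_norm_le_const (a := 0) (b := x)
      (f := multInt n f) (C := ε) fun t ht => by
        rw [uIoc_of_le hx.1] at ht
        exact ih t ⟨ht.1.le, ht.2.trans hx.2⟩
    rw [sub_zero, abs_of_nonneg hx.1] at h
    exact h.trans (mul_le_of_le_one_right hε hx.2)

end MultInt

/-! ### Basis functions and approximations as iterated integrals of their level-zero versions -/

section Approx

variable {N M₁ : ℕ} {p : ℕ → ℝ} {φ : ℝ → ℝ} {d : ℕ → ℤ → ℝ}

/-- The boundary coefficients do not depend on n, so integration passes through the combination. All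
estimates can therefore be made for n = 0. -/
lemma IsCoiflet.ΦInt_eq_multInt (hφ : IsCoiflet N M₁ p φ) (n j k : ℕ) :
    ΦInt N M₁ φ d n j k = multInt n (ΦInt N M₁ φ d 0 j k) := by
  have h0 := hφ.continuous
  have hc : ∀ i : ℤ, Continuous fun ξ : ℝ => φ (2 ^ j * ξ - i) := fun i => by fun_prop
  have hc0 : ∀ i : ℤ, φInt φ 0 j i = fun ξ => φ (2 ^ j * ξ - i) := fun i => rfl
  have h1 : ΦInt N M₁ φ d 0 j k = fun x => φInt φ 0 j ((k : ℤ) - M₁) x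
    + (if k ≤ M₁ - 1 then
        ∑ m ∈ Finset.Icc 1 (3 * N - 2 - M₁),
          TL N M₁ d j k (-(m : ℝ) / 2 ^ j) * φInt φ 0 j (-(m : ℤ) - M₁) x
      else 0)
    + (if 2 ^ j ≤ k + (3 * N - 2 - M₁) then
        ∑ m ∈ Finset.Icc 1 (M₁ - 1),
          TR N M₁ d j (2 ^ j - k) (1 + (m : ℝ) / 2 ^ j) * φInt φ 0 j ((2 : ℤ) ^ j + m - M₁) x
      else 0) := rfl
  have hφ0 : ∀ i : ℤ, Continuous (φInt φ 0 j i) := hc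
  have hM : ∀ i : ℤ, φInt φ n j i = multInt n (φInt φ 0 j i) := fun i => rfl
  rw [h1, multInt_add, multInt_add]
  · funext x
    simp only [ΦInt, hM]
    congr 1
    · congr 1
      split_ifs
      · rw [multInt_sum _ _ fun m : ℕ => hφ0 (-(m : ℤ) - M₁)]
      · rw [multInt_zero_fun]
    · split_ifs
      · rw [multInt_sum _ _ fun m : ℕ => hφ0 ((2 : ℤ) ^ j + m - M₁)]
      · rw [multInt_zero_fun]
  · exact hφ0 _
  · split_ifs <;> fun_prop
  · refine (hφ0 _).add ?_
    split_ifs <;> fun_prop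
  · split_ifs <;> fun_prop

lemma IsCoiflet.continuous_approxInt_zero (hφ : IsCoiflet N M₁ p φ) (j : ℕ)
    (v : Fin (2 ^ j + 1) → ℝ) : Continuous (approxInt N M₁ φ d 0 j v) := by
  have h : ∀ k : ℕ, Continuous (ΦInt N M₁ φ d 0 j k) := fun k => hφ.continuous_ΦInt_zero j k
  exact continuous_finsetSum _ fun k _ => (h k).const_mul _

lemma IsCoiflet.approxInt_eq_multInt (hφ : IsCoiflet N M₁ p φ) (n j : ℕ)
    (v : Fin (2 ^ j + 1) → ℝ) :
    approxInt N M₁ φ d n j v = multInt n (approxInt N M₁ φ d 0 j v) := by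
  have h := multInt_sum Finset.univ v
    (fun k : Fin (2 ^ j + 1) => hφ.continuous_ΦInt_zero (d := d) j k) n
  refine Eq.trans ?_ h.symm
  funext x
  exact Finset.sum_congr rfl fun k _ => by rw [hφ.ΦInt_eq_multInt]

end Approx

/-! ### The integral operator of the boundary value problem -/

/-- The lower order part of the boundary value problem after integration, as an operator acting on
the primitive `F` of the highest derivative. -/
def lowerOp (α : Fin 5 → ℝ) (F : ℝ → ℝ) (x : ℝ) : ℝ :=
  α 0 * multInt 3 F x + α 1 * multInt 2 F x + α 2 * multInt 1 F x + α 3 * F x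
    - coeff₁ α x * multInt 3 F 1 - (coeff₃ α x - coeff₁ α x / 6) * multInt 1 F 1

section LowerOp

variable {N M₁ : ℕ} {p : ℕ → ℝ} {φ : ℝ → ℝ} {d : ℕ → ℤ → ℝ} {α : Fin 5 → ℝ}

lemma continuous_lowerOp {F : ℝ → ℝ} (hF : Continuous F) : Continuous (lowerOp α F) := by
  have h1 := continuous_multInt hF 1
  have h2 := continuous_multInt hF 2
  have h3 := continuous_multInt hF 3
  unfold lowerOp coeff₁ coeff₃
  fun_prop

lemma lowerOp_sub {F G : ℝ → ℝ} (hF : Continuous F) (hG : Continuous G) (x : ℝ) :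
    lowerOp α (fun x => F x - G x) x = lowerOp α F x - lowerOp α G x := by
  simp only [lowerOp, multInt_sub hF hG]
  ring

lemma abs_lowerOp_le {F : ℝ → ℝ} {ε : ℝ} (hF : ∀ x ∈ Icc (0 : ℝ) 1, |F x| ≤ ε) {x : ℝ}
    (hx : x ∈ Icc (0 : ℝ) 1) :
    |lowerOp α F x| ≤ 4 * (|α 0| + |α 1| + |α 2| + |α 3|) * ε := by
  have hε : 0 ≤ ε := (abs_nonneg _).trans (hF 0 (by simp))
  have h1x := abs_multInt_le hF 1 x hx
  have h2x := abs_multInt_le hF 2 x hx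
  have h3x := abs_multInt_le hF 3 x hx
  have h0x := hF x hx
  have h11 := abs_multInt_le hF 1 1 (by simp)
  have h31 := abs_multInt_le hF 3 1 (by simp)
  have key : ∀ c t s : ℝ, |t| ≤ ε → |s| ≤ 1 → |c * s * t| ≤ |c| * ε := by
    intro c t s ht hs
    rw [abs_mul, abs_mul]
    calc |c| * |s| * |t| ≤ |c| * 1 * ε := by gcongr
      _ = |c| * ε := by ring
  have hx1 : ∀ n : ℕ, ∀ c : ℝ, 1 ≤ c → |x ^ n / c| ≤ 1 := by
    intro n c hc
    rw [abs_div, abs_of_nonneg (pow_nonneg hx.1 _), abs_of_pos (by linarith),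
      div_le_one (by linarith)]
    exact (pow_le_one₀ hx.1 hx.2).trans hc
  -- Each of α₀ and α₁ occurs in four terms and each of α₂ and α₃ in two, which explains the factor
  -- 4.
  have e : lowerOp α F x = α 0 * 1 * multInt 3 F x + α 1 * 1 * multInt 2 F x
      + α 2 * 1 * multInt 1 F x + α 3 * 1 * F x
      + (-(α 0 * (x ^ 1 / 1) * multInt 3 F 1) + -(α 1 * 1 * multInt 3 F 1))
      + (-(α 0 * (x ^ 3 / 6) * multInt 1 F 1) + -(α 1 * (x ^ 2 / 2) * multInt 1 F 1)
        + -(α 2 * (x ^ 1 / 1) * multInt 1 F 1) + -(α 3 * 1 * multInt 1 F 1))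
      + (α 0 * (x ^ 1 / 6) * multInt 1 F 1 + α 1 * (x ^ 0 / 6) * multInt 1 F 1) := by
    simp only [lowerOp, coeff₁, coeff₃]
    ring
  have k1 := key (α 0) _ 1 h3x (by simp)
  have k2 := key (α 1) _ 1 h2x (by simp)
  have k3 := key (α 2) _ 1 h1x (by simp)
  have k4 := key (α 3) _ 1 h0x (by simp)
  have k5 := key (α 0) _ _ h31 (hx1 1 1 le_rfl)
  have k6 := key (α 1) _ 1 h31 (by simp)
  have k7 := key (α 0) _ _ h11 (hx1 3 6 (by norm_num))
  have k8 := key (α 1) _ _ h11 (hx1 2 2 (by norm_num))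
  have k9 := key (α 2) _ _ h11 (hx1 1 1 le_rfl)
  have k10 := key (α 3) _ 1 h11 (by simp)
  have k11 := key (α 0) _ _ h11 (hx1 1 6 (by norm_num))
  have k12 := key (α 1) _ _ h11 (hx1 0 6 (by norm_num))
  have p2 : 0 ≤ |α 2| * ε := by positivity
  have p3 : 0 ≤ |α 3| * ε := by positivity
  rw [e]
  rw [abs_le] at k1 k2 k3 k4 k5 k6 k7 k8 k9 k10 k11 k12 ⊢
  constructor <;> linarith [k1.1, k1.2, k2.1, k2.2, k3.1, k3.2, k4.1, k4.2, k5.1, k5.2, k6.1,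
    k6.2, k7.1, k7.2, k8.1, k8.2, k9.1, k9.2, k10.1, k10.2, k11.1, k11.2, k12.1, k12.2]

lemma lowerOp_multInt_one (f : ℝ → ℝ) (x : ℝ) : lowerOp α (multInt 1 f) x =
    α 0 * multInt 4 f x + α 1 * multInt 3 f x + α 2 * multInt 2 f x + α 3 * multInt 1 f x
    - coeff₁ α x * multInt 4 f 1 - (coeff₃ α x - coeff₁ α x / 6) * multInt 2 f 1 := by
  simp only [lowerOp, multInt_comp]

/-- Apart from the diagonal term, A sees `v` only through the primitive of its wavelet
approximation. This discrete twin of the integrated boundary value problem underlies both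
consistency and stability. -/
lemma IsCoiflet.colMatrix_mulVec (hφ : IsCoiflet N M₁ p φ) (j : ℕ) (v : Fin (2 ^ j + 1) → ℝ)
    (l : Fin (2 ^ j + 1)) : (colMatrix N M₁ φ d α j *ᵥ v) l =
      α 4 * v l + lowerOp α (multInt 1 (approxInt N M₁ φ d 0 j v)) (node j l) := by
  rw [lowerOp_multInt_one]
  simp only [← hφ.approxInt_eq_multInt]
  have h4 : α 4 * v l = ∑ k, (if l = k then α 4 else 0) * v k := by simp
  rw [h4]
  simp only [Matrix.mulVec, dotProduct, colMatrix, Matrix.of_apply, approxInt, Finset.mul_sum]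
  simp only [← Finset.sum_add_distrib, ← Finset.sum_sub_distrib]
  exact Finset.sum_congr rfl fun k _ => by ring

lemma node_mem (j : ℕ) (l : Fin (2 ^ j + 1)) : node j l ∈ Icc (0 : ℝ) 1 := by
  rw [node, mem_Icc]
  refine ⟨by positivity, div_le_one_of_le₀ ?_ (by positivity)⟩
  have : (l : ℕ) ≤ 2 ^ j := Nat.lt_succ_iff.1 l.2
  exact_mod_cast this

end LowerOp

/-! ### Classical solutions -/

section Solutions

variable {α : Fin 5 → ℝ}

lemma hasDerivWithinAt_iteratedDerivWithin {n m : ℕ} {u : ℝ → ℝ}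
    (hu : ContDiffOn ℝ n u (Icc 0 1)) (hm : m < n) {x : ℝ} (hx : x ∈ Icc (0 : ℝ) 1) :
    HasDerivWithinAt (iteratedDerivWithin m u (Icc 0 1))
      (iteratedDerivWithin (m + 1) u (Icc 0 1) x) (Icc 0 1) x := by
  rw [iteratedDerivWithin_succ]
  exact (hu.differentiableOn_iteratedDerivWithin (by exact_mod_cast hm)
    (uniqueDiffOn_Icc zero_lt_one) x hx).hasDerivWithinAt

lemma continuousOn_iteratedDerivWithin_unit {n m : ℕ} {u : ℝ → ℝ}
    (hu : ContDiffOn ℝ n u (Icc 0 1)) (hm : m ≤ n) :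
    ContinuousOn (iteratedDerivWithin m u (Icc 0 1)) (Icc 0 1) :=
  hu.continuousOn_iteratedDerivWithin (by exact_mod_cast hm) (uniqueDiffOn_Icc zero_lt_one)

lemma integral_of_hasDerivWithinAt_unit {f f' : ℝ → ℝ}
    (hf : ∀ x ∈ Icc (0 : ℝ) 1, HasDerivWithinAt f (f' x) (Icc 0 1) x)
    (hf' : ContinuousOn f' (Icc 0 1)) {x : ℝ} (hx : x ∈ Icc (0 : ℝ) 1) :
    f x = f 0 + ∫ t in (0 : ℝ)..x, f' t := by
  have hsub : Icc 0 x ⊆ Icc (0 : ℝ) 1 := Icc_subset_Icc le_rfl hx.2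
  rw [intervalIntegral.integral_eq_sub_of_hasDerivAt_of_le hx.1
    (fun t ht => ((hf t (hsub ht)).continuousWithinAt).mono hsub)
    (fun t ht => (hf t (hsub (Ioo_subset_Icc_self ht))).hasDerivAt
      (Icc_mem_nhds ht.1 (ht.2.trans_le hx.2)))]
  · ring
  · refine ContinuousOn.intervalIntegrable ?_
    rw [uIcc_of_le hx.1]
    exact hf'.mono hsub

/-- The integrated form of the boundary value problem. -/
lemma IsSolution.integral_equation {f : ℝ → ℝ} {a₀ a₁ b₀ b₁ : ℝ} {u : ℝ → ℝ}
    (hu : IsSolution α f a₀ a₁ b₀ b₁ u) {g : ℝ → ℝ}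
    (hg : ∀ x ∈ Icc (0 : ℝ) 1, iteratedDerivWithin 4 u (Icc 0 1) x = g x) {x : ℝ}
    (hx : x ∈ Icc (0 : ℝ) 1) :
    α 4 * g x + lowerOp α (multInt 1 g) x = f x - α 0 * a₀
      - b₀ * (α 0 * x ^ 2 / 2 + α 1 * x + α 2)
      - coeff₁ α x * (a₁ - a₀ - b₀ / 2 - (b₁ - b₀) / 6) - coeff₃ α x * (b₁ - b₀) := by
  have hcd : ContDiffOn ℝ (4 : ℕ) u (Icc 0 1) := by exact_mod_cast hu.contDiffOn
  have step : ∀ m < 4, ∀ x ∈ Icc (0 : ℝ) 1, iteratedDerivWithin m u (Icc 0 1) x =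
      iteratedDerivWithin m u (Icc 0 1) 0 +
        ∫ t in (0 : ℝ)..x, iteratedDerivWithin (m + 1) u (Icc 0 1) t := fun m hm x hx =>
    integral_of_hasDerivWithinAt_unit
      (fun t ht => hasDerivWithinAt_iteratedDerivWithin hcd hm ht)
      (continuousOn_iteratedDerivWithin_unit hcd hm) hx
  have hgc : ContinuousOn g (Icc 0 1) :=
    (continuousOn_iteratedDerivWithin_unit hcd le_rfl).congr fun x hx => (hg x hx).symm
  set c : ℕ → ℝ := fun m => iteratedDerivWithin m u (Icc 0 1) 0 with hc
  have hint : ∀ n, ∀ x ∈ Icc (0 : ℝ) 1, IntervalIntegrable (multInt n g) volume 0 x := by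
    have hcont : ∀ n, ContinuousOn (multInt n g) (Icc 0 1) := by
      intro n
      induction n with
      | zero => exact hgc
      | succ n ih =>
        have := intervalIntegral.continuousOn_primitive_interval (a := 0) (b := 1)
          (f := multInt n g) (μ := volume) (by
            rw [uIcc_of_le zero_le_one]
            exact ih.integrableOn_Icc)
        rwa [uIcc_of_le zero_le_one] at this
    intro n x hx
    refine ContinuousOn.intervalIntegrable ?_
    rw [uIcc_of_le hx.1]
    exact (hcont n).mono (Icc_subset_Icc le_rfl hx.2)
  -- One integration step: a derivative known as an iterated integral of g plus a polynomial P'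
  -- yields the next lower one, with P the primitive vanishing at 0 and c₀ the initial value.
  have next : ∀ (n : ℕ) (F P : ℝ → ℝ) (P' : ℝ → ℝ) (c₀ : ℝ), Continuous P' →
      (∀ t, HasDerivAt P (P' t) t) → P 0 = 0 →
      (∀ x ∈ Icc (0 : ℝ) 1, F x = multInt n g x + P' x) →
      ∀ x ∈ Icc (0 : ℝ) 1, c₀ + ∫ t in (0 : ℝ)..x, F t = multInt (n + 1) g x + (P x + c₀) := by
    intro n F P P' c₀ hP' hP hP0 hF x hx
    have h1 : ∫ t in (0 : ℝ)..x, F t = ∫ t in (0 : ℝ)..x, (multInt n g t + P' t) := by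
      refine intervalIntegral.integral_congr fun t ht => ?_
      rw [uIcc_of_le hx.1] at ht
      exact hF t ⟨ht.1, ht.2.trans hx.2⟩
    rw [h1, intervalIntegral.integral_add (hint n x hx) (hP'.intervalIntegrable _ _),
      intervalIntegral.integral_eq_sub_of_hasDerivAt (fun t _ => hP t)
        (hP'.intervalIntegrable _ _), hP0]
    simp only [multInt]
    ring
  have d1 : ∀ (a t : ℝ), HasDerivAt (fun t => a * t) a t := fun a t => by
    simpa using (hasDerivAt_id t).const_mul a
  have d2 : ∀ (a t : ℝ), HasDerivAt (fun t => a * t ^ 2 / 2) (a * t) t := fun a t => by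
    have := ((hasDerivAt_pow 2 t).const_mul a).div_const 2
    refine this.congr_deriv ?_
    push_cast
    ring
  have d3 : ∀ (a t : ℝ), HasDerivAt (fun t => a * t ^ 3 / 6) (a * t ^ 2 / 2) t := fun a t => by
    have := ((hasDerivAt_pow 3 t).const_mul a).div_const 6
    refine this.congr_deriv ?_
    push_cast
    ring
  have u3 : ∀ x ∈ Icc (0 : ℝ) 1, iteratedDerivWithin 3 u (Icc 0 1) x = multInt 1 g x + c 3 := by
    intro x hx
    rw [step 3 (by norm_num) x hx, next 0 _ (fun _ => 0) (fun _ => 0) _ continuous_const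
      (fun t => hasDerivAt_const t 0) rfl (fun x hx => by rw [hg x hx]; simp [multInt]) x hx]
    ring
  have u2 : ∀ x ∈ Icc (0 : ℝ) 1, iteratedDerivWithin 2 u (Icc 0 1) x =
      multInt 2 g x + (c 3 * x + c 2) := by
    intro x hx
    rw [step 2 (by norm_num) x hx, next 1 _ (fun t => c 3 * t) (fun _ => c 3) _ continuous_const
      (d1 _) (by simp) u3 x hx]
  have u1 : ∀ x ∈ Icc (0 : ℝ) 1, iteratedDerivWithin 1 u (Icc 0 1) x =
      multInt 3 g x + (c 3 * x ^ 2 / 2 + c 2 * x + c 1) := by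
    intro x hx
    rw [step 1 (by norm_num) x hx, next 2 _ (fun t => c 3 * t ^ 2 / 2 + c 2 * t)
      (fun t => c 3 * t + c 2) _ (by fun_prop) (fun t => (d2 _ t).add (d1 _ t)) (by simp) u2 x hx]
  have u0 : ∀ x ∈ Icc (0 : ℝ) 1, iteratedDerivWithin 0 u (Icc 0 1) x =
      multInt 4 g x + (c 3 * x ^ 3 / 6 + c 2 * x ^ 2 / 2 + c 1 * x + c 0) := by
    intro x hx
    rw [step 0 (by norm_num) x hx, next 3 _ (fun t => c 3 * t ^ 3 / 6 + c 2 * t ^ 2 / 2 + c 1 * t)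
      (fun t => c 3 * t ^ 2 / 2 + c 2 * t + c 1) _ (by fun_prop)
      (fun t => ((d3 _ t).add (d2 _ t)).add (d1 _ t)) (by simp) u1 x hx]
  have hc0 : c 0 = a₀ := by simpa [hc] using hu.left
  have hc2 : c 2 = b₀ := hu.left₂
  have h1 : (1 : ℝ) ∈ Icc (0 : ℝ) 1 := by simp
  have e2 := u2 1 h1
  rw [hu.right₂, hc2] at e2
  have e0 := u0 1 h1
  rw [iteratedDerivWithin_zero, hu.right, hc0, hc2] at e0
  have heq := hu.equation x hx
  rw [Fin.sum_univ_five] at heq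
  have v4 : iteratedDerivWithin ((4 : Fin 5) : ℕ) u (Icc 0 1) x = g x := hg x hx
  have v3 : iteratedDerivWithin ((3 : Fin 5) : ℕ) u (Icc 0 1) x = _ := u3 x hx
  have v2 : iteratedDerivWithin ((2 : Fin 5) : ℕ) u (Icc 0 1) x = _ := u2 x hx
  have v1 : iteratedDerivWithin ((1 : Fin 5) : ℕ) u (Icc 0 1) x = _ := u1 x hx
  have v0 : iteratedDerivWithin ((0 : Fin 5) : ℕ) u (Icc 0 1) x = _ := u0 x hx
  rw [v0, v1, v2, v3, v4, hc0, hc2] at heq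
  have e3 : c 3 = b₁ - b₀ - multInt 2 g 1 := by linarith
  have e1 : c 1 = a₁ - a₀ - b₀ / 2 - (b₁ - b₀ - multInt 2 g 1) / 6 - multInt 4 g 1 := by
    rw [← e3]
    linarith
  rw [e1, e3] at heq
  rw [lowerOp_multInt_one]
  simp only [coeff₁, coeff₃]
  linear_combination heq

lemma iteratedDerivWithin_eq_of_hasDerivWithinAt {n : ℕ} {w : ℕ → ℝ → ℝ}
    (hw : ∀ i < n, ∀ x ∈ Icc (0 : ℝ) 1, HasDerivWithinAt (w i) (w (i + 1) x) (Icc 0 1) x) :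
    ∀ i ≤ n, ∀ x ∈ Icc (0 : ℝ) 1, iteratedDerivWithin i (w 0) (Icc 0 1) x = w i x := by
  intro i
  induction i with
  | zero => simp
  | succ i ih =>
    intro hi x hx
    rw [iteratedDerivWithin_succ]
    have h := (hw i (by omega) x hx).congr (fun y hy => ih (by omega) y hy) (ih (by omega) x hx)
    exact h.derivWithin (uniqueDiffOn_Icc zero_lt_one x hx)

/-- Solutions of the homogeneous integral equation come from solutions of the homogeneous boundary
value problem. -/
lemma eq_zero_of_integral_equation
    (huniq : ∀ w : ℝ → ℝ, IsSolution α (fun _ => 0) 0 0 0 0 w → ∀ x ∈ Icc (0 : ℝ) 1, w x = 0)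
    {g : ℝ → ℝ} (hg : Continuous g)
    (h : ∀ x ∈ Icc (0 : ℝ) 1, α 4 * g x + lowerOp α (multInt 1 g) x = 0) :
    ∀ x ∈ Icc (0 : ℝ) 1, g x = 0 := by
  -- The constants c₃ and c₁ are the values w'''(0) and w'(0) that enforce w''(1) = 0 and w(1) = 0.
  set c₃ : ℝ := -multInt 2 g 1 with hc₃
  set c₁ : ℝ := -c₃ / 6 - multInt 4 g 1 with hc₁
  obtain ⟨w, hw0, hw1, hw2, hw3, hw4⟩ : ∃ w : ℕ → ℝ → ℝ,
      w 0 = (fun x => multInt 4 g x + (c₃ * x ^ 3 / 6 + c₁ * x)) ∧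
      w 1 = (fun x => multInt 3 g x + (c₃ * x ^ 2 / 2 + c₁)) ∧
      w 2 = (fun x => multInt 2 g x + c₃ * x) ∧
      w 3 = (fun x => multInt 1 g x + c₃) ∧ w 4 = g :=
    ⟨fun i => match i with
      | 0 => fun x => multInt 4 g x + (c₃ * x ^ 3 / 6 + c₁ * x)
      | 1 => fun x => multInt 3 g x + (c₃ * x ^ 2 / 2 + c₁)
      | 2 => fun x => multInt 2 g x + c₃ * x
      | 3 => fun x => multInt 1 g x + c₃
      | _ => g, rfl, rfl, rfl, rfl, rfl⟩
  have d1 : ∀ (a t : ℝ), HasDerivAt (fun t => a * t) a t := fun a t => by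
    simpa using (hasDerivAt_id t).const_mul a
  have hd : ∀ i < 4, ∀ x, HasDerivAt (w i) (w (i + 1) x) x := by
    intro i hi x
    interval_cases i
    · rw [hw0, hw1]
      have h3 := (((hasDerivAt_pow 3 x).const_mul c₃).div_const 6).add (d1 c₁ x)
      refine ((hasDerivAt_multInt hg 3 x).add h3).congr_deriv ?_
      push_cast
      ring
    · rw [hw1, hw2]
      have h3 := (((hasDerivAt_pow 2 x).const_mul c₃).div_const 2).add_const c₁
      refine ((hasDerivAt_multInt hg 2 x).add h3).congr_deriv ?_
      push_cast
      ring
    · rw [hw2, hw3]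
      exact (hasDerivAt_multInt hg 1 x).add (d1 c₃ x)
    · rw [hw3, hw4]
      exact (hasDerivAt_multInt hg 0 x).add_const c₃
  have hit := iteratedDerivWithin_eq_of_hasDerivWithinAt (n := 4) (w := w)
    fun i hi x _ => (hd i hi x).hasDerivWithinAt
  have hcont : ∀ i ≤ 4, Continuous (w i) := by
    intro i hi
    have m1 := continuous_multInt hg 1
    have m2 := continuous_multInt hg 2
    have m3 := continuous_multInt hg 3
    have m4 := continuous_multInt hg 4
    interval_cases i
    · rw [hw0]; fun_prop
    · rw [hw1]; fun_prop
    · rw [hw2]; fun_prop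
    · rw [hw3]; fun_prop
    · rw [hw4]; exact hg
  have h0 : ∀ n, multInt (n + 1) g 0 = 0 := fun n => by simp [multInt]
  have hsol : IsSolution α (fun _ => 0) 0 0 0 0 (w 0) := by
    refine ⟨?_, ?_, ?_, ?_, ?_, ?_⟩
    · have := contDiffOn_of_continuousOn_differentiableOn_deriv (𝕜 := ℝ) (n := (4 : ℕ))
        (f := w 0) (s := Icc 0 1) (fun m hm => ?_) (fun m hm => ?_)
      · exact_mod_cast this
      · have hm' : m ≤ 4 := by exact_mod_cast hm
        exact (hcont m hm').continuousOn.congr (hit m hm')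
      · have hm' : m < 4 := by exact_mod_cast hm
        exact DifferentiableOn.congr
          (fun x _ => (hd m hm' x).differentiableAt.differentiableWithinAt) (hit m hm'.le)
    · intro x hx
      rw [Fin.sum_univ_five]
      have v4 : iteratedDerivWithin ((4 : Fin 5) : ℕ) (w 0) (Icc 0 1) x = _ :=
        hit 4 (by norm_num) x hx
      have v3 : iteratedDerivWithin ((3 : Fin 5) : ℕ) (w 0) (Icc 0 1) x = _ :=
        hit 3 (by norm_num) x hx
      have v2 : iteratedDerivWithin ((2 : Fin 5) : ℕ) (w 0) (Icc 0 1) x = _ :=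
        hit 2 (by norm_num) x hx
      have v1 : iteratedDerivWithin ((1 : Fin 5) : ℕ) (w 0) (Icc 0 1) x = _ :=
        hit 1 (by norm_num) x hx
      have v0 : iteratedDerivWithin ((0 : Fin 5) : ℕ) (w 0) (Icc 0 1) x = _ :=
        hit 0 (by norm_num) x hx
      rw [v0, v1, v2, v3, v4, hw0, hw1, hw2, hw3, hw4]
      have hx' := h x hx
      rw [lowerOp_multInt_one] at hx'
      simp only [coeff₁, coeff₃] at hx'
      rw [hc₁, hc₃]
      linear_combination hx'
    · rw [hw0]
      simp [h0]
    · rw [hw0]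
      simp only
      rw [hc₁]
      ring
    · rw [hit 2 (by norm_num) 0 (by simp), hw2]
      simp [h0]
    · rw [hit 2 (by norm_num) 1 (by simp), hw2]
      simp only
      rw [hc₃]
      ring
  have hz := huniq _ hsol
  intro x hx
  rw [← hw4, ← hit 4 le_rfl x hx]
  have := iteratedDerivWithin_congr (n := 4) (f := w 0) (g := fun _ => (0 : ℝ)) (s := Icc 0 1)
    (fun y hy => hz y hy) hx
  rw [this]
  simp

end Solutions

/-! ### Approximation by nodal values -/

/-- The values of `g` at the collocation points. -/
def sample (j : ℕ) (g : ℝ → ℝ) (l : Fin (2 ^ j + 1)) : ℝ := g (node j l)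

/-- The remainder after the full degree-n Taylor polynomial is governed by the oscillation ρ of the
n-th derivative, so a Hölder condition on that derivative suffices. The induction shifts the family
and applies the mean value inequality on the convex set of points of [0,1] within δ of z. -/
lemma abs_sub_taylor_le {n : ℕ} {g : ℕ → ℝ → ℝ} {z δ ρ : ℝ} (hz : z ∈ Icc (0 : ℝ) 1)
    (hδ : 0 ≤ δ)
    (hg : ∀ i < n, ∀ x ∈ Icc (0 : ℝ) 1, HasDerivWithinAt (g i) (g (i + 1) x) (Icc 0 1) x)
    (hρ : ∀ y ∈ Icc (0 : ℝ) 1, |y - z| ≤ δ → |g n y - g n z| ≤ ρ) :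
    ∀ y ∈ Icc (0 : ℝ) 1, |y - z| ≤ δ →
      |g 0 y - ∑ i ∈ Finset.range (n + 1), g i z / i.factorial * (y - z) ^ i| ≤ ρ * δ ^ n := by
  induction n generalizing g with
  | zero => simpa using hρ
  | succ n ih =>
    have ih' := ih (g := fun i => g (i + 1)) (fun i hi => hg (i + 1) (by omega)) hρ
    intro y hy hyz
    set s : Set ℝ := Icc (z - δ) (z + δ) ∩ Icc 0 1 with hs
    have hmem : ∀ t, t ∈ s ↔ t ∈ Icc (0 : ℝ) 1 ∧ |t - z| ≤ δ := by
      intro t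
      rw [hs, mem_inter_iff, abs_le, mem_Icc]
      constructor
      · rintro ⟨⟨h1, h2⟩, h3⟩
        exact ⟨h3, by linarith, by linarith⟩
      · rintro ⟨h3, h1, h2⟩
        exact ⟨⟨by linarith, by linarith⟩, h3⟩
    have hconv : Convex ℝ s := (convex_Icc _ _).inter (convex_Icc _ _)
    have hpoly : ∀ t : ℝ, HasDerivAt
        (fun y => ∑ i ∈ Finset.range (n + 2), g i z / i.factorial * (y - z) ^ i)
        (∑ i ∈ Finset.range (n + 1), g (i + 1) z / i.factorial * (t - z) ^ i) t := by
      intro t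
      have h1 : (fun y => ∑ i ∈ Finset.range (n + 2), g i z / i.factorial * (y - z) ^ i) =
          fun y => ∑ i ∈ Finset.range (n + 1), g (i + 1) z / (i + 1).factorial * (y - z) ^ (i + 1)
            + g 0 z := by
        funext y
        rw [Finset.sum_range_succ']
        simp
      rw [h1]
      refine HasDerivAt.add_const _ (HasDerivAt.fun_sum fun i _ => ?_)
      have h2 := (((hasDerivAt_id t).sub_const z).fun_pow (i + 1)).const_mul
        (g (i + 1) z / (i + 1).factorial)
      refine h2.congr_deriv ?_
      rw [Nat.factorial_succ]
      push_cast
      have h3 : (i.factorial : ℝ) ≠ 0 := by positivity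
      simp only [id]
      field_simp
    have key := hconv.norm_image_sub_le_of_norm_hasDerivWithin_le
      (f := fun y => g 0 y - ∑ i ∈ Finset.range (n + 2), g i z / i.factorial * (y - z) ^ i)
      (f' := fun t => g 1 t - ∑ i ∈ Finset.range (n + 1), g (i + 1) z / i.factorial * (t - z) ^ i)
      (C := ρ * δ ^ n) (x := z) (y := y)
      (fun t ht => ((hg 0 (by omega) t ht.2).mono inter_subset_right).sub
        (hpoly t).hasDerivWithinAt)
      (fun t ht => ih' t ht.2 ((hmem t).1 ht).2)
      ((hmem z).2 ⟨hz, by simpa using hδ⟩) ((hmem y).2 ⟨hy, hyz⟩)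
    have h0 : g 0 z - ∑ i ∈ Finset.range (n + 2), g i z / i.factorial * (z - z) ^ i = 0 := by
      rw [Finset.sum_range_succ']
      simp
    simp only [h0, sub_zero, Real.norm_eq_abs] at key
    refine key.trans ?_
    have hρ0 : 0 ≤ ρ := (abs_nonneg _).trans (hρ z hz (by simpa using hδ))
    rw [pow_succ, ← mul_assoc]
    exact mul_le_mul_of_nonneg_left hyz (by positivity)

/-- An integral is small if the integrals over most of the cells of a uniform partition are. -/
lemma abs_integral_le_of_cells {f : ℝ → ℝ} (hf : Continuous f) {n b : ℕ} (hn : 0 < n) {A B : ℝ}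
    (hA0 : 0 ≤ A) (hB0 : 0 ≤ B) (hA : ∀ x ∈ Icc (0 : ℝ) 1, |f x| ≤ A)
    (hB : ∀ l : ℕ, b ≤ l → l + 1 + b ≤ n →
      |∫ t in ((l : ℝ) / n)..(((l + 1 : ℕ) : ℝ) / n), f t| ≤ B / n)
    {x : ℝ} (hx : x ∈ Icc (0 : ℝ) 1) :
    |∫ t in (0 : ℝ)..x, f t| ≤ B + (2 * b + 1) * (A / n) := by
  have hn' : (0 : ℝ) < n := by exact_mod_cast hn
  set m := ⌊x * n⌋₊ with hm
  have hm1 : (m : ℝ) ≤ x * n := Nat.floor_le (mul_nonneg hx.1 hn'.le)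
  have hm2 : x * n < m + 1 := Nat.lt_floor_add_one _
  have hmn : m ≤ n := by
    have : (m : ℝ) ≤ n := hm1.trans (mul_le_of_le_one_left hn'.le hx.2)
    exact_mod_cast this
  have hshort : ∀ a c : ℝ, 0 ≤ a → a ≤ c → c ≤ 1 → c - a ≤ 1 / n → |∫ t in a..c, f t| ≤ A / n := by
    intro a c ha hac hc hle
    have h := intervalIntegral.norm_integral_le_of_norm_le_const (a := a) (b := c)
      (f := f) (C := A) fun t ht => by
        rw [uIoc_of_le hac] at ht
        exact hA t ⟨by linarith [ht.1], by linarith [ht.2]⟩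
    rw [abs_of_nonneg (by linarith)] at h
    refine h.trans ?_
    rw [div_eq_mul_one_div]
    exact mul_le_mul_of_nonneg_left hle hA0
  -- The b cells at each end are bounded trivially by A/n. Together with the incomplete last cell
  -- they account for the coefficient 2b+1.
  have hcell : ∀ l ∈ Finset.range m, |∫ t in ((l : ℝ) / n)..(((l + 1 : ℕ) : ℝ) / n), f t| ≤
      B / n + (if l < b then A / n else 0) + (if n < l + 1 + b then A / n else 0) := by
    intro l hl
    rw [Finset.mem_range] at hl
    have hB' : 0 ≤ B / n := by positivity
    have hA' : 0 ≤ A / n := by positivity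
    have h1 : |∫ t in ((l : ℝ) / n)..(((l + 1 : ℕ) : ℝ) / n), f t| ≤ A / n := by
      refine hshort _ _ (by positivity) ?_ ?_ ?_
      · gcongr
        simp
      · rw [div_le_one hn']
        exact_mod_cast (by omega : l + 1 ≤ n)
      · rw [← sub_div]
        push_cast
        rw [add_sub_cancel_left]
    split_ifs with c1 c2 c2
    · linarith
    · linarith
    · linarith
    · linarith [hB l (by omega) (by omega)]
  have hsum1 : ∑ l ∈ Finset.range m, (if l < b then A / n else 0) ≤ b * (A / n) := by
    rw [← Finset.sum_filter, Finset.sum_const, nsmul_eq_mul]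
    refine mul_le_mul_of_nonneg_right ?_ (by positivity)
    have : ((Finset.range m).filter fun l => l < b).card ≤ (Finset.range b).card :=
      Finset.card_le_card fun l hl => by simpa using (Finset.mem_filter.1 hl).2
    rw [Finset.card_range] at this
    exact_mod_cast this
  have hsum2 : ∑ l ∈ Finset.range m, (if n < l + 1 + b then A / n else 0) ≤ b * (A / n) := by
    rw [← Finset.sum_filter, Finset.sum_const, nsmul_eq_mul]
    refine mul_le_mul_of_nonneg_right ?_ (by positivity)
    have : ((Finset.range m).filter fun l => n < l + 1 + b).card ≤ (Finset.Ico (n - b) n).card :=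
      Finset.card_le_card fun l hl => by
        simp only [Finset.mem_filter, Finset.mem_range] at hl
        rw [Finset.mem_Ico]
        omega
    rw [Nat.card_Ico] at this
    exact_mod_cast this.trans (by omega)
  have hsum3 : ∑ l ∈ Finset.range m, B / n ≤ B := by
    rw [Finset.sum_const, nsmul_eq_mul, Finset.card_range, mul_div_assoc', div_le_iff₀ hn',
      mul_comm]
    exact mul_le_mul_of_nonneg_left (by exact_mod_cast hmn) hB0
  have hsplit : ∫ t in (0 : ℝ)..x, f t =
      ∑ l ∈ Finset.range m, (∫ t in ((l : ℝ) / n)..(((l + 1 : ℕ) : ℝ) / n), f t)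
        + ∫ t in ((m : ℝ) / n)..x, f t := by
    rw [intervalIntegral.sum_integral_adjacent_intervals (a := fun l : ℕ => (l : ℝ) / n)
      fun k _ => hf.intervalIntegrable _ _]
    rw [intervalIntegral.integral_add_adjacent_intervals (hf.intervalIntegrable _ _)
      (hf.intervalIntegrable _ _)]
    simp
  have hrest : |∫ t in ((m : ℝ) / n)..x, f t| ≤ A / n := by
    refine hshort _ _ (by positivity) ?_ hx.2 ?_
    · rwa [div_le_iff₀ hn']
    · rw [sub_le_iff_le_add, ← add_div, le_div_iff₀ hn']
      linarith
  rw [hsplit]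
  refine (abs_add_le _ _).trans ?_
  have h5 := (Finset.abs_sum_le_sum_abs _ _).trans (Finset.sum_le_sum hcell)
  rw [Finset.sum_add_distrib, Finset.sum_add_distrib] at h5
  linarith

/-! ### Local approximation error and cancellation over interior cells -/

section Consistency

variable {N M₁ : ℕ} {p : ℕ → ℝ} {φ : ℝ → ℝ} {d : ℕ → ℤ → ℝ}

lemma approxInt_sample (j : ℕ) (g : ℝ → ℝ) (x : ℝ) :
    approxInt N M₁ φ d 0 j (sample j g) x =
      ∑ k ∈ Finset.range (2 ^ j + 1), g ((k : ℝ) / 2 ^ j) * ΦInt N M₁ φ d 0 j k x := by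
  rw [← Fin.sum_univ_eq_sum_range
    (fun k : ℕ => g ((k : ℝ) / 2 ^ j) * ΦInt N M₁ φ d 0 j k x) (2 ^ j + 1)]
  rfl

/-- Functions that are close near `x` have close approximations at `x`. -/
lemma IsCoiflet.abs_approxInt_sample_sub_le (hφ : IsCoiflet N M₁ p φ) {C : ℝ} {j : ℕ}
    (hC : ∀ x, ∑ k ∈ Finset.range (2 ^ j + 1), |ΦInt N M₁ φ d 0 j k x| ≤ C) {g q : ℝ → ℝ}
    {x ε : ℝ} (hx : x ∈ Icc (0 : ℝ) 1)
    (hε : ∀ y ∈ Icc (0 : ℝ) 1, |y - x| ≤ 3 * N / 2 ^ j → |g y - q y| ≤ ε) :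
    |approxInt N M₁ φ d 0 j (sample j g) x - approxInt N M₁ φ d 0 j (sample j q) x| ≤ ε * C := by
  have h2j : (0 : ℝ) < 2 ^ j := by positivity
  have hε0 : 0 ≤ ε := (abs_nonneg _).trans (hε x hx (by simp; positivity))
  rw [approxInt_sample, approxInt_sample, ← Finset.sum_sub_distrib]
  refine (Finset.abs_sum_le_sum_abs _ _).trans ?_
  refine le_trans ?_ (mul_le_mul_of_nonneg_left (hC x) hε0)
  rw [Finset.mul_sum]
  refine Finset.sum_le_sum fun k hk => ?_
  rw [Finset.mem_range] at hk
  rw [← sub_mul, abs_mul]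
  by_cases h0 : ΦInt N M₁ φ d 0 j k x = 0
  · simp [h0]
  refine mul_le_mul_of_nonneg_right (hε _ ⟨by positivity, ?_⟩ ?_) (abs_nonneg _)
  · rw [div_le_one h2j]
    exact_mod_cast (by omega : k ≤ 2 ^ j)
  · have h1 := hφ.abs_sub_le_of_ΦInt_ne_zero (by omega) hx h0
    rw [show (k : ℝ) / 2 ^ j - x = (k - 2 ^ j * x) / 2 ^ j by field_simp, abs_div,
      abs_of_pos h2j]
    gcongr

lemma IsCoiflet.approxInt_sample_poly (hφ : IsCoiflet N M₁ p φ) (hd : IsIntegerDerivs N p φ d)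
    (hS₀ : IsUnit (1 - S₀ N M₁ d)) (hS₁ : IsUnit (1 - S₁ N M₁ d)) {j : ℕ}
    (hj : 3 * N - 2 ≤ 2 ^ j) (a : ℕ → ℝ) (z : ℝ) {x : ℝ} (hx : x ∈ Icc (0 : ℝ) 1) :
    approxInt N M₁ φ d 0 j (sample j fun y => ∑ i ∈ Finset.range N, a i * (y - z) ^ i) x =
      ∑ i ∈ Finset.range N, a i * (x - z) ^ i := by
  have h2j : (2 : ℝ) ^ j ≠ 0 := by positivity
  rw [approxInt_sample]
  simp_rw [Finset.sum_mul]
  rw [Finset.sum_comm]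
  refine Finset.sum_congr rfl fun i hi => ?_
  have h := hφ.sum_pow_mul_ΦInt hd hS₀ hS₁ hj (Finset.mem_range.1 hi) (2 ^ j * z) hx
  rw [show 2 ^ j * x - 2 ^ j * z = 2 ^ j * (x - z) by ring, mul_pow] at h
  have h' : ∀ k : ℕ, a i * ((k : ℝ) / 2 ^ j - z) ^ i * ΦInt N M₁ φ d 0 j k x =
      a i / (2 ^ j) ^ i * (((k : ℝ) - 2 ^ j * z) ^ i * ΦInt N M₁ φ d 0 j k x) := by
    intro k
    rw [show (k : ℝ) / 2 ^ j - z = (k - 2 ^ j * z) / 2 ^ j by field_simp, div_pow]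
    ring
  simp_rw [h']
  rw [← Finset.mul_sum, h]
  field_simp

lemma IsCoiflet.approxInt_sample_pow_order (hφ : IsCoiflet N M₁ p φ) (hN : Even N) (hN0 : 0 < N)
    {j : ℕ} (z : ℝ) {x : ℝ} (hx0 : 3 * N ≤ 2 ^ j * x) (hx1 : 2 ^ j * x ≤ 2 ^ j - 3 * N) (a : ℝ) :
    approxInt N M₁ φ d 0 j (sample j fun y => a * (y - z) ^ N) x =
      a * (x - z) ^ N + a / (2 ^ j) ^ N * periodicMoment M₁ φ N (2 ^ j * x) := by
  have h2j : (2 : ℝ) ^ j ≠ 0 := by positivity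
  rw [approxInt_sample]
  have h := hφ.sum_pow_order_mul_ΦInt (d := d) hN hN0 (2 ^ j * z) hx0 hx1
  rw [show 2 ^ j * x - 2 ^ j * z = 2 ^ j * (x - z) by ring, mul_pow] at h
  have h' : ∀ k : ℕ, a * ((k : ℝ) / 2 ^ j - z) ^ N * ΦInt N M₁ φ d 0 j k x =
      a / (2 ^ j) ^ N * (((k : ℝ) - 2 ^ j * z) ^ N * ΦInt N M₁ φ d 0 j k x) := by
    intro k
    rw [show (k : ℝ) / 2 ^ j - z = (k - 2 ^ j * z) / 2 ^ j by field_simp, div_pow]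
    ring
  simp_rw [h']
  rw [← Finset.mul_sum, h]
  field_simp

lemma approxInt_sample_add (j : ℕ) (g q : ℝ → ℝ) (x : ℝ) :
    approxInt N M₁ φ d 0 j (sample j fun y => g y + q y) x =
      approxInt N M₁ φ d 0 j (sample j g) x + approxInt N M₁ φ d 0 j (sample j q) x := by
  simp only [approxInt_sample, add_mul, Finset.sum_add_distrib]

/-- The approximation of a `C^N` function by its nodal values has order `N`. -/
lemma IsCoiflet.abs_approxInt_sub_le (hφ : IsCoiflet N M₁ p φ) (hd : IsIntegerDerivs N p φ d)
    (hS₀ : IsUnit (1 - S₀ N M₁ d)) (hS₁ : IsUnit (1 - S₁ N M₁ d)) {C : ℝ} {j : ℕ}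
    (hj : 3 * N - 2 ≤ 2 ^ j)
    (hC : ∀ x, ∑ k ∈ Finset.range (2 ^ j + 1), |ΦInt N M₁ φ d 0 j k x| ≤ C)
    {g : ℕ → ℝ → ℝ} {S : ℝ}
    (hg : ∀ i < N, ∀ x ∈ Icc (0 : ℝ) 1, HasDerivWithinAt (g i) (g (i + 1) x) (Icc 0 1) x)
    (hS : ∀ x ∈ Icc (0 : ℝ) 1, |g N x| ≤ S) {x : ℝ} (hx : x ∈ Icc (0 : ℝ) 1) :
    |approxInt N M₁ φ d 0 j (sample j (g 0)) x - g 0 x| ≤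
      3 * S * (3 * N) ^ N * C * ((2 : ℝ) ^ (j * N))⁻¹ := by
  have hS0 : 0 ≤ S := (abs_nonneg _).trans (hS x hx)
  have hC0 : 0 ≤ C := (Finset.sum_nonneg fun _ _ => abs_nonneg _).trans (hC x)
  set δ : ℝ := 3 * N / 2 ^ j with hδ
  have hδ0 : 0 ≤ δ := by positivity
  -- The Taylor polynomial is centred at the evaluation point, so its exact reproduction returns
  -- g(x) itself.
  set q : ℝ → ℝ := fun y => ∑ i ∈ Finset.range N, g i x / i.factorial * (y - x) ^ i with hq
  have hqx : approxInt N M₁ φ d 0 j (sample j q) x = q x :=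
    hφ.approxInt_sample_poly hd hS₀ hS₁ hj (fun i => g i x / i.factorial) x hx
  have hqx' : q x = g 0 x := by
    have hN0 : 0 < N := by
      have := hφ.moment_le
      have := hφ.moment_pos
      omega
    simp only [hq, sub_self]
    rw [Finset.sum_eq_single 0]
    · simp
    · intro i _ hi
      simp [hi]
    · intro h
      exact absurd (Finset.mem_range.2 hN0) h
  -- The constant 3S combines the oscillation bound 2S of the N-th derivative with S for the omitted
  -- term of degree N.
  have hbound : ∀ y ∈ Icc (0 : ℝ) 1, |y - x| ≤ 3 * N / 2 ^ j → |g 0 y - q y| ≤ 3 * S * δ ^ N := by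
    intro y hy hyx
    have h1 := abs_sub_taylor_le hx hδ0 hg (ρ := 2 * S) (fun y hy _ =>
      (abs_sub _ _).trans (by linarith [hS y hy, hS x hx])) y hy hyx
    rw [Finset.sum_range_succ] at h1
    have h2 : |g N x / N.factorial * (y - x) ^ N| ≤ S * δ ^ N := by
      rw [abs_mul, abs_pow, abs_div, Nat.abs_cast]
      have h3 : |g N x| / (N.factorial : ℝ) ≤ S :=
        (div_le_self (abs_nonneg _) (by exact_mod_cast N.factorial_pos)).trans (hS x hx)
      exact mul_le_mul h3 (pow_le_pow_left₀ (abs_nonneg _) hyx N) (by positivity) hS0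
    have h3 : g 0 y - q y = (g 0 y - (q y + g N x / N.factorial * (y - x) ^ N))
        + g N x / N.factorial * (y - x) ^ N := by ring
    rw [h3]
    refine (abs_add_le _ _).trans ?_
    linarith
  have h := hφ.abs_approxInt_sample_sub_le hC hx hbound
  rw [hqx, hqx'] at h
  refine h.trans (le_of_eq ?_)
  rw [hδ, div_pow, ← pow_mul]
  ring

/-- Superconvergence of the integral over an interior cell. -/
lemma IsCoiflet.abs_integral_cell_le (hφ : IsCoiflet N M₁ p φ) (hN : Even N) (hN0 : 0 < N)
    (hd : IsIntegerDerivs N p φ d)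
    (hS₀ : IsUnit (1 - S₀ N M₁ d)) (hS₁ : IsUnit (1 - S₁ N M₁ d)) {C : ℝ} {j : ℕ}
    (hj : 3 * N - 2 ≤ 2 ^ j)
    (hC : ∀ x, ∑ k ∈ Finset.range (2 ^ j + 1), |ΦInt N M₁ φ d 0 j k x| ≤ C)
    {g : ℕ → ℝ → ℝ} (hgc : Continuous (g 0)) {L : ℝ}
    (hg : ∀ i < N, ∀ x ∈ Icc (0 : ℝ) 1, HasDerivWithinAt (g i) (g (i + 1) x) (Icc 0 1) x)
    (hL0 : 0 ≤ L)
    (hL : ∀ x ∈ Icc (0 : ℝ) 1, ∀ y ∈ Icc (0 : ℝ) 1, |g N x - g N y| ≤ L * √|x - y|)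
    {l : ℕ} (hl0 : 3 * N ≤ l) (hl1 : l + 1 + 3 * N ≤ 2 ^ j) :
    |∫ t in ((l : ℝ) / (2 ^ j : ℕ))..(((l + 1 : ℕ) : ℝ) / (2 ^ j : ℕ)),
        (approxInt N M₁ φ d 0 j (sample j (g 0)) t - g 0 t)| ≤
      (C + 1) * L * √((3 * N + 1) / 2 ^ j) * ((3 * N + 1) / 2 ^ j) ^ N / (2 ^ j : ℕ) := by
  have h2j : (0 : ℝ) < 2 ^ j := by positivity
  set z : ℝ := (l : ℝ) / 2 ^ j with hz
  -- The basis reaches 3N nodes from t, and t lies at most one cell away from z.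
  set δ : ℝ := (3 * N + 1) / 2 ^ j with hδ
  have hδ0 : 0 ≤ δ := by positivity
  have hl1' : (l : ℝ) + 1 + 3 * N ≤ 2 ^ j := by exact_mod_cast hl1
  have hl0' : 3 * (N : ℝ) ≤ l := by exact_mod_cast hl0
  have hN' : (0 : ℝ) ≤ N := by positivity
  have hz1 : z ∈ Icc (0 : ℝ) 1 := ⟨by positivity, by rw [hz, div_le_one h2j]; linarith⟩
  push_cast
  set z' : ℝ := ((l : ℝ) + 1) / 2 ^ j with hz'
  have hzz : z ≤ z' := by rw [hz, hz']; gcongr; linarith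
  set a : ℕ → ℝ := fun i => g i z / i.factorial with ha
  set q : ℝ → ℝ := fun y => ∑ i ∈ Finset.range N, a i * (y - z) ^ i + a N * (y - z) ^ N with hq
  have hqc : Continuous q := by fun_prop
  have hcell : ∀ t ∈ Icc z z', l ≤ 2 ^ j * t ∧ 2 ^ j * t ≤ l + 1 := by
    intro t ht
    rw [hz, hz', mem_Icc, div_le_iff₀ h2j, le_div_iff₀ h2j] at ht
    constructor <;> linarith [ht.1, ht.2]
  have hunit : ∀ t ∈ Icc z z', t ∈ Icc (0 : ℝ) 1 := by
    intro t ht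
    refine ⟨hz1.1.trans ht.1, ht.2.trans ?_⟩
    rw [hz', div_le_one h2j]
    linarith
  have hr : ∀ t ∈ Icc z z', approxInt N M₁ φ d 0 j (sample j q) t - q t =
      a N / (2 ^ j) ^ N * periodicMoment M₁ φ N (2 ^ j * t) := by
    intro t ht
    have h := hcell t ht
    rw [hq, approxInt_sample_add, hφ.approxInt_sample_poly hd hS₀ hS₁ hj a z (hunit t ht),
      hφ.approxInt_sample_pow_order hN hN0 z (by linarith) (by linarith)]
    ring
  -- The cell is one full period of P_N(2^j t), whose mean is zero.
  have hint0 : ∫ t in z..z', (approxInt N M₁ φ d 0 j (sample j q) t - q t) = 0 := by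
    rw [intervalIntegral.integral_congr (g := fun t => a N / (2 ^ j) ^ N *
      periodicMoment M₁ φ N (2 ^ j * t)) fun t ht => hr t (by rwa [uIcc_of_le hzz] at ht),
      intervalIntegral.integral_const_mul, intervalIntegral.integral_comp_mul_left _ h2j.ne']
    have e1 : (2 : ℝ) ^ j * z = 0 + l := by rw [hz]; field_simp; ring
    have e2 : (2 : ℝ) ^ j * z' = 1 + l := by rw [hz']; field_simp; ring
    rw [e1, e2, ← intervalIntegral.integral_comp_add_right]
    have e3 : ∀ y : ℝ, periodicMoment M₁ φ N (y + l) = periodicMoment M₁ φ N y := fun y => by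
      exact_mod_cast periodicMoment_add_int (M₁ := M₁) (φ := φ) N y l
    simp_rw [e3]
    rw [hφ.integral_periodicMoment_order hN hN0]
    simp
  have hclose : ∀ y ∈ Icc (0 : ℝ) 1, |y - z| ≤ δ → |g 0 y - q y| ≤ L * √δ * δ ^ N := by
    intro y hy hyz
    have h1 := abs_sub_taylor_le hz1 hδ0 hg (ρ := L * √δ) (fun y hy hyz =>
      (hL y hy z hz1).trans (mul_le_mul_of_nonneg_left (Real.sqrt_le_sqrt hyz) hL0)) y hy hyz
    rwa [Finset.sum_range_succ] at h1
  have hAc := hφ.continuous_approxInt_zero (d := d) j (sample j (g 0))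
  have hAq := hφ.continuous_approxInt_zero (d := d) j (sample j q)
  have hdiff : ∀ t ∈ Icc z z', |(approxInt N M₁ φ d 0 j (sample j (g 0)) t - g 0 t) -
      (approxInt N M₁ φ d 0 j (sample j q) t - q t)| ≤ (C + 1) * L * √δ * δ ^ N := by
    intro t ht
    have h := hcell t ht
    have htz : |t - z| ≤ 1 / 2 ^ j := by
      rw [abs_of_nonneg (by linarith [ht.1]), hz, sub_le_iff_le_add, ← add_div, le_div_iff₀ h2j]
      linarith
    have hδe : δ = 3 * N / 2 ^ j + 1 / 2 ^ j := by rw [hδ, add_div]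
    have h1 := hφ.abs_approxInt_sample_sub_le hC (hunit t ht) (g := g 0) (q := q)
      (ε := L * √δ * δ ^ N) fun y hy hyt => hclose y hy (by
        have : y - z = (y - t) + (t - z) := by ring
        rw [this, hδe]
        exact (abs_add_le _ _).trans (add_le_add hyt htz))
    have h2 := hclose t (hunit t ht) (htz.trans (by
      rw [hδe]
      have : 0 ≤ 3 * (N : ℝ) / 2 ^ j := by positivity
      linarith))
    rw [show ∀ A B C D : ℝ, (A - B) - (C - D) = (A - C) - (B - D) from fun A B C D => by ring]
    refine (abs_sub _ _).trans ?_
    linarith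
  have hfin : ∫ t in z..z', (approxInt N M₁ φ d 0 j (sample j (g 0)) t - g 0 t) =
      ∫ t in z..z', ((approxInt N M₁ φ d 0 j (sample j (g 0)) t - g 0 t) -
        (approxInt N M₁ φ d 0 j (sample j q) t - q t)) := by
    have i1 : IntervalIntegrable (fun t => approxInt N M₁ φ d 0 j (sample j (g 0)) t - g 0 t)
      volume z z' := (hAc.sub hgc).intervalIntegrable _ _
    have i2 : IntervalIntegrable (fun t => approxInt N M₁ φ d 0 j (sample j q) t - q t)
      volume z z' := (hAq.sub hqc).intervalIntegrable _ _
    rw [intervalIntegral.integral_sub i1 i2, hint0, sub_zero]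
  rw [hfin, ← Real.norm_eq_abs]
  refine (intervalIntegral.norm_integral_le_of_norm_le_const
    (C := (C + 1) * L * √δ * δ ^ N) fun t ht => ?_).trans ?_
  · rw [uIoc_of_le hzz] at ht
    exact hdiff t (Ioc_subset_Icc_self ht)
  · rw [abs_of_nonneg (by linarith), hz, hz', ← sub_div, add_sub_cancel_left]
    exact le_of_eq (by ring)

end Consistency

/-! ### Norms -/

section Norms

lemma vecNorm_eq {ι : Type*} [Fintype ι] (v : ι → ℝ) : vecNorm v = √(∑ k, v k ^ 2) := by
  rw [vecNorm, EuclideanSpace.norm_eq]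
  simp

lemma vecNorm_nonneg {ι : Type*} [Fintype ι] (v : ι → ℝ) : 0 ≤ vecNorm v := norm_nonneg _

lemma vecNorm_sub_le {ι : Type*} [Fintype ι] (v w : ι → ℝ) :
    vecNorm (v - w) ≤ vecNorm v + vecNorm w := norm_sub_le _ _

lemma vecNorm_smul {ι : Type*} [Fintype ι] (c : ℝ) (v : ι → ℝ) :
    vecNorm (c • v) = |c| * vecNorm v := norm_smul c (WithLp.toLp 2 v)

lemma vecNorm_mulVec_le {ι : Type*} [Fintype ι] [DecidableEq ι] (A : Matrix ι ι ℝ) (v : ι → ℝ) :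
    vecNorm (A *ᵥ v) ≤ matNorm A * vecNorm v :=
  (Matrix.toEuclideanCLM (n := ι) (𝕜 := ℝ) A).le_opNorm (WithLp.toLp 2 v)

lemma matNorm_nonneg {ι : Type*} [Fintype ι] [DecidableEq ι] (A : Matrix ι ι ℝ) :
    0 ≤ matNorm A := norm_nonneg _

lemma vecNorm_le_of_abs_le {n : ℕ} {v : Fin (n + 1) → ℝ} {c : ℝ} (hc : 0 ≤ c)
    (h : ∀ l, |v l| ≤ c) : vecNorm v ≤ √(n + 1) * c := by
  rw [vecNorm_eq, ← Real.sqrt_sq hc, ← Real.sqrt_mul (by positivity)]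
  refine Real.sqrt_le_sqrt ((Finset.sum_le_card_nsmul _ _ (c ^ 2) fun k _ => ?_).trans ?_)
  · rw [← sq_abs]
    exact pow_le_pow_left₀ (abs_nonneg _) (h k) 2
  · simp

/-- A bound from below makes a matrix invertible and bounds the norm of its inverse. -/
lemma isUnit_and_matNorm_inv_le {ι : Type*} [Fintype ι] [DecidableEq ι] {A : Matrix ι ι ℝ} {B : ℝ}
    (hB : 0 ≤ B) (h : ∀ v, vecNorm v ≤ B * vecNorm (A *ᵥ v)) :
    IsUnit A ∧ matNorm A⁻¹ ≤ B := by
  have hA : IsUnit A := by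
    rw [← Matrix.mulVec_injective_iff_isUnit]
    intro v w hvw
    have h1 := h (v - w)
    rw [Matrix.mulVec_sub, sub_eq_zero.2 hvw, vecNorm, vecNorm, WithLp.toLp_zero, norm_zero,
      mul_zero] at h1
    have h2 := norm_le_zero_iff.1 h1
    have h3 : v - w = 0 := congrArg WithLp.ofLp h2
    exact sub_eq_zero.1 h3
  refine ⟨hA, ContinuousLinearMap.opNorm_le_bound _ hB fun x => ?_⟩
  have h1 := h (A⁻¹ *ᵥ x.ofLp)
  rw [Matrix.mulVec_mulVec, Matrix.mul_nonsing_inv _ ((Matrix.isUnit_iff_isUnit_det A).1 hA),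
    Matrix.one_mulVec] at h1
  exact h1

end Norms

/-! ### Consistency of the scheme -/

section Scheme

variable {N M₁ : ℕ} {p : ℕ → ℝ} {φ : ℝ → ℝ} {d : ℕ → ℤ → ℝ} {α : Fin 5 → ℝ}

/-- The residual of the exact nodal values in terms of the approximation error. -/
lemma IsCoiflet.residual_eq (hφ : IsCoiflet N M₁ p φ) {f : ℝ → ℝ} {a₀ a₁ b₀ b₁ : ℝ} {u : ℝ → ℝ}
    (hu : IsSolution α f a₀ a₁ b₀ b₁ u) {g : ℝ → ℝ} (hgc : Continuous g)
    (hg : ∀ x ∈ Icc (0 : ℝ) 1, iteratedDerivWithin 4 u (Icc 0 1) x = g x) (j : ℕ)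
    (l : Fin (2 ^ j + 1)) :
    (colMatrix N M₁ φ d α j *ᵥ exactNodal u j - colRhs α f a₀ a₁ b₀ b₁ j) l =
      lowerOp α (multInt 1 fun x => approxInt N M₁ φ d 0 j (sample j g) x - g x) (node j l) := by
  have h1 : exactNodal u j = sample j g := funext fun l => hg _ (node_mem j l)
  have h2 := hu.integral_equation hg (node_mem j l)
  have hA := hφ.continuous_approxInt_zero (d := d) j (sample j g)
  rw [h1, Pi.sub_apply, hφ.colMatrix_mulVec, multInt_sub hA hgc,
    lowerOp_sub (continuous_multInt hA 1) (continuous_multInt hgc 1), colRhs, ← h2, sample]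
  ring

/-- A continuously differentiable family representing the derivatives of `u''''`. -/
lemma exists_derivative_family {n : ℕ} {u : ℝ → ℝ} (hu : ContDiffOn ℝ (n + 4 : ℕ) u (Icc 0 1)) :
    ∃ g : ℕ → ℝ → ℝ, (∀ i ≤ n, Continuous (g i)) ∧
      (∀ i, ∀ x ∈ Icc (0 : ℝ) 1, iteratedDerivWithin (i + 4) u (Icc 0 1) x = g i x) ∧
      ∀ i < n, ∀ x ∈ Icc (0 : ℝ) 1, HasDerivWithinAt (g i) (g (i + 1) x) (Icc 0 1) x := by
  -- Constant extension beyond [0,1] gives continuity on the whole line, as the lemmas on iterated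
  -- integrals require.
  set g : ℕ → ℝ → ℝ := fun i =>
    IccExtend zero_le_one ((Icc (0 : ℝ) 1).domRestrict (iteratedDerivWithin (i + 4) u (Icc 0 1)))
    with hg
  have hgx : ∀ i, ∀ x ∈ Icc (0 : ℝ) 1, iteratedDerivWithin (i + 4) u (Icc 0 1) x = g i x := by
    intro i x hx
    rw [hg]
    simp only
    rw [IccExtend_of_mem _ _ hx]
    rfl
  refine ⟨g, fun i hi => ?_, hgx, fun i hi x hx => ?_⟩
  · exact Continuous.Icc_extend' (continuousOn_iff_continuous_domRestrict.1
      (continuousOn_iteratedDerivWithin_unit hu (by omega)))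
  · rw [← hgx (i + 1) x hx, show i + 1 + 4 = i + 4 + 1 by omega]
    exact (hasDerivWithinAt_iteratedDerivWithin hu (by omega) hx).congr
      (fun y hy => (hgx i y hy).symm) (hgx i x hx).symm

lemma IsCoiflet.consistency (hφ : IsCoiflet N M₁ p φ) (hN0 : 0 < N) (hd : IsIntegerDerivs N p φ d)
    (hS₀ : IsUnit (1 - S₀ N M₁ d)) (hS₁ : IsUnit (1 - S₁ N M₁ d)) {f : ℝ → ℝ} {a₀ a₁ b₀ b₁ : ℝ}
    {u : ℝ → ℝ} (hu : IsSolution α f a₀ a₁ b₀ b₁ u)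
    (hcd : ContDiffOn ℝ (N + 4 : ℕ) u (Icc 0 1)) :
    ∃ C, 0 ≤ C ∧ ∀ j : ℕ, 3 * N - 2 ≤ 2 ^ j → ∀ l,
      |(colMatrix N M₁ φ d α j *ᵥ exactNodal u j - colRhs α f a₀ a₁ b₀ b₁ j) l| ≤
        C * ((2 : ℝ) ^ (j * N))⁻¹ := by
  obtain ⟨C, hC0, hC⟩ := hφ.exists_sum_abs_ΦInt_le hN0 d
  obtain ⟨g, hgc, hgu, hg⟩ := exists_derivative_family hcd
  obtain ⟨S, hS⟩ := isCompact_Icc.exists_bound_of_continuousOn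
    (hgc N le_rfl).continuousOn (s := Icc (0 : ℝ) 1)
  have hS0 : 0 ≤ S := (norm_nonneg _).trans (hS 0 (by simp))
  refine ⟨4 * (|α 0| + |α 1| + |α 2| + |α 3|) * (3 * S * (3 * N) ^ N * C), by positivity, ?_⟩
  intro j hj l
  rw [hφ.residual_eq hu (hgc 0 (Nat.zero_le _)) (hgu 0), mul_assoc]
  exact abs_lowerOp_le (abs_multInt_le (fun x hx =>
    hφ.abs_approxInt_sub_le hd hS₀ hS₁ hj (hC j hj) hg hS hx) 1) (node_mem j l)

/-- `lowerOp` acts on the primitive of the error, for which interior cells gain √(2^{-j}) from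
cancellation. The boundary cells are bounded in number and short, so they gain even 2^{-j}. -/
lemma IsCoiflet.superconsistency (hφ : IsCoiflet N M₁ p φ) (hN : Even N) (hN0 : 0 < N)
    (hd : IsIntegerDerivs N p φ d)
    (hS₀ : IsUnit (1 - S₀ N M₁ d)) (hS₁ : IsUnit (1 - S₁ N M₁ d)) {f : ℝ → ℝ} {a₀ a₁ b₀ b₁ : ℝ}
    {u : ℝ → ℝ} (hu : IsSolution α f a₀ a₁ b₀ b₁ u)
    (hcd : ContDiffOn ℝ (N + 4 : ℕ) u (Icc 0 1)) {L : ℝ} (hL0 : 0 ≤ L)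
    (hL : ∀ x ∈ Icc (0 : ℝ) 1, ∀ y ∈ Icc (0 : ℝ) 1,
      |iteratedDerivWithin (N + 4) u (Icc 0 1) x - iteratedDerivWithin (N + 4) u (Icc 0 1) y| ≤
        L * √|x - y|) :
    ∃ C, 0 ≤ C ∧ ∀ j : ℕ, 3 * N - 2 ≤ 2 ^ j → ∀ l,
      |(colMatrix N M₁ φ d α j *ᵥ exactNodal u j - colRhs α f a₀ a₁ b₀ b₁ j) l| ≤
        C * ((2 : ℝ) ^ (j * N))⁻¹ * √((2 ^ j)⁻¹) := by
  obtain ⟨C, hC0, hC⟩ := hφ.exists_sum_abs_ΦInt_le hN0 d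
  obtain ⟨g, hgc, hgu, hg⟩ := exists_derivative_family hcd
  obtain ⟨S, hS⟩ := isCompact_Icc.exists_bound_of_continuousOn
    (hgc N le_rfl).continuousOn (s := Icc (0 : ℝ) 1)
  have hS0 : 0 ≤ S := (norm_nonneg _).trans (hS 0 (by simp))
  set D₀ : ℝ := 3 * S * (3 * N) ^ N * C with hD₀
  set D₁ : ℝ := (C + 1) * L * √(3 * N + 1) * (3 * N + 1) ^ N with hD₁
  have hD₀0 : 0 ≤ D₀ := by positivity
  have hD₁0 : 0 ≤ D₁ := by positivity
  refine ⟨4 * (|α 0| + |α 1| + |α 2| + |α 3|) * (D₁ + (2 * (3 * N : ℕ) + 1) * D₀),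
    by positivity, ?_⟩
  intro j hj l
  have h2j : (0 : ℝ) < 2 ^ j := by positivity
  rw [hφ.residual_eq hu (hgc 0 (Nat.zero_le _)) (hgu 0), mul_assoc, mul_assoc]
  refine abs_lowerOp_le (fun x hx => ?_) (node_mem j l)
  have hcont := (hφ.continuous_approxInt_zero (d := d) j (sample j (g 0))).sub
    (hgc 0 (Nat.zero_le _))
  have key := abs_integral_le_of_cells hcont (n := 2 ^ j) (b := 3 * N) (by positivity)
    (A := D₀ * ((2 : ℝ) ^ (j * N))⁻¹) (B := D₁ * (((2 : ℝ) ^ (j * N))⁻¹ * √((2 ^ j)⁻¹)))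
    (by positivity) (by positivity)
    (fun x hx => hφ.abs_approxInt_sub_le hd hS₀ hS₁ hj (hC j hj) hg hS hx)
    (fun l hl0 hl1 => (hφ.abs_integral_cell_le hN hN0 hd hS₀ hS₁ hj (hC j hj)
      (hgc 0 (Nat.zero_le _)) hg hL0 (fun x hx y hy => by
        rw [← hgu N x hx, ← hgu N y hy]
        exact hL x hx y hy) hl0 hl1).trans (le_of_eq ?_)) hx
  · have hh : ((2 : ℝ) ^ j)⁻¹ ≤ √((2 ^ j)⁻¹) := by
      refine Real.le_sqrt_of_sq_le ?_
      rw [sq]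
      have h1 : (1 : ℝ) ≤ 2 ^ j := one_le_pow₀ (by norm_num)
      exact mul_le_of_le_one_left (by positivity) (inv_le_one_of_one_le₀ h1)
    refine key.trans ?_
    rw [add_mul D₁]
    refine add_le_add_right ?_ _
    push_cast
    rw [mul_assoc (2 * (3 * (N : ℝ)) + 1), div_eq_mul_inv, mul_assoc D₀]
    gcongr
  · rw [hD₁, div_pow, ← pow_mul, Real.sqrt_div (by positivity), Real.sqrt_inv]
    ring

lemma sub_eq_inv_mulVec {f : ℝ → ℝ} {a₀ a₁ b₀ b₁ : ℝ} {j : ℕ}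
    (hA : IsUnit (colMatrix N M₁ φ d α j)) {U V : Fin (2 ^ j + 1) → ℝ}
    (hV : IsWICMSolution N M₁ φ d α f a₀ a₁ b₀ b₁ j V) :
    U - V = (colMatrix N M₁ φ d α j)⁻¹ *ᵥ
      (colMatrix N M₁ φ d α j *ᵥ U - colRhs α f a₀ a₁ b₀ b₁ j) := by
  rw [← (isWICMSolution_iff _ _ _ _ _ _ _ _ _ _ _ _).1 hV, ← Matrix.mulVec_sub,
    Matrix.mulVec_mulVec, Matrix.nonsing_inv_mul _ ((Matrix.isUnit_iff_isUnit_det _).1 hA),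
    Matrix.one_mulVec]

end Scheme

/-! ### Stability -/

section Stability

variable {N M₁ : ℕ} {p : ℕ → ℝ} {φ : ℝ → ℝ} {d : ℕ → ℤ → ℝ} {α : Fin 5 → ℝ}

/-- Cauchy–Schwarz applied to v and the integrals β_k. Each β_k is O(2^{-j}) by locality and their
sum is at most C(b-a) by the Lebesgue bound, so ∑ β_k² is at most the product. The result is a
Hölder-1/2 modulus in terms of the mesh-weighted norm of v. -/
lemma IsCoiflet.abs_integral_approxInt_le (hφ : IsCoiflet N M₁ p φ) {C : ℝ} (hC0 : 0 ≤ C) {j : ℕ}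
    (hC : ∀ x, ∑ k ∈ Finset.range (2 ^ j + 1), |ΦInt N M₁ φ d 0 j k x| ≤ C)
    (v : Fin (2 ^ j + 1) → ℝ) {a b : ℝ} (ha : 0 ≤ a) (hab : a ≤ b) (hb : b ≤ 1) :
    |∫ x in a..b, approxInt N M₁ φ d 0 j v x| ≤
      √(6 * N) * C * √(b - a) * (vecNorm v * √((2 ^ j)⁻¹)) := by
  have hc : ∀ k : Fin (2 ^ j + 1), Continuous (ΦInt N M₁ φ d 0 j k) := fun k =>
    hφ.continuous_ΦInt_zero j k
  set β : Fin (2 ^ j + 1) → ℝ := fun k => ∫ x in a..b, |ΦInt N M₁ φ d 0 j k x| with hβ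
  have hβ0 : ∀ k, 0 ≤ β k := fun k =>
    intervalIntegral.integral_nonneg hab fun x _ => abs_nonneg _
  have hβ1 : ∀ k, β k ≤ 6 * N * C * ((2 : ℝ) ^ j)⁻¹ := fun k =>
    hφ.integral_abs_ΦInt_le hC0 hC (Nat.lt_succ_iff.1 k.2) ha hab hb
  have hβ2 : ∑ k, β k ≤ C * (b - a) := by
    have i1 : ∀ k ∈ (Finset.univ : Finset (Fin (2 ^ j + 1))),
        IntervalIntegrable (fun x => |ΦInt N M₁ φ d 0 j k x|) volume a b := fun k _ =>
      (hc k).abs.intervalIntegrable _ _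
    rw [← intervalIntegral.integral_finsetSum i1]
    have h1 := intervalIntegral.norm_integral_le_of_norm_le_const (a := a) (b := b) (C := C)
      (f := fun x => ∑ k : Fin (2 ^ j + 1), |ΦInt N M₁ φ d 0 j k x|) fun x _ => by
        rw [Real.norm_of_nonneg (Finset.sum_nonneg fun _ _ => abs_nonneg _),
          Fin.sum_univ_eq_sum_range (fun k : ℕ => |ΦInt N M₁ φ d 0 j k x|) (2 ^ j + 1)]
        exact hC x
    rw [abs_of_nonneg (by linarith)] at h1
    exact (le_abs_self _).trans h1
  have h1 : |∫ x in a..b, approxInt N M₁ φ d 0 j v x| ≤ ∑ k, |v k| * β k := by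
    have i1 : ∀ k ∈ (Finset.univ : Finset (Fin (2 ^ j + 1))),
        IntervalIntegrable (fun x => v k * ΦInt N M₁ φ d 0 j k x) volume a b := fun k _ =>
      ((hc k).const_mul _).intervalIntegrable _ _
    simp only [approxInt]
    rw [intervalIntegral.integral_finsetSum i1]
    refine (Finset.abs_sum_le_sum_abs _ _).trans (Finset.sum_le_sum fun k _ => ?_)
    rw [intervalIntegral.integral_const_mul, abs_mul]
    exact mul_le_mul_of_nonneg_left (intervalIntegral.abs_integral_le_integral_abs hab)
      (abs_nonneg _)
  refine h1.trans ((Real.sum_mul_le_sqrt_mul_sqrt _ _ _).trans ?_)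
  have h2 : ∑ k, β k ^ 2 ≤ 6 * N * C ^ 2 * (b - a) * ((2 : ℝ) ^ j)⁻¹ := by
    calc ∑ k, β k ^ 2 ≤ ∑ k, (6 * N * C * ((2 : ℝ) ^ j)⁻¹) * β k :=
          Finset.sum_le_sum fun k _ => by
            rw [sq]
            exact mul_le_mul_of_nonneg_right (hβ1 k) (hβ0 k)
      _ = (6 * N * C * ((2 : ℝ) ^ j)⁻¹) * ∑ k, β k := by rw [Finset.mul_sum]
      _ ≤ (6 * N * C * ((2 : ℝ) ^ j)⁻¹) * (C * (b - a)) :=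
          mul_le_mul_of_nonneg_left hβ2 (by positivity)
      _ = 6 * N * C ^ 2 * (b - a) * ((2 : ℝ) ^ j)⁻¹ := by ring
  have h3 : √(6 * N * C ^ 2 * (b - a) * ((2 : ℝ) ^ j)⁻¹) =
      √(6 * N) * C * √(b - a) * √((2 ^ j)⁻¹) := by
    rw [Real.sqrt_mul' _ (by positivity), Real.sqrt_mul' _ (by linarith),
      Real.sqrt_mul' _ (by positivity), Real.sqrt_sq hC0]
  simp_rw [sq_abs]
  rw [← vecNorm_eq]
  calc vecNorm v * √(∑ k, β k ^ 2)
      ≤ vecNorm v * (√(6 * N) * C * √(b - a) * √((2 ^ j)⁻¹)) := by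
        rw [← h3]
        exact mul_le_mul_of_nonneg_left (Real.sqrt_le_sqrt h2) (vecNorm_nonneg _)
    _ = _ := by ring

/-- The approximation by nodal values converges uniformly for continuous functions. -/
lemma IsCoiflet.exists_abs_approxInt_sub_le (hφ : IsCoiflet N M₁ p φ) (hN0 : 0 < N)
    (hd : IsIntegerDerivs N p φ d)
    (hS₀ : IsUnit (1 - S₀ N M₁ d)) (hS₁ : IsUnit (1 - S₁ N M₁ d)) {C : ℝ} (hC0 : 0 ≤ C)
    (hC : ∀ j, 3 * N - 2 ≤ 2 ^ j → ∀ x,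
      ∑ k ∈ Finset.range (2 ^ j + 1), |ΦInt N M₁ φ d 0 j k x| ≤ C)
    {g : ℝ → ℝ} (hg : Continuous g) {ε : ℝ} (hε : 0 < ε) :
    ∃ J : ℕ, ∀ j ≥ J, 3 * N - 2 ≤ 2 ^ j → ∀ x ∈ Icc (0 : ℝ) 1,
      |approxInt N M₁ φ d 0 j (sample j g) x - g x| ≤ ε := by
  have huc := isCompact_Icc.uniformContinuousOn_of_continuous (s := Icc (0 : ℝ) 1) hg.continuousOn
  rw [Metric.uniformContinuousOn_iff] at huc
  obtain ⟨δ, hδ, hgδ⟩ := huc (ε / (C + 1)) (by positivity)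
  have hlim : Filter.Tendsto (fun j : ℕ => 3 * (N : ℝ) / 2 ^ j) Filter.atTop (nhds 0) :=
    tendsto_const_nhds.div_atTop (tendsto_pow_atTop_atTop_of_one_lt (by norm_num))
  obtain ⟨J, hJ⟩ := Filter.eventually_atTop.1 (hlim.eventually (gt_mem_nhds hδ))
  refine ⟨J, fun j hj hj' x hx => ?_⟩
  -- The comparison function is the constant g(x), written as a polynomial of degree below `N` so
  -- that it is reproduced.
  have h1 := hφ.abs_approxInt_sample_sub_le (hC j hj') hx (g := g)
    (q := fun y => ∑ i ∈ Finset.range N, (if i = 0 then g x else 0) * (y - 0) ^ i)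
    (ε := ε / (C + 1)) fun y hy hyx => by
      have h2 := hgδ y hy x hx (hyx.trans_lt (hJ j hj))
      rw [Real.dist_eq] at h2
      simp only [ite_mul, zero_mul, Finset.sum_ite_eq', Finset.mem_range, hN0, if_true, pow_zero,
        mul_one]
      exact h2.le
  rw [hφ.approxInt_sample_poly hd hS₀ hS₁ hj' (fun i => if i = 0 then g x else 0) 0 hx] at h1
  simp only [ite_mul, zero_mul, Finset.sum_ite_eq', Finset.mem_range, hN0, if_true, pow_zero,
    mul_one] at h1
  refine h1.trans ?_
  rw [div_mul_eq_mul_div, div_le_iff₀ (by positivity)]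
  exact mul_le_mul_of_nonneg_left (by linarith) hε.le

/-- Compactness of a family with a common Hölder modulus. -/
lemma exists_uniform_limit {F : ℕ → ℝ → ℝ} {K : ℝ} (hF : ∀ n, Continuous (F n))
    (hF0 : ∀ n, F n 0 = 0)
    (hFK : ∀ n, ∀ x ∈ Icc (0 : ℝ) 1, ∀ y ∈ Icc (0 : ℝ) 1, |F n x - F n y| ≤ K * √|x - y|) :
    ∃ G : ℝ → ℝ, Continuous G ∧ ∃ s : ℕ → ℕ, StrictMono s ∧
      ∀ ε > 0, ∀ᶠ n in Filter.atTop, ∀ x ∈ Icc (0 : ℝ) 1, |F (s n) x - G x| ≤ ε := by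
  set f : ℕ → BoundedContinuousFunction (Icc (0 : ℝ) 1) ℝ := fun n =>
    BoundedContinuousFunction.mkOfCompact ⟨fun x => F n x, (hF n).comp continuous_subtype_val⟩
    with hf
  have hK : 0 ≤ K := by
    have := (abs_nonneg _).trans (hFK 0 1 (by simp) 0 (by simp))
    simpa using this
  have hcomp : IsCompact (closure (range f)) := by
    refine BoundedContinuousFunction.arzela_ascoli (Icc (-K) K) isCompact_Icc _ ?_ ?_
    · rintro _ x ⟨n, rfl⟩
      have h := hFK n x x.2 0 (by simp)
      rw [hF0, sub_zero, sub_zero, abs_of_nonneg x.2.1] at h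
      refine abs_le.1 (h.trans (mul_le_of_le_one_right hK ?_))
      exact Real.sqrt_le_one.2 x.2.2
    · refine Metric.equicontinuous_of_continuity_modulus (fun t => K * √t) ?_ _ ?_
      · have : Continuous fun t => K * √t := by fun_prop
        simpa using this.tendsto 0
      · rintro x y ⟨_, n, rfl⟩
        exact hFK n x x.2 y y.2
  obtain ⟨G, _, s, hs, hlim⟩ := hcomp.tendsto_subseq (x := f)
    fun n => subset_closure (mem_range_self n)
  refine ⟨IccExtend zero_le_one G, G.continuous.Icc_extend', s, hs, fun ε hε => ?_⟩
  filter_upwards [(Metric.tendsto_nhds.1 hlim) ε hε] with n hn x hx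
  rw [IccExtend_of_mem _ _ hx, ← Real.dist_eq]
  exact (BoundedContinuousFunction.dist_coe_le_dist (f := f (s n)) (g := G) ⟨x, hx⟩).trans hn.le

lemma approxInt_sub (j : ℕ) (v w : Fin (2 ^ j + 1) → ℝ) (x : ℝ) :
    approxInt N M₁ φ d 0 j (v - w) x =
      approxInt N M₁ φ d 0 j v x - approxInt N M₁ φ d 0 j w x := by
  simp only [approxInt, Pi.sub_apply, sub_mul, Finset.sum_sub_distrib]

/-- The mesh-weighted distance of `v` to the samples of `-(lowerOp G) / α₄`. -/
lemma IsCoiflet.vecNorm_sub_sample_le (hφ : IsCoiflet N M₁ p φ) (hα : α 4 ≠ 0) {j : ℕ}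
    (v : Fin (2 ^ j + 1) → ℝ) {G : ℝ → ℝ} (hG : Continuous G) {ε : ℝ} (hε : 0 ≤ ε)
    (h : ∀ x ∈ Icc (0 : ℝ) 1, |multInt 1 (approxInt N M₁ φ d 0 j v) x - G x| ≤ ε) :
    vecNorm (v - sample j fun x => -(lowerOp α G x) / α 4) * √((2 ^ j)⁻¹) ≤
      |α 4|⁻¹ * (vecNorm (colMatrix N M₁ φ d α j *ᵥ v) * √((2 ^ j)⁻¹)
        + 2 * (4 * (|α 0| + |α 1| + |α 2| + |α 3|) * ε)) := by
  set F := multInt 1 (approxInt N M₁ φ d 0 j v) with hF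
  have hFc : Continuous F := continuous_multInt (hφ.continuous_approxInt_zero j v) 1
  set r : Fin (2 ^ j + 1) → ℝ := fun l => lowerOp α F (node j l) - lowerOp α G (node j l) with hr
  -- Each row of A v is solved for v l, and T(F) is compared with T(G).
  have h1 : v - (sample j fun x => -(lowerOp α G x) / α 4) =
      (α 4)⁻¹ • (colMatrix N M₁ φ d α j *ᵥ v - r) := by
    funext l
    rw [Pi.smul_apply, Pi.sub_apply, Pi.sub_apply, hφ.colMatrix_mulVec]
    simp only [sample, hr, ← hF, smul_eq_mul]
    field_simp
    ring
  have h2 : ∀ l, |r l| ≤ 4 * (|α 0| + |α 1| + |α 2| + |α 3|) * ε := by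
    intro l
    simp only [hr]
    rw [← lowerOp_sub hFc hG]
    exact abs_lowerOp_le h (node_mem j l)
  have h3 := vecNorm_le_of_abs_le (by positivity) h2
  rw [h1, vecNorm_smul, abs_inv, mul_assoc]
  refine mul_le_mul_of_nonneg_left ?_ (by positivity)
  refine (mul_le_mul_of_nonneg_right (vecNorm_sub_le _ _) (by positivity)).trans ?_
  rw [add_mul]
  refine add_le_add le_rfl ?_
  refine (mul_le_mul_of_nonneg_right h3 (by positivity)).trans ?_
  rw [mul_right_comm, ← Real.sqrt_mul (by positivity)]
  refine mul_le_mul_of_nonneg_right ?_ (by positivity)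
  rw [Real.sqrt_le_left (by norm_num)]
  push_cast
  have : (1 : ℝ) ≤ 2 ^ j := one_le_pow₀ (by norm_num)
  rw [← div_eq_mul_inv, div_le_iff₀ (by positivity)]
  linarith

/-- Unique solvability of the boundary value problem implies stability of the scheme. -/
lemma IsCoiflet.stability (hφ : IsCoiflet N M₁ p φ) (hN0 : 0 < N) (hd : IsIntegerDerivs N p φ d)
    (hS₀ : IsUnit (1 - S₀ N M₁ d)) (hS₁ : IsUnit (1 - S₁ N M₁ d)) (hα : α 4 ≠ 0)
    (huniq : ∀ w : ℝ → ℝ, IsSolution α (fun _ => 0) 0 0 0 0 w →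
      ∀ x ∈ Icc (0 : ℝ) 1, w x = 0) :
    ∃ (B : ℝ) (j₀ : ℕ), ∀ j ≥ j₀, IsUnit (colMatrix N M₁ φ d α j) ∧
      matNorm (colMatrix N M₁ φ d α j)⁻¹ ≤ B := by
  obtain ⟨C, hC0, hC⟩ := hφ.exists_sum_abs_ΦInt_le hN0 d
  by_contra hcon
  push Not at hcon
  have hseq : ∀ n : ℕ, ∃ j ≥ n, 3 * N - 2 ≤ 2 ^ j ∧ ∃ v : Fin (2 ^ j + 1) → ℝ,
      vecNorm v * √((2 ^ j)⁻¹) = 1 ∧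
      vecNorm (colMatrix N M₁ φ d α j *ᵥ v) * √((2 ^ j)⁻¹) ≤ 1 / (n + 1) := by
    intro n
    obtain ⟨j, hj, hjA⟩ := hcon (n + 1) (max n (3 * N))
    refine ⟨j, (le_max_left _ _).trans hj, ?_, ?_⟩
    · have h1 : 3 * N ≤ j := (le_max_right _ _).trans hj
      have h2 : j < 2 ^ j := Nat.lt_two_pow_self
      omega
    -- A lower bound ‖v‖ ≤ (n+1)‖Av‖ would give both invertibility and the norm bound, so the
    -- failure of either yields such a vector.
    have hv : ∃ v, (n + 1) * vecNorm (colMatrix N M₁ φ d α j *ᵥ v) < vecNorm v := by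
      by_contra hv
      push Not at hv
      have h1 := isUnit_and_matNorm_inv_le (by positivity) hv
      exact absurd h1.2 (not_le.2 (hjA h1.1))
    obtain ⟨v, hv⟩ := hv
    have hv0 : 0 < vecNorm v := lt_of_le_of_lt
      (mul_nonneg (by positivity) (vecNorm_nonneg _)) hv
    have hs0 : 0 < √(((2 : ℝ) ^ j)⁻¹) := Real.sqrt_pos.2 (by positivity)
    set c : ℝ := (vecNorm v * √((2 ^ j)⁻¹))⁻¹ with hc
    have hc0 : 0 < c := by positivity
    refine ⟨c • v, ?_, ?_⟩
    · rw [vecNorm_smul, abs_of_pos hc0, hc]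
      field_simp
    · rw [Matrix.mulVec_smul, vecNorm_smul, abs_of_pos hc0, hc, le_div_iff₀ (by positivity)]
      have : (vecNorm v * √((2 ^ j)⁻¹))⁻¹ * vecNorm (colMatrix N M₁ φ d α j *ᵥ v) *
          √((2 ^ j)⁻¹) * (n + 1) =
          ((n + 1) * vecNorm (colMatrix N M₁ φ d α j *ᵥ v)) / vecNorm v := by
        field_simp
      rw [this, div_le_one hv0]
      exact hv.le
  choose j hjn hj2 v hv1 hvA using hseq
  set K : ℝ := √(6 * N) * C with hK
  have hK0 : 0 ≤ K := by positivity
  set F : ℕ → ℝ → ℝ := fun n => multInt 1 (approxInt N M₁ φ d 0 (j n) (v n)) with hF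
  have hac : ∀ n, Continuous (approxInt N M₁ φ d 0 (j n) (v n)) := fun n =>
    hφ.continuous_approxInt_zero _ _
  have hFK' : ∀ n x y, 0 ≤ y → y ≤ x → x ≤ 1 → |F n x - F n y| ≤ K * √|x - y| := by
    intro n x y hy hyx hx
    have h1 : F n x - F n y = ∫ t in y..x, approxInt N M₁ φ d 0 (j n) (v n) t :=
      intervalIntegral.integral_interval_sub_left ((hac n).intervalIntegrable _ _)
        ((hac n).intervalIntegrable _ _)
    have h2 := hφ.abs_integral_approxInt_le hC0 (hC _ (hj2 n)) (v n) hy hyx hx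
    rw [hv1, mul_one] at h2
    rw [h1, abs_of_nonneg (sub_nonneg.2 hyx)]
    exact h2
  obtain ⟨G, hGc, s, hs, hlim⟩ := exists_uniform_limit (F := F) (K := K)
    (fun n => continuous_multInt (hac n) 1) (fun n => by simp [hF, multInt])
    (fun n x hx y hy => by
      rcases le_total y x with h | h
      · exact hFK' n x y hy.1 h hx.2
      · rw [abs_sub_comm, abs_sub_comm x]
        exact hFK' n y x hx.1 h hy.2)
  set g : ℝ → ℝ := fun x => -(lowerOp α G x) / α 4 with hg
  have hgc : Continuous g := (continuous_lowerOp hGc).neg.div_const _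
  have hdist : ∀ ε > 0, ∀ᶠ n in Filter.atTop,
      vecNorm (v (s n) - sample (j (s n)) g) * √((2 ^ j (s n))⁻¹) ≤ ε := by
    intro ε hε
    set D : ℝ := 4 * (|α 0| + |α 1| + |α 2| + |α 3|) with hD
    have hD0 : 0 ≤ D := by positivity
    have hα0 : 0 < |α 4| := abs_pos.2 hα
    -- Chosen so that 2Dη ≤ |α₄|ε/2; the 1 added to D covers D = 0.
    set η : ℝ := |α 4| * ε / (4 * (D + 1)) with hη
    have hη0 : 0 < η := by positivity
    have hdec : Filter.Tendsto (fun n : ℕ => 1 / ((s n : ℝ) + 1)) Filter.atTop (nhds 0) :=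
      tendsto_one_div_add_atTop_nhds_zero_nat.comp hs.tendsto_atTop
    have hε2 : 0 < |α 4| * ε / 2 := by positivity
    filter_upwards [hlim η hη0, hdec.eventually (ge_mem_nhds hε2)] with n hn1 hn2
    refine (hφ.vecNorm_sub_sample_le hα (v (s n)) hGc hη0.le hn1).trans ?_
    rw [inv_mul_le_iff₀ hα0]
    have h1 := (hvA (s n)).trans hn2
    have h2 : 2 * (D * η) ≤ |α 4| * ε / 2 := by
      rw [hη, show 2 * (D * (|α 4| * ε / (4 * (D + 1)))) = |α 4| * ε / 2 * (D / (D + 1)) by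
        field_simp; ring]
      exact mul_le_of_le_one_right (by positivity)
        ((div_le_one (by positivity)).2 (by linarith))
    linarith
  -- G is compared with F, then with the primitive of the approximation Q of g, then with ∫g. The
  -- errors come from uniform convergence, closeness of v to the samples, and convergence of the
  -- approximation.
  have hGg : ∀ x ∈ Icc (0 : ℝ) 1, G x = multInt 1 g x := by
    intro x hx
    refine eq_of_forall_dist_le fun ε hε => ?_
    obtain ⟨J, hJ⟩ := hφ.exists_abs_approxInt_sub_le hN0 hd hS₀ hS₁ hC0 hC hgc
      (show 0 < ε / 3 by positivity)
    obtain ⟨n, hn1, hn2, hn3⟩ := ((hlim (ε / 3) (by positivity)).and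
      ((hdist (ε / 3 / (K + 1)) (by positivity)).and (Filter.eventually_ge_atTop J))).exists
    have hsn : J ≤ j (s n) := hn3.trans (hs.le_apply.trans (hjn _))
    set Q := approxInt N M₁ φ d 0 (j (s n)) (sample (j (s n)) g) with hQ
    have hQc : Continuous Q := hφ.continuous_approxInt_zero _ _
    have e1 := hn1 x hx
    have e2 : |F (s n) x - multInt 1 Q x| ≤ ε / 3 := by
      have h1 : F (s n) x - multInt 1 Q x = ∫ t in (0 : ℝ)..x,
          approxInt N M₁ φ d 0 (j (s n)) (v (s n) - sample (j (s n)) g) t := by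
        have h2 := congrFun (multInt_sub (hac (s n)) hQc 1) x
        rw [← h2]
        simp only [approxInt_sub, multInt, hQ]
      have h2 := hφ.abs_integral_approxInt_le hC0 (hC _ (hj2 (s n)))
        (v (s n) - sample (j (s n)) g) le_rfl hx.1 hx.2
      rw [h1]
      refine h2.trans ?_
      have h3 : √(x - 0) ≤ 1 := Real.sqrt_le_one.2 (by linarith [hx.2])
      have h4 := mul_nonneg (vecNorm_nonneg (v (s n) - sample (j (s n)) g))
        (Real.sqrt_nonneg ((2 ^ j (s n))⁻¹))
      calc K * √(x - 0) * _ ≤ K * 1 * (ε / 3 / (K + 1)) := by gcongr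
        _ = ε / 3 * (K / (K + 1)) := by ring
        _ ≤ ε / 3 := mul_le_of_le_one_right (by positivity)
          ((div_le_one (by positivity)).2 (by linarith))
    have e3 : |multInt 1 Q x - multInt 1 g x| ≤ ε / 3 := by
      have h2 := congrFun (multInt_sub hQc hgc 1) x
      rw [← h2]
      exact abs_multInt_le (hJ _ hsn (hj2 _)) 1 x hx
    rw [Real.dist_eq]
    rw [abs_le] at e1 e2 e3 ⊢
    constructor <;> linarith [e1.1, e1.2, e2.1, e2.2, e3.1, e3.2]
  have hg0 : ∀ x ∈ Icc (0 : ℝ) 1, g x = 0 := by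
    refine eq_zero_of_integral_equation huniq hgc fun x hx => ?_
    have h1 := abs_lowerOp_le (α := α) (F := fun x => multInt 1 g x - G x) (ε := 0)
      (fun y hy => by rw [hGg y hy]; simp) hx
    rw [mul_zero, abs_nonpos_iff, lowerOp_sub (continuous_multInt hgc 1) hGc, sub_eq_zero] at h1
    rw [h1, hg]
    field_simp
    ring
  obtain ⟨n, hn⟩ := (hdist (1 / 2) (by norm_num)).exists
  have h0 : sample (j (s n)) g = 0 := funext fun l => hg0 _ (node_mem _ l)
  rw [h0, sub_zero, hv1] at hn
  norm_num at hn

end Stability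

/-! ### Structure of the collocation matrix and error bounds -/

section Main

variable {N M₁ : ℕ} {p : ℕ → ℝ} {φ : ℝ → ℝ} {d : ℕ → ℤ → ℝ} {α : Fin 5 → ℝ}

lemma IsCoiflet.colMatrix_apply (hφ : IsCoiflet N M₁ p φ) (j : ℕ) (l k : Fin (2 ^ j + 1)) :
    colMatrix N M₁ φ d α j l k =
      (if l = k then α 4 else 0) + lowerOp α (ΦInt N M₁ φ d 1 j k) (node j l) := by
  rw [hφ.ΦInt_eq_multInt 1, lowerOp_multInt_one]
  simp only [← hφ.ΦInt_eq_multInt, colMatrix, Matrix.of_apply]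
  ring

lemma IsCoiflet.colMatrix_eq (hφ : IsCoiflet N M₁ p φ) (hN0 : 0 < N) :
    ∃ K : ℝ, ∀ j : ℕ, 3 * N - 2 ≤ 2 ^ j →
      ∃ M : Matrix (Fin (2 ^ j + 1)) (Fin (2 ^ j + 1)) ℝ,
        colMatrix N M₁ φ d α j = α 4 • 1 + ((2 : ℝ) ^ j)⁻¹ • M ∧ ∀ l k, |M l k| ≤ K := by
  obtain ⟨C, hC0, hC⟩ := hφ.exists_sum_abs_ΦInt_le hN0 d
  refine ⟨4 * (|α 0| + |α 1| + |α 2| + |α 3|) * (6 * N * C), fun j hj => ?_⟩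
  have h2j : (0 : ℝ) < 2 ^ j := by positivity
  refine ⟨Matrix.of fun l k => 2 ^ j * lowerOp α (ΦInt N M₁ φ d 1 j k) (node j l), ?_, ?_⟩
  · ext l k
    rw [hφ.colMatrix_apply, Matrix.add_apply, Matrix.smul_apply, Matrix.smul_apply,
      Matrix.one_apply, Matrix.of_apply, smul_eq_mul, smul_eq_mul, mul_ite, mul_one, mul_zero]
    field_simp
  · intro l k
    have h1 : ∀ x ∈ Icc (0 : ℝ) 1, |ΦInt N M₁ φ d 1 j k x| ≤ 6 * N * C * ((2 : ℝ) ^ j)⁻¹ := by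
      intro x hx
      rw [hφ.ΦInt_eq_multInt 1]
      exact (intervalIntegral.abs_integral_le_integral_abs hx.1).trans
        (hφ.integral_abs_ΦInt_le hC0 (hC j hj) (Nat.lt_succ_iff.1 k.2) le_rfl hx.1 hx.2)
    have h2 := abs_lowerOp_le (α := α) h1 (node_mem j l)
    rw [Matrix.of_apply, abs_mul, abs_of_pos h2j]
    calc 2 ^ j * _ ≤ 2 ^ j * _ := mul_le_mul_of_nonneg_left h2 h2j.le
      _ = _ := by field_simp

/-- The error in terms of a bound of the residual. -/
lemma vecNorm_sub_le_of_residual {f : ℝ → ℝ} {a₀ a₁ b₀ b₁ : ℝ} {j : ℕ}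
    (hA : IsUnit (colMatrix N M₁ φ d α j)) {U V : Fin (2 ^ j + 1) → ℝ}
    (hV : IsWICMSolution N M₁ φ d α f a₀ a₁ b₀ b₁ j V) {c : ℝ} (hc : 0 ≤ c)
    (hres : ∀ l, |(colMatrix N M₁ φ d α j *ᵥ U - colRhs α f a₀ a₁ b₀ b₁ j) l| ≤ c) :
    vecNorm (U - V) ≤ √(2 ^ j + 1) * c * matNorm (colMatrix N M₁ φ d α j)⁻¹ := by
  rw [sub_eq_inv_mulVec hA hV]
  refine (vecNorm_mulVec_le _ _).trans ?_
  rw [mul_comm]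
  refine mul_le_mul_of_nonneg_right ?_ (matNorm_nonneg _)
  have h := vecNorm_le_of_abs_le hc hres
  push_cast at h
  exact h

lemma IsCoiflet.error_bound (hφ : IsCoiflet N M₁ p φ) (hN0 : 0 < N) (hd : IsIntegerDerivs N p φ d)
    (hS₀ : IsUnit (1 - S₀ N M₁ d)) (hS₁ : IsUnit (1 - S₁ N M₁ d)) {f : ℝ → ℝ} {a₀ a₁ b₀ b₁ : ℝ}
    {u : ℝ → ℝ} (hu : IsSolution α f a₀ a₁ b₀ b₁ u)
    (hcd : ContDiffOn ℝ (N + 4 : ℕ) u (Icc 0 1)) :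
    ∃ C, 0 ≤ C ∧ ∀ j : ℕ, 3 * N - 2 ≤ 2 ^ j →
      (∀ l, |(colMatrix N M₁ φ d α j *ᵥ exactNodal u j - colRhs α f a₀ a₁ b₀ b₁ j) l| ≤
        C * ((2 : ℝ) ^ (j * N))⁻¹) ∧
      (IsUnit (colMatrix N M₁ φ d α j) →
        ∀ V, IsWICMSolution N M₁ φ d α f a₀ a₁ b₀ b₁ j V →
          vecNorm (exactNodal u j - V) / √(2 ^ j + 1)
            ≤ C * ((2 : ℝ) ^ (j * N))⁻¹ * matNorm (colMatrix N M₁ φ d α j)⁻¹) := by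
  obtain ⟨C, hC0, hC⟩ := hφ.consistency (α := α) hN0 hd hS₀ hS₁ hu hcd
  refine ⟨C, hC0, fun j hj => ⟨hC j hj, fun hA V hV => ?_⟩⟩
  have h := vecNorm_sub_le_of_residual hA hV (by positivity) (hC j hj)
  rw [div_le_iff₀ (Real.sqrt_pos.2 (by positivity))]
  exact h.trans (le_of_eq (by ring))

lemma IsCoiflet.error_bound_of_holder (hφ : IsCoiflet N M₁ p φ) (hN : Even N) (hN0 : 0 < N)
    (hd : IsIntegerDerivs N p φ d) (hS₀ : IsUnit (1 - S₀ N M₁ d)) (hS₁ : IsUnit (1 - S₁ N M₁ d))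
    {f : ℝ → ℝ} {a₀ a₁ b₀ b₁ : ℝ} {u : ℝ → ℝ} (hu : IsSolution α f a₀ a₁ b₀ b₁ u)
    (hcd : ContDiffOn ℝ (N + 4 : ℕ) u (Icc 0 1))
    (hL : ∃ L, HolderOnWith L (1 / 2) (iteratedDerivWithin (N + 4) u (Icc 0 1)) (Icc 0 1)) :
    ∃ C, 0 ≤ C ∧ ∀ j : ℕ, 3 * N - 2 ≤ 2 ^ j → IsUnit (colMatrix N M₁ φ d α j) →
      ∀ V, IsWICMSolution N M₁ φ d α f a₀ a₁ b₀ b₁ j V →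
        vecNorm (exactNodal u j - V)
          ≤ C * ((2 : ℝ) ^ (j * N))⁻¹ * matNorm (colMatrix N M₁ φ d α j)⁻¹ := by
  obtain ⟨L, hL⟩ := hL
  obtain ⟨C, hC0, hC⟩ := hφ.superconsistency (α := α) hN hN0 hd hS₀ hS₁ hu hcd L.2
    fun x hx y hy => by
      have h := hL.dist_le hx hy
      rw [Real.dist_eq, Real.dist_eq] at h
      rw [Real.sqrt_eq_rpow]
      simpa using h
  refine ⟨2 * C, by positivity, fun j hj hA V hV => ?_⟩
  refine (vecNorm_sub_le_of_residual hA hV (by positivity) (hC j hj)).trans ?_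
  refine mul_le_mul_of_nonneg_right ?_ (matNorm_nonneg _)
  -- The extra 2^{-j/2} in the residual absorbs the number of nodes.
  have h1 : √(2 ^ j + 1) * √(((2 : ℝ) ^ j)⁻¹) ≤ 2 := by
    rw [← Real.sqrt_mul (by positivity), Real.sqrt_le_left (by norm_num),
      ← div_eq_mul_inv, div_le_iff₀ (by positivity)]
    have : (1 : ℝ) ≤ 2 ^ j := one_le_pow₀ (by norm_num)
    linarith
  calc √(2 ^ j + 1) * (C * ((2 : ℝ) ^ (j * N))⁻¹ * √((2 ^ j)⁻¹))
      = (√(2 ^ j + 1) * √(((2 : ℝ) ^ j)⁻¹)) * (C * ((2 : ℝ) ^ (j * N))⁻¹) := by ring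
    _ ≤ 2 * (C * ((2 : ℝ) ^ (j * N))⁻¹) := mul_le_mul_of_nonneg_right h1 (by positivity)
    _ = 2 * C * ((2 : ℝ) ^ (j * N))⁻¹ := by ring

lemma existsUnique_isWICMSolution {j : ℕ} (hA : IsUnit (colMatrix N M₁ φ d α j)) (f : ℝ → ℝ)
    (a₀ a₁ b₀ b₁ : ℝ) : ∃! V, IsWICMSolution N M₁ φ d α f a₀ a₁ b₀ b₁ j V := by
  simp only [isWICMSolution_iff]
  refine ⟨(colMatrix N M₁ φ d α j)⁻¹ *ᵥ colRhs α f a₀ a₁ b₀ b₁ j, ?_, fun V hV => ?_⟩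
  · simp only
    rw [Matrix.mulVec_mulVec, Matrix.mul_nonsing_inv _ ((Matrix.isUnit_iff_isUnit_det _).1 hA),
      Matrix.one_mulVec]
  · rw [← hV, Matrix.mulVec_mulVec,
      Matrix.nonsing_inv_mul _ ((Matrix.isUnit_iff_isUnit_det _).1 hA), Matrix.one_mulVec]

end Main

end WICM

end

theorem mainTheorem2 (N M₁ : ℕ) (hN : Even N) (hN0 : 0 < N)
    (p : ℕ → ℝ) (φ : ℝ → ℝ) (hφ : WICM.IsCoiflet N M₁ p φ)
    (d : ℕ → ℤ → ℝ) (hd : WICM.IsIntegerDerivs N p φ d)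
    (hS₀ : IsUnit (1 - WICM.S₀ N M₁ d)) (hS₁ : IsUnit (1 - WICM.S₁ N M₁ d))
    (α : Fin 5 → ℝ) (hα : α 4 ≠ 0) :
    -- the collocation matrix is `α₄ I + 2^{-j} M` with entries of `M` bounded uniformly in `j`
    (∃ K : ℝ, ∀ j : ℕ, 3 * N - 2 ≤ 2 ^ j →
      ∃ M : Matrix (Fin (2 ^ j + 1)) (Fin (2 ^ j + 1)) ℝ,
        WICM.colMatrix N M₁ φ d α j = α 4 • 1 + ((2 : ℝ) ^ j)⁻¹ • M ∧ ∀ l k, |M l k| ≤ K) ∧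
    -- consistency and error bounds in terms of `‖A⁻¹‖₂`
    (∀ (f : ℝ → ℝ) (a₀ a₁ b₀ b₁ : ℝ) (u : ℝ → ℝ), WICM.IsSolution α f a₀ a₁ b₀ b₁ u →
      ContDiffOn ℝ ((N + 4 : ℕ) : WithTop ℕ∞) u (Set.Icc 0 1) →
      (∃ C : ℝ, ∀ j : ℕ, 3 * N - 2 ≤ 2 ^ j →
        (∀ l, |(WICM.colMatrix N M₁ φ d α j *ᵥ WICM.exactNodal u j
            - WICM.colRhs α f a₀ a₁ b₀ b₁ j) l| ≤ C * ((2 : ℝ) ^ (j * N))⁻¹) ∧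
        (IsUnit (WICM.colMatrix N M₁ φ d α j) →
          ∀ Ubar, WICM.IsWICMSolution N M₁ φ d α f a₀ a₁ b₀ b₁ j Ubar →
            WICM.vecNorm (WICM.exactNodal u j - Ubar) / √(2 ^ j + 1)
              ≤ C * ((2 : ℝ) ^ (j * N))⁻¹ * WICM.matNorm (WICM.colMatrix N M₁ φ d α j)⁻¹)) ∧
      ((∃ L, HolderOnWith L (1 / 2) (iteratedDerivWithin (N + 4) u (Set.Icc 0 1)) (Set.Icc 0 1)) →
        ∃ C : ℝ, ∀ j : ℕ, 3 * N - 2 ≤ 2 ^ j → IsUnit (WICM.colMatrix N M₁ φ d α j) →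
          ∀ Ubar, WICM.IsWICMSolution N M₁ φ d α f a₀ a₁ b₀ b₁ j Ubar →
            WICM.vecNorm (WICM.exactNodal u j - Ubar)
              ≤ C * ((2 : ℝ) ^ (j * N))⁻¹ * WICM.matNorm (WICM.colMatrix N M₁ φ d α j)⁻¹)) ∧
    -- stability and convergence of order `N` for uniquely solvable problems
    ((∀ w : ℝ → ℝ, WICM.IsSolution α (fun _ => 0) 0 0 0 0 w → ∀ x ∈ Set.Icc (0 : ℝ) 1, w x = 0) →
      (∃ (B : ℝ) (j₀ : ℕ), ∀ j ≥ j₀, IsUnit (WICM.colMatrix N M₁ φ d α j) ∧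
        WICM.matNorm (WICM.colMatrix N M₁ φ d α j)⁻¹ ≤ B) ∧
      (∀ (f : ℝ → ℝ) (a₀ a₁ b₀ b₁ : ℝ) (u : ℝ → ℝ), WICM.IsSolution α f a₀ a₁ b₀ b₁ u →
        ContDiffOn ℝ ((N + 4 : ℕ) : WithTop ℕ∞) u (Set.Icc 0 1) →
        (∃ (C : ℝ) (j₀ : ℕ), ∀ j ≥ j₀,
          (∃! Ubar, WICM.IsWICMSolution N M₁ φ d α f a₀ a₁ b₀ b₁ j Ubar) ∧
          ∀ Ubar, WICM.IsWICMSolution N M₁ φ d α f a₀ a₁ b₀ b₁ j Ubar →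
            WICM.vecNorm (WICM.exactNodal u j - Ubar) / √(2 ^ j + 1)
              ≤ C * ((2 : ℝ) ^ (j * N))⁻¹) ∧
        ((∃ L, HolderOnWith L (1 / 2) (iteratedDerivWithin (N + 4) u (Set.Icc 0 1))
            (Set.Icc 0 1)) →
          ∃ (C : ℝ) (j₀ : ℕ), ∀ j ≥ j₀,
            ∀ Ubar, WICM.IsWICMSolution N M₁ φ d α f a₀ a₁ b₀ b₁ j Ubar →
              WICM.vecNorm (WICM.exactNodal u j - Ubar) ≤ C * ((2 : ℝ) ^ (j * N))⁻¹))) := by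
  refine ⟨hφ.colMatrix_eq hN0, ?_, ?_⟩
  · intro f a₀ a₁ b₀ b₁ u hu hcd
    obtain ⟨C, -, hC⟩ := hφ.error_bound (α := α) hN0 hd hS₀ hS₁ hu hcd
    refine ⟨⟨C, hC⟩, fun hL => ?_⟩
    obtain ⟨C', -, hC'⟩ := hφ.error_bound_of_holder (α := α) hN hN0 hd hS₀ hS₁ hu hcd hL
    exact ⟨C', hC'⟩
  · intro huniq
    obtain ⟨B, j₀, hB⟩ := hφ.stability hN0 hd hS₀ hS₁ hα huniq
    have hlevel : ∀ j ≥ 3 * N, 3 * N - 2 ≤ 2 ^ j := fun j hj => by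
      have : j < 2 ^ j := Nat.lt_two_pow_self
      omega
    refine ⟨⟨B, j₀, hB⟩, fun f a₀ a₁ b₀ b₁ u hu hcd => ?_⟩
    have hmono : ∀ C : ℝ, 0 ≤ C → ∀ j ≥ j₀, C * ((2 : ℝ) ^ (j * N))⁻¹ *
        WICM.matNorm (WICM.colMatrix N M₁ φ d α j)⁻¹ ≤ C * B * ((2 : ℝ) ^ (j * N))⁻¹ := by
      intro C hC j hj
      rw [mul_right_comm C B]
      exact mul_le_mul_of_nonneg_left (hB j hj).2 (by positivity)
    constructor
    · obtain ⟨C, hC0, hC⟩ := hφ.error_bound (α := α) hN0 hd hS₀ hS₁ hu hcd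
      refine ⟨C * B, max j₀ (3 * N), fun j hj => ?_⟩
      have hj₀ : j ≥ j₀ := (le_max_left _ _).trans hj
      have hjN := hlevel j ((le_max_right _ _).trans hj)
      exact ⟨WICM.existsUnique_isWICMSolution (hB j hj₀).1 f a₀ a₁ b₀ b₁, fun V hV =>
        ((hC j hjN).2 (hB j hj₀).1 V hV).trans (hmono C hC0 j hj₀)⟩
    · intro hL
      obtain ⟨C, hC0, hC⟩ := hφ.error_bound_of_holder (α := α) hN hN0 hd hS₀ hS₁ hu hcd hL
      refine ⟨C * B, max j₀ (3 * N), fun j hj V hV => ?_⟩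
      have hj₀ : j ≥ j₀ := (le_max_left _ _).trans hj
      have hjN := hlevel j ((le_max_right _ _).trans hj)
      exact (hC j hjN (hB j hj₀).1 V hV).trans (hmono C hC0 j hj₀)
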